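/- **Setting.** Let $N\ge 3$, let $\Omega\subset\mathbb R^N$ be a bounded domain (nonempty, open, connected) locally located on one side of its Lipschitz boundary, and let $T>0$. Let $Z=Y=(0,1)^N$, and let $\Theta\subset Z$ be a compact set with smooth boundary (lying locally on one side of it) and nonempty interior, such that $Z^*=Z\setminus\Theta$ is connected and has nonzero Lebesgue measure. For $\varepsilon>0$ put $$t^\varepsilon=\{k\in\mathbb Z^N:\ \varepsilon^2(k+\Theta)\subset\Omega\},\qquad \Omega^\varepsilon=\Omega\setminus\bigcup_{k\in t^\varepsilon}\varepsilon^2(k+\Theta),$$ and let $V_\varepsilon=\{u\in H^1(\Omega^\varepsilon): u=0\text{ on }\partial\Omega\}$ (the closure in $H^1(\Omega^\varepsilon)$ of the restrictions of functions in $C_c^\infty(\Omega)$), with the gradient norm $\|u\|_{V_\varepsilon}=\|\nabla u\|_{L^2(\Omega^\varepsilon)^N}$; its dual $V_\varepsilon'$ carries the dual norm. **Assumptions on the data.** * (A1) $A=(a_{ij})\in L^\infty(\mathbb R^N\times\mathbb R^N)^{N\times N}$ is real and symmetric, and there is $\Lambda>0$ with $\|a_{ij}\|_{L^\infty}\le\Lambda$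 for all $i,j$ and $\sum_{i,j}a_{ij}(y,z)\zeta_i\zeta_j\ge\Lambda^{-1}|\zeta|^2$ for a.e. $(y,z)$ and all $\zeta\in\mathbb R^N$. Moreover $A$ is given by a function such that, for every $\varepsilon>0$, the matrix $A^\varepsilon(x)=A(x/\varepsilon,x/\varepsilon^2)$ is measurable, symmetric and satisfies the same bounds for a.e. $x\in\mathbb R^N$ (this is automatic if $A$ is a Borel function satisfying the conditions everywhere). * (A2) $\rho\in\mathcal C^1(\mathbb R^N)$, $\rho\ge0$; $\beta\in L^\infty(\mathbb R^N\times\mathbb R)$ and $\beta\ge\alpha$ a.e. for a constant $\alpha>0$. * (A3) $\beta(y,\tau)$ is $Y\times(0,1)$-periodic, each $a_{ij}$ is $Y\times Z$-periodic, $\rho$ is $Z$-periodic, and $\int_{Z^*}\rho\,dz>0$. Let $f\in L^2(0,T;L^2(\Omega))$, $u^0\in H^1_0(\Omega)$, $v^0\in L^2(\Omega)$. Write $\rho^\varepsilon(x)=\rho(x/\varepsilon^2)$ and $\beta^\varepsilon(x,t)=\beta(x/\varepsilon,t/\varepsilon^2)$. **The problem.** For $\varepsilon>0$ let $u_\varepsilon$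 be the weak solution of $$\rho^\varepsilon u_\varepsilon''+\beta^\varepsilon u_\varepsilon'-\operatorname{div}(A^\varepsilon\nabla u_\varepsilon)=f\ \text{ in }\Omega^\varepsilon\times(0,T),\qquad A^\varepsilon\nabla u_\varepsilon\cdot\nu_\varepsilon=0\ \text{ on }(\partial\Omega^\varepsilon\setminus\partial\Omega)\times(0,T),\qquad u_\varepsilon=0\ \text{ on }(\partial\Omega^\varepsilon\cap\partial\Omega)\times(0,T),$$ $$u_\varepsilon(0)=u^0,\qquad \rho^\varepsilon u_\varepsilon'(0)=\sqrt{\rho^\varepsilon}\,v^0\quad\text{in }\Omega^\varepsilon,$$ that is: $u_\varepsilon\in L^\infty(0,T;V_\varepsilon)$, $u_\varepsilon'\in L^2(0,T;L^2(\Omega^\varepsilon))$, $\sqrt{\rho^\varepsilon}u_\varepsilon'\in L^\infty(0,T;L^2(\Omega^\varepsilon))$ and $\rho^\varepsilon u_\varepsilon''=(\rho^\varepsilon u_\varepsilon')'\in L^2(0,T;V_\varepsilon')$, where the derivatives in $t$ are weak derivatives; for a.e. $t\in(0,T)$ and all $v\in V_\varepsilon$, $$\langle\rho^\varepsilon u_\varepsilon''(t),v\rangle+\int_{\Omega^\varepsilon}\beta^\varepsilon(t)u_\varepsilon'(t)v\,dx+\int_{\Omega^\varepsilon}A^\varepsilon\nabla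 u_\varepsilon(t)\cdot\nabla v\,dx=\int_{\Omega^\varepsilon}f(t)v\,dx;$$ and the initial conditions hold for the representatives of $u_\varepsilon$ and $\rho^\varepsilon u_\varepsilon'$ that are continuous on $[0,T]$ with values in $L^2(\Omega^\varepsilon)$ and $V_\varepsilon'$, respectively. **Proposition.** There is a constant $C>0$, independent of $\varepsilon$, such that for every $\varepsilon>0$ $$\|u_\varepsilon\|_{L^\infty(0,T;V_\varepsilon)}\le C,\qquad \|\sqrt{\rho^\varepsilon}\,u_\varepsilon'\|_{L^\infty(0,T;L^2(\Omega^\varepsilon))}\le C,$$ $$\|u_\varepsilon'\|_{L^2(0,T;L^2(\Omega^\varepsilon))}\le C,\qquad \|\rho^\varepsilon u_\varepsilon''\|_{L^2(0,T;V_\varepsilon')}\le C.$$ -/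

import Mathlib

open MeasureTheory Set

/-- The numerical space `ℝ^N` with its Euclidean norm and Lebesgue measure. -/
abbrev Space (N : ℕ) : Type := EuclideanSpace ℝ (Fin N)

/-- The Lebesgue space `L²(U)` of real-valued functions. -/
abbrev L2 {N : ℕ} (U : Set (Space N)) : Type := Lp ℝ 2 (volume.restrict U)

/-- The Lebesgue space `L²(U)^N` of vector fields. -/
abbrev L2Vec {N : ℕ} (U : Set (Space N)) : Type := Lp (Space N) 2 (volume.restrict U)

/-- The Lebesgue measure on the time interval `(0, T)`. -/
noncomputable abbrev timeMeasure (T : ℝ) : Measure ℝ := volume.restrict (Ioo 0 T)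

/-- The point of `ℝ^N` with the integer coordinates `k`. -/
noncomputable def latticePoint {N : ℕ} (k : Fin N → ℤ) : Space N :=
  WithLp.toLp 2 fun i => (k i : ℝ)

/-- The open unit cube `(0,1)^N`. -/
def unitCube (N : ℕ) : Set (Space N) := {z | ∀ i, z i ∈ Ioo (0 : ℝ) 1}

/-! ### Regularity of boundaries -/

/-- Inside the ball of radius `r` around `x₀`, the set `U` is the part strictly above the graph of
`γ`, the vertical direction being the unit vector `n`; the horizontal part of `x` is
`x - ⟪n, x⟫ n`. -/
def IsAboveGraphNear {N : ℕ} (U : Set (Space N)) (x₀ : Space N) (r : ℝ) (n : Space N)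
    (γ : Space N → ℝ) : Prop :=
  ∀ x ∈ Metric.ball x₀ r, x ∈ U ↔ γ (x - inner ℝ n x • n) < inner ℝ n x

/-- The set `U` has a Lipschitz boundary and is locally located on one side of it. -/
def HasLipschitzBoundary {N : ℕ} (U : Set (Space N)) : Prop :=
  ∀ x₀ ∈ frontier U, ∃ r > 0, ∃ n : Space N, ‖n‖ = 1 ∧ ∃ γ : Space N → ℝ,
    (∃ L, LipschitzWith L γ) ∧ IsAboveGraphNear U x₀ r n γ

/-- The set `U` has a smooth (`C^∞`) boundary and is locally located on one side of it. -/
def HasSmoothBoundary {N : ℕ} (U : Set (Space N)) : Prop :=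
  ∀ x₀ ∈ frontier U, ∃ r > 0, ∃ n : Space N, ‖n‖ = 1 ∧ ∃ γ : Space N → ℝ,
    ContDiff ℝ (⊤ : ℕ∞) γ ∧ IsAboveGraphNear U x₀ r n γ

/-! ### The perforated domain -/

/-- The reference hole `Θ`: a compact subset of the open unit cube `Z` with smooth boundary and
nonempty interior, such that the perforated cell `Z \ Θ` is connected and of nonzero measure. -/
structure IsReferenceHole {N : ℕ} (Θ : Set (Space N)) : Prop where
  compact : IsCompact Θ
  subset_cube : Θ ⊆ unitCube N
  smooth : HasSmoothBoundary Θᶜ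
  interior_nonempty : (interior Θ).Nonempty
  volume_cell_ne_zero : volume (unitCube N \ Θ) ≠ 0
  cell_connected : IsConnected (unitCube N \ Θ)

/-- The hole `ε² (k + Θ)`. -/
def scaledHole {N : ℕ} (Θ : Set (Space N)) (ε : ℝ) (k : Fin N → ℤ) : Set (Space N) :=
  (fun z => ε ^ 2 • (latticePoint k + z)) '' Θ

/-- The perforated domain `Ω^ε`: all the holes `ε² (k + Θ)` contained in `Ω` are removed. -/
def perforated {N : ℕ} (Ω Θ : Set (Space N)) (ε : ℝ) : Set (Space N) :=
  Ω \ ⋃ k ∈ {k : Fin N → ℤ | scaledHole Θ ε k ⊆ Ω}, scaledHole Θ ε k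

/-! ### Sobolev spaces of functions vanishing on the outer boundary -/

/-- The pairs `(φ, ∇φ)`, restricted to `U`, for `φ ∈ C_c^∞(Ω)`, as a subspace of the Hilbert space
`L²(U) × L²(U)^N`. -/
def testGraph {N : ℕ} (Ω U : Set (Space N)) : Submodule ℝ (WithLp 2 (L2 U × L2Vec U)) where
  carrier := {p | ∃ φ : Space N → ℝ, ContDiff ℝ (⊤ : ℕ∞) φ ∧ HasCompactSupport φ ∧
    tsupport φ ⊆ Ω ∧ p.fst =ᵐ[volume.restrict U] φ ∧ p.snd =ᵐ[volume.restrict U] gradient φ}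
  zero_mem' := by
    refine ⟨0, contDiff_const, HasCompactSupport.zero, ?_, Lp.coeFn_zero _ _ _, ?_⟩
    · simp [tsupport]
    · filter_upwards [Lp.coeFn_zero (Space N) 2 (volume.restrict U)] with x hx
      have h0 : gradient (0 : Space N → ℝ) x = 0 := by simp [gradient]
      rw [h0]
      exact hx
  add_mem' := by
    rintro p q ⟨φ, hφ, hφc, hφs, h1, h2⟩ ⟨ψ, hψ, hψc, hψs, h3, h4⟩
    refine ⟨φ + ψ, hφ.add hψ, hφc.add hψc,
      (tsupport_add φ ψ).trans (union_subset hφs hψs), ?_, ?_⟩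
    · filter_upwards [Lp.coeFn_add p.fst q.fst, h1, h3] with x hx a b
      simpa [a, b] using hx
    · filter_upwards [Lp.coeFn_add p.snd q.snd, h2, h4] with x hx a b
      have hd : gradient (φ + ψ) x = gradient φ x + gradient ψ x := by
        simp only [gradient]
        rw [fderiv_add (hφ.differentiable (by simp) x) (hψ.differentiable (by simp) x), map_add]
      rw [hd]
      simpa [a, b] using hx
  smul_mem' := by
    rintro c p ⟨φ, hφ, hφc, hφs, h1, h2⟩
    refine ⟨c • φ, hφ.const_smul c, hφc.smul_left (f := fun _ => c), ?_, ?_, ?_⟩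
    · exact (closure_mono (Function.support_const_smul_subset c φ)).trans hφs
    · filter_upwards [Lp.coeFn_smul c p.fst, h1] with x hx a
      simpa [a] using hx
    · filter_upwards [Lp.coeFn_smul c p.snd, h2] with x hx a
      have hd : gradient (c • φ) x = c • gradient φ x := by
        simp only [gradient]
        rw [fderiv_const_smul (hφ.differentiable (by simp) x), map_smul]
      rw [hd]
      simpa [a] using hx

/-- For `U ⊆ Ω`, the closure in `H¹(U)` of the restrictions to `U` of the functions of
`C_c^∞(Ω)`, a function `u` being recorded together with its weak gradient as `(u, ∇u)`.
For `U = Ω` this is `H¹₀(Ω)`. For the perforated domain `U = Ω^ε` this is the space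
`V_ε = {u ∈ H¹(Ω^ε) : u = 0 on ∂Ω}`; no condition is imposed on the boundary of the holes.
The topology is that of `H¹(U)`. On `V_ε` the gradient norm `‖∇u‖_{L²}` is an equivalent norm;
it is `‖VSpace.grad u‖`, and the corresponding norm on the dual is `gradDualNorm`. -/
abbrev VSpace {N : ℕ} (Ω U : Set (Space N)) : Type :=
  ↥(testGraph Ω U).topologicalClosure

/-- The function `u ∈ L²(U)` underlying an element of the Sobolev space. -/
noncomputable def VSpace.fn {N : ℕ} {Ω U : Set (Space N)} : VSpace Ω U →L[ℝ] L2 U :=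
  (WithLp.fstL 2 ℝ (L2 U) (L2Vec U)).comp (testGraph Ω U).topologicalClosure.subtypeL

/-- The weak gradient `∇u ∈ L²(U)^N` of an element of the Sobolev space. -/
noncomputable def VSpace.grad {N : ℕ} {Ω U : Set (Space N)} : VSpace Ω U →L[ℝ] L2Vec U :=
  (WithLp.sndL 2 ℝ (L2 U) (L2Vec U)).comp (testGraph Ω U).topologicalClosure.subtypeL

/-- The norm of a functional dual to the gradient norm: `sup {|F v| : ‖∇v‖_{L²} ≤ 1}`. -/
noncomputable def gradDualNorm {N : ℕ} {Ω U : Set (Space N)} (F : StrongDual ℝ (VSpace Ω U)) :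
    ENNReal :=
  ⨆ (v : VSpace Ω U) (_ : ‖VSpace.grad v‖ ≤ 1), ‖F v‖ₑ

/-! ### The coefficients -/

/-- The matrix field `B` on the measure space `X` is measurable, symmetric, has entries bounded
by `Λ` and satisfies `B ζ · ζ ≥ Λ⁻¹ |ζ|²`, almost everywhere. -/
structure IsUniformlyElliptic {N : ℕ} {X : Type} [MeasureSpace X]
    (B : X → Matrix (Fin N) (Fin N) ℝ) (Λ : ℝ) : Prop where
  measurable : ∀ i j, AEStronglyMeasurable (fun x => B x i j) volume
  symm : ∀ᵐ x, (B x).IsSymm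
  bound : ∀ i j, ∀ᵐ x, |B x i j| ≤ Λ
  coercive : ∀ᵐ x, ∀ ζ : Space N, Λ⁻¹ * ‖ζ‖ ^ 2 ≤ ∑ i, ∑ j, B x i j * ζ i * ζ j

/-- The oscillating matrix `A^ε(x) = A(x/ε, x/ε²)`. -/
noncomputable def oscA {N : ℕ} (A : Space N × Space N → Matrix (Fin N) (Fin N) ℝ) (ε : ℝ)
    (x : Space N) : Matrix (Fin N) (Fin N) ℝ :=
  A (ε⁻¹ • x, (ε ^ 2)⁻¹ • x)

/-- The oscillating function `ρ^ε(x) = ρ(x/ε²)`. -/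
noncomputable def oscRho {N : ℕ} (ρ : Space N → ℝ) (ε : ℝ) (x : Space N) : ℝ :=
  ρ ((ε ^ 2)⁻¹ • x)

/-- The oscillating function `β^ε(x, t) = β(x/ε, t/ε²)`. -/
noncomputable def oscBeta {N : ℕ} (β : Space N × ℝ → ℝ) (ε : ℝ) (x : Space N) (t : ℝ) : ℝ :=
  β (ε⁻¹ • x, t / ε ^ 2)

/-- Assumption A1 on the matrix `A`. As `A` is evaluated on the null set
`{(x/ε, x/ε²)}`, the oscillating matrices `A^ε` that it defines have to be measurable and subject
to the same bounds almost everywhere in `ℝ^N` (which is automatic if `A` is a Borel function that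
satisfies the bounds everywhere). -/
structure AssumptionA1 {N : ℕ} (A : Space N × Space N → Matrix (Fin N) (Fin N) ℝ) (Λ : ℝ) :
    Prop where
  pos : 0 < Λ
  elliptic : IsUniformlyElliptic A Λ
  elliptic_osc : ∀ ε > 0, IsUniformlyElliptic (oscA A ε) Λ

/-- Assumption A2 on `ρ` and `β`. -/
structure AssumptionA2 {N : ℕ} (ρ : Space N → ℝ) (β : Space N × ℝ → ℝ) (α : ℝ) : Prop where
  rho_contDiff : ContDiff ℝ 1 ρ
  rho_nonneg : ∀ z, 0 ≤ ρ z
  beta_memLp : MemLp β ⊤ volume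
  pos : 0 < α
  beta_lower : ∀ᵐ p, α ≤ β p

/-- Assumption A3: periodicity, and positivity of the integral of `ρ` on the perforated cell. -/
structure AssumptionA3 {N : ℕ} (Θ : Set (Space N))
    (A : Space N × Space N → Matrix (Fin N) (Fin N) ℝ)
    (ρ : Space N → ℝ) (β : Space N × ℝ → ℝ) : Prop where
  beta_periodic : ∀ (k : Fin N → ℤ) (l : ℤ),
    ∀ᵐ p : Space N × ℝ, β (p.1 + latticePoint k, p.2 + l) = β p
  matrix_periodic : ∀ k l : Fin N → ℤ,
    ∀ᵐ p : Space N × Space N, A (p.1 + latticePoint k, p.2 + latticePoint l) = A p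
  rho_periodic : ∀ (k : Fin N → ℤ) (z : Space N), ρ (z + latticePoint k) = ρ z
  rho_mean_pos : 0 < ∫ z in unitCube N \ Θ, ρ z

/-! ### Solutions of the evolution problem -/

/-- `φ ∈ C_c^∞((0, T))`. -/
def IsTimeTest (T : ℝ) (φ : ℝ → ℝ) : Prop :=
  ContDiff ℝ (⊤ : ℕ∞) φ ∧ HasCompactSupport φ ∧ tsupport φ ⊆ Ioo 0 T

/-- `u` is the (weak) solution of the hyperbolic-parabolic problem
`ρ^ε u'' + β^ε u' - div (A^ε ∇u) = f` in `Ω^ε × (0, T)`, with `A^ε ∇u · ν = 0` on the boundary of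
the holes, `u = 0` on `∂Ω`, `u(0) = u⁰` and `ρ^ε u'(0) = √ρ^ε v⁰`. Here `U = Ω^ε`, the space `V_ε`
is `VSpace Ω U`, `du` is the time derivative `u'`, and `rddu` is `ρ^ε u''`, the time derivative
of `ρ^ε u'` with values in the dual `V_ε'`. -/
structure IsSolution {N : ℕ} (Ω U : Set (Space N)) (T ε : ℝ)
    (A : Space N × Space N → Matrix (Fin N) (Fin N) ℝ)
    (ρ : Space N → ℝ) (β : Space N × ℝ → ℝ)
    (f : ℝ → L2 Ω) (u₀ : VSpace Ω Ω) (v₀ : L2 Ω)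
    (u : ℝ → VSpace Ω U) (du : ℝ → L2 U) (rddu : ℝ → StrongDual ℝ (VSpace Ω U)) : Prop where
  /-- `u ∈ L^∞(0,T;V_ε)` -/
  u_memLp : MemLp u ⊤ (timeMeasure T)
  /-- `u' ∈ L²(0,T;L²(Ω^ε))` -/
  du_memLp : MemLp du 2 (timeMeasure T)
  /-- `√ρ^ε u' ∈ L^∞(0,T;L²(Ω^ε))` -/
  sqrt_rho_du_bounded :
    eLpNorm (fun t => eLpNorm (fun x => √(oscRho ρ ε x) * du t x) 2 (volume.restrict U)) ⊤
      (timeMeasure T) < ⊤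
  /-- `ρ^ε u'' ∈ L²(0,T;V_ε')` -/
  rddu_memLp : MemLp rddu 2 (timeMeasure T)
  /-- `du` is the weak time derivative of `u` -/
  hasTimeDeriv : ∀ φ : ℝ → ℝ, IsTimeTest T φ →
    ∫ t in Ioo 0 T, deriv φ t • VSpace.fn (u t) = -∫ t in Ioo 0 T, φ t • du t
  /-- `rddu` is the weak time derivative of `ρ^ε u'` -/
  hasSecondTimeDeriv : ∀ φ : ℝ → ℝ, IsTimeTest T φ → ∀ v : VSpace Ω U,
    ∫ t in Ioo 0 T, deriv φ t * ∫ x in U, oscRho ρ ε x * du t x * VSpace.fn v x =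
      -∫ t in Ioo 0 T, φ t * rddu t v
  /-- the equation in `V_ε'`, with the boundary conditions on the holes in variational form -/
  equation : ∀ᵐ t ∂timeMeasure T, ∀ v : VSpace Ω U,
    rddu t v + (∫ x in U, oscBeta β ε x t * du t x * VSpace.fn v x) +
      (∫ x in U, ∑ i, ∑ j, oscA A ε x i j * VSpace.grad (u t) x j * VSpace.grad v x i) =
    ∫ x in U, f t x * VSpace.fn v x
  /-- `u(0) = u⁰`, for the representative of `u` that is continuous with values in `L²(Ω^ε)` -/
  initial_u : ∃ w : ℝ → L2 U, ContinuousOn w (Icc 0 T) ∧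
    (∀ᵐ t ∂timeMeasure T, w t = VSpace.fn (u t)) ∧ w 0 =ᵐ[volume.restrict U] VSpace.fn u₀
  /-- `ρ^ε u'(0) = √ρ^ε v⁰`, for the representative of `ρ^ε u'` that is continuous with values
  in `V_ε'` -/
  initial_du : ∃ g : ℝ → StrongDual ℝ (VSpace Ω U), ContinuousOn g (Icc 0 T) ∧
    (∀ᵐ t ∂timeMeasure T, ∀ v : VSpace Ω U,
      g t v = ∫ x in U, oscRho ρ ε x * du t x * VSpace.fn v x) ∧
    ∀ v : VSpace Ω U, g 0 v = ∫ x in U, √(oscRho ρ ε x) * v₀ x * VSpace.fn v x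

/-! The estimates come from testing the equation with the velocity. Formally the energy `½‖√ρ u'‖² +
½∫ A∇u·∇u` changes at the rate `∫ (f - βu')u'`, and since `β ≥ α > 0`, Young's inequality bounds
this rate by `‖f‖²/(2α) - (α/2)‖u'‖²`. No Gronwall argument is needed. The energy at time `0` is at
most `½‖v⁰‖²` plus a multiple of `‖∇u⁰‖²`, which yields the first three bounds with constants
depending only on the data. The fourth is read off from `ρu'' = f - βu' + div(A∇u)`. The dual norm
is taken with respect to the gradient norm, so the zero-order terms require a Poincaré inequality on
the perforated domains whose constant does not depend on `ε`.

Two points carry the proof. The first is the uniform Poincaré inequality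
`exists_poincare_perforated`. Since `Θ` is compact in the open cube, a grid of slabs around the cell
faces contains no hole. Every slab contains whole lines along another axis, so a function vanishing
outside a ball is controlled there by integration along lines. The control spreads from the slabs
into each perforated cell by translations along segments that avoid the hole: connectedness reaches
interior points, and a push along the normal reaches points near the hole. The translations have
length `ε²|v|`, which is bounded because a removed hole must fit into the bounded set `Ω`; if `ε` is
too large for that, there is no hole.

The second is the energy identity `IsWeakWave.exists_energy_identity`. The velocity lies only in
`L²`, hence is not an admissible test function, and `ρ` may vanish, so that `u'(0)` itself is not
defined. Averaging over a short future interval makes the solution smooth in time and its velocity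
an element of `V_ε`; the identity is then exact, even from time `0`. Applied to differences of
averages it shows that their initial energies form a Cauchy family. The limits are an initial
position with trace `u⁰` and a vector `m` standing for `√ρ u'(0)`. The prescribed data identify `m`
as the orthogonal projection of `v⁰` onto the closure of the range of multiplication by `√ρ`, whence
`‖m‖ ≤ ‖v⁰‖`. -/

section

open Filter Topology

open scoped NNReal ENNReal RealInnerProductSpace

/-! ### Mean squares under translation, and integration along lines -/

/-- Jensen's inequality for the square on a probability space. -/
theorem lintegral_sq_le_lintegral_sq {X : Type*} [MeasurableSpace X] {μ : Measure X}
    [IsProbabilityMeasure μ] {F : X → ℝ≥0∞} (hF : AEMeasurable F μ) :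
    (∫⁻ x, F x ∂μ) ^ 2 ≤ ∫⁻ x, F x ^ 2 ∂μ := by
  have h := ENNReal.lintegral_mul_le_Lp_mul_Lq μ Real.HolderConjugate.two_two hF
    (aemeasurable_const (b := (1 : ℝ≥0∞)))
  simp only [Pi.mul_apply, mul_one, ENNReal.one_rpow, lintegral_const, measure_univ] at h
  calc (∫⁻ x, F x ∂μ) ^ 2 ≤ ((∫⁻ x, F x ^ (2 : ℝ) ∂μ) ^ (1 / 2 : ℝ)) ^ 2 := by gcongr
    _ = ∫⁻ x, F x ^ 2 ∂μ := by
      rw [← ENNReal.rpow_natCast, ← ENNReal.rpow_mul]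
      norm_num

theorem ENNReal.add_sq_le_two_mul (a b : ℝ≥0∞) : (a + b) ^ 2 ≤ 2 * a ^ 2 + 2 * b ^ 2 := by
  have h := ENNReal.rpow_add_le_mul_rpow_add_rpow a b (p := 2) (by norm_num)
  have e : (2 : ℝ≥0∞) ^ ((2 : ℝ) - 1) = 2 := by norm_num
  rw [e, mul_add] at h
  exact_mod_cast h

/-- Fundamental theorem of calculus along the segment from `x` to `x + h`, followed by Jensen on
`(0, 1)`. Working in `ℝ≥0∞` avoids all integrability side conditions later. -/
theorem enorm_sq_le_shift {N : ℕ} {φ : Space N → ℝ} (hφ : ContDiff ℝ 1 φ) (x h : Space N) :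
    ‖φ x‖ₑ ^ 2 ≤ 2 * ‖φ (x + h)‖ₑ ^ 2 +
      2 * ‖h‖ₑ ^ 2 * ∫⁻ s in Ioc (0 : ℝ) 1, ‖fderiv ℝ φ (x + s • h)‖ₑ ^ 2 := by
  have hc : Continuous (fun s : ℝ => fderiv ℝ φ (x + s • h)) :=
    (hφ.continuous_fderiv (by simp)).comp (by fun_prop)
  have hd : ∀ s : ℝ, HasDerivAt (fun s : ℝ => φ (x + s • h)) (fderiv ℝ φ (x + s • h) h) s := by
    intro s
    have h1 : HasDerivAt (fun s : ℝ => x + s • h) h s := by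
      simpa using ((hasDerivAt_id s).smul_const h).const_add x
    exact ((hφ.differentiable (by simp) _).hasFDerivAt).comp_hasDerivAt s h1
  have hI := intervalIntegral.integral_eq_sub_of_hasDerivAt (a := 0) (b := 1)
    (fun s _ => hd s) (((hc.clm_apply continuous_const)).intervalIntegrable 0 1)
  have : IsProbabilityMeasure (volume.restrict (Ioc (0 : ℝ) 1)) := ⟨by simp⟩
  have e : φ x = φ (x + h) + -∫ s in (0 : ℝ)..1, fderiv ℝ φ (x + s • h) h := by
    rw [hI]; simp
  have hb : ‖∫ s in (0 : ℝ)..1, fderiv ℝ φ (x + s • h) h‖ₑ ^ 2 ≤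
      ‖h‖ₑ ^ 2 * ∫⁻ s in Ioc (0 : ℝ) 1, ‖fderiv ℝ φ (x + s • h)‖ₑ ^ 2 := by
    rw [intervalIntegral.integral_of_le zero_le_one]
    calc _ ≤ (∫⁻ s in Ioc (0 : ℝ) 1, ‖fderiv ℝ φ (x + s • h) h‖ₑ) ^ 2 := by
          gcongr; exact enorm_integral_le_lintegral_enorm _
      _ ≤ (∫⁻ s in Ioc (0 : ℝ) 1, ‖h‖ₑ * ‖fderiv ℝ φ (x + s • h)‖ₑ) ^ 2 := by
          gcongr with s
          rw [mul_comm]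
          exact ContinuousLinearMap.le_opENorm _ _
      _ = ‖h‖ₑ ^ 2 * (∫⁻ s in Ioc (0 : ℝ) 1, ‖fderiv ℝ φ (x + s • h)‖ₑ) ^ 2 := by
          rw [lintegral_const_mul _ hc.enorm.measurable, mul_pow]
      _ ≤ _ := by
          gcongr
          exact lintegral_sq_le_lintegral_sq hc.enorm.measurable.aemeasurable
  calc ‖φ x‖ₑ ^ 2 ≤ (‖φ (x + h)‖ₑ + ‖∫ s in (0 : ℝ)..1, fderiv ℝ φ (x + s • h) h‖ₑ) ^ 2 := by
        gcongr
        nth_rewrite 1 [e]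
        refine (enorm_add_le _ _).trans ?_
        rw [enorm_neg]
    _ ≤ _ := (ENNReal.add_sq_le_two_mul _ _)
    _ ≤ _ := by
        rw [mul_assoc]
        gcongr

/-- Comparison of the mean square of a function on a set and on a translate of the set, when the
segments between the points and their translates lie in `W`. -/
theorem lintegral_sq_le_shift {N : ℕ} {φ : Space N → ℝ} (hφ : ContDiff ℝ 1 φ)
    {S W : Set (Space N)} (hS : MeasurableSet S) (hW : MeasurableSet W) (h : Space N)
    (hSW : ∀ x ∈ S, ∀ s ∈ Icc (0 : ℝ) 1, x + s • h ∈ W) :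
    ∫⁻ x in S, ‖φ x‖ₑ ^ 2 ≤ 2 * (∫⁻ x in S, ‖φ (x + h)‖ₑ ^ 2) +
      2 * ‖h‖ₑ ^ 2 * ∫⁻ x in W, ‖fderiv ℝ φ x‖ₑ ^ 2 := by
  have hf : Continuous (fderiv ℝ φ) := hφ.continuous_fderiv (by simp)
  have hm : Measurable (fun p : Space N × ℝ => ‖fderiv ℝ φ (p.1 + p.2 • h)‖ₑ ^ 2) :=
    ((hf.comp (by fun_prop)).enorm.measurable).pow_const 2
  have key : ∫⁻ x in S, ∫⁻ s in Ioc (0 : ℝ) 1, ‖fderiv ℝ φ (x + s • h)‖ₑ ^ 2 ≤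
      ∫⁻ x in W, ‖fderiv ℝ φ x‖ₑ ^ 2 := by
    -- For fixed `s`, the translation by `s • h` preserves the measure and maps `S` into `W`.
    rw [lintegral_lintegral_swap hm.aemeasurable]
    calc _ ≤ ∫⁻ s in Ioc (0 : ℝ) 1, ∫⁻ x in W, ‖fderiv ℝ φ x‖ₑ ^ 2 := by
          refine setLIntegral_mono' measurableSet_Ioc fun s hs => ?_
          rw [← lintegral_indicator hS, ← lintegral_indicator hW,
            ← lintegral_add_right_eq_self (W.indicator _) (s • h)]
          refine lintegral_mono fun x => ?_
          by_cases hx : x ∈ S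
          · rw [indicator_of_mem hx, indicator_of_mem (hSW x hx s ⟨hs.1.le, hs.2⟩)]
          · rw [indicator_of_notMem hx]; exact zero_le
      _ = _ := by simp
  calc _ ≤ ∫⁻ x in S, (2 * ‖φ (x + h)‖ₑ ^ 2 +
        2 * ‖h‖ₑ ^ 2 * ∫⁻ s in Ioc (0 : ℝ) 1, ‖fderiv ℝ φ (x + s • h)‖ₑ ^ 2) :=
        lintegral_mono fun x => enorm_sq_le_shift hφ x h
    _ = 2 * (∫⁻ x in S, ‖φ (x + h)‖ₑ ^ 2) + 2 * ‖h‖ₑ ^ 2 *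
        ∫⁻ x in S, ∫⁻ s in Ioc (0 : ℝ) 1, ‖fderiv ℝ φ (x + s • h)‖ₑ ^ 2 := by
        have hm1 : Measurable (fun x => ‖φ (x + h)‖ₑ ^ 2) :=
          ((hφ.continuous.comp (by fun_prop)).enorm.measurable).pow_const 2
        rw [lintegral_add_left (hm1.const_mul 2), lintegral_const_mul _ hm1,
          lintegral_const_mul _ hm.lintegral_prod_right']
    _ ≤ _ := by gcongr

/-- The Poincaré inequality along the lines in a coordinate direction. -/
theorem lintegral_sq_le_of_line {N : ℕ} {φ : Space N → ℝ} (hφ : ContDiff ℝ 1 φ) {R : ℝ}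
    (hR : 0 < R) (hφR : ∀ x, R ≤ ‖x‖ → φ x = 0)
    {S W : Set (Space N)} (hS : MeasurableSet S) (hW : MeasurableSet W) {e : Space N}
    (he : ‖e‖ = 1) (hSW : ∀ x ∈ S, ∀ s : ℝ, x + s • e ∈ W) :
    ∫⁻ x in S, ‖φ x‖ₑ ^ 2 ≤
      2 * ENNReal.ofReal (2 * R) ^ 2 * ∫⁻ x in W, ‖fderiv ℝ φ x‖ₑ ^ 2 := by
  -- A translation by `2R` moves the ball of radius `R` off itself, so the translated term vanishes
  -- and only the gradient remains.
  have h1 := lintegral_sq_le_shift hφ (hS.inter (Metric.isOpen_ball (x := (0 : Space N))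
    (ε := R)).measurableSet) hW ((2 * R) • e) (fun x hx s _ => by
      rw [smul_smul]; exact hSW x hx.1 _)
  have h2 : ∫⁻ x in S ∩ Metric.ball 0 R, ‖φ (x + (2 * R) • e)‖ₑ ^ 2 = 0 := by
    refine setLIntegral_eq_zero (hS.inter Metric.isOpen_ball.measurableSet) fun x hx => ?_
    have h3 : R ≤ ‖x + (2 * R) • e‖ := by
      have h4 : ‖(2 * R) • e‖ ≤ ‖x + (2 * R) • e‖ + ‖x‖ := by
        simpa using norm_sub_le (x + (2 * R) • e) x
      rw [norm_smul, he, Real.norm_of_nonneg (by linarith)] at h4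
      have h5 : ‖x‖ < R := by simpa using hx.2
      linarith
    simp [hφR _ h3]
  have h3 : ∫⁻ x in S, ‖φ x‖ₑ ^ 2 = ∫⁻ x in S ∩ Metric.ball 0 R, ‖φ x‖ₑ ^ 2 := by
    rw [← lintegral_indicator hS, ← lintegral_indicator (hS.inter Metric.isOpen_ball.measurableSet)]
    refine lintegral_congr fun x => ?_
    by_cases hx : x ∈ S
    · by_cases hx' : x ∈ Metric.ball 0 R
      · rw [indicator_of_mem hx, indicator_of_mem (mem_inter hx hx')]
      · rw [indicator_of_mem hx, indicator_of_notMem (fun h => hx' h.2)]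
        simp [hφR x (by simpa using hx')]
    · rw [indicator_of_notMem hx, indicator_of_notMem (fun h => hx h.1)]
  rw [h2, mul_zero, zero_add, ← h3] at h1
  refine h1.trans_eq ?_
  rw [enorm_smul, ← ofReal_norm e, he, Real.enorm_of_nonneg (by linarith)]
  simp

/-! ### Control by the gradient on the perforated cell, uniformly in the scale -/

/-- The union of the copies `ε² (k + S)`, `k ∈ K`, of the set `S`. -/
def cellUnion {N : ℕ} (ε : ℝ) (K : Set (Fin N → ℤ)) (S : Set (Space N)) : Set (Space N) :=
  ⋃ k ∈ K, (fun x => (ε ^ 2)⁻¹ • x - latticePoint k) ⁻¹' S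

/-- The points at distance less than `ε² m` from the faces of the cells `ε² (k + Z)` that are
orthogonal to the `i`-th axis. -/
def faceCollar {N : ℕ} (ε m : ℝ) (i : Fin N) : Set (Space N) :=
  ⋃ l : ℤ, {x | |(ε ^ 2)⁻¹ * x i - l| < m}

/-- The points close to the faces of the cells. -/
def collar (N : ℕ) (ε m : ℝ) : Set (Space N) := ⋃ i, faceCollar ε m i

section

variable {N : ℕ}

theorem mem_cellUnion {ε : ℝ} {K : Set (Fin N → ℤ)} {S : Set (Space N)} {x : Space N} :
    x ∈ cellUnion ε K S ↔ ∃ k ∈ K, (ε ^ 2)⁻¹ • x - latticePoint k ∈ S := by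
  simp [cellUnion]

theorem measurableSet_cellUnion {ε : ℝ} {K : Set (Fin N → ℤ)} {S : Set (Space N)}
    (hS : MeasurableSet S) : MeasurableSet (cellUnion ε K S) := by
  refine MeasurableSet.biUnion K.to_countable fun k _ => ?_
  have h : Continuous (fun x : Space N => (ε ^ 2)⁻¹ • x - latticePoint k) := by fun_prop
  exact h.measurable hS

theorem cellUnion_mono {ε : ℝ} {K : Set (Fin N → ℤ)} {S S' : Set (Space N)} (h : S ⊆ S') :
    cellUnion ε K S ⊆ cellUnion ε K S' :=
  iUnion₂_mono fun _ _ => preimage_mono h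

theorem cellUnion_union {ε : ℝ} {K : Set (Fin N → ℤ)} {S S' : Set (Space N)} :
    cellUnion ε K (S ∪ S') = cellUnion ε K S ∪ cellUnion ε K S' := by
  ext x
  simp only [mem_cellUnion, mem_union]
  constructor
  · rintro ⟨k, hk, h | h⟩
    exacts [.inl ⟨k, hk, h⟩, .inr ⟨k, hk, h⟩]
  · rintro (⟨k, hk, h⟩ | ⟨k, hk, h⟩)
    exacts [⟨k, hk, .inl h⟩, ⟨k, hk, .inr h⟩]

theorem isOpen_faceCollar (ε m : ℝ) (i : Fin N) : IsOpen (faceCollar ε m i) := by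
  refine isOpen_iUnion fun l => isOpen_lt ?_ continuous_const
  fun_prop

theorem isOpen_unitCube : IsOpen (unitCube N) := by
  have h : unitCube N = ⋂ i, {z : Space N | z i ∈ Ioo (0 : ℝ) 1} := by
    ext z; simp [unitCube]
  rw [h]
  refine isOpen_iInter_of_finite fun i => ?_
  exact isOpen_Ioo.preimage (by fun_prop : Continuous fun z : Space N => z i)

/-- The slabs orthogonal to the `i`-th axis are invariant under translations along any other axis
`j`, which exists as `N ≥ 2`; integration along the lines in direction `j` therefore never leaves
the collar. Summing over the `N` directions gives the factor `N`. -/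
theorem lintegral_sq_collar_le (hN : 2 ≤ N) {ε m R : ℝ} (hR : 0 < R) {W : Set (Space N)}
    (hW : MeasurableSet W) (hcW : collar N ε m ⊆ W) {φ : Space N → ℝ} (hφ : ContDiff ℝ 1 φ)
    (hφR : ∀ x, R ≤ ‖x‖ → φ x = 0) :
    ∫⁻ x in collar N ε m, ‖φ x‖ₑ ^ 2 ≤
      (N * (2 * ENNReal.ofReal (2 * R) ^ 2)) * ∫⁻ x in W, ‖fderiv ℝ φ x‖ₑ ^ 2 := by
  refine (lintegral_iUnion_le _ _).trans ?_
  rw [tsum_fintype]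
  refine (Finset.sum_le_card_nsmul _ _
    (2 * ENNReal.ofReal (2 * R) ^ 2 * ∫⁻ x in W, ‖fderiv ℝ φ x‖ₑ ^ 2) fun i _ => ?_).trans_eq
      (by rw [Finset.card_univ, Fintype.card_fin, nsmul_eq_mul, ← mul_assoc])
  have : Nontrivial (Fin N) := Fin.nontrivial_iff_two_le.2 hN
  obtain ⟨j, hj⟩ := exists_ne i
  refine lintegral_sq_le_of_line hφ hR hφR (isOpen_faceCollar ε m i).measurableSet hW
    (e := EuclideanSpace.single j (1 : ℝ)) (by simp) fun x hx s => hcW (mem_iUnion.2 ⟨i, ?_⟩)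
  simpa [faceCollar, hj.symm] using hx

/-- The mean square over the copies of `S` of a function supported in the ball of radius `R` is
controlled by its gradient on a set that contains the cells perforated by `Θ` and their collars,
uniformly in the scale. -/
def IsControlled (Θ : Set (Space N)) (m R ε₀ : ℝ) (S : Set (Space N)) : Prop :=
  ∃ C : ℝ≥0, ∀ ε : ℝ, 0 < ε → ε ≤ ε₀ → ∀ (K : Set (Fin N → ℤ)) (W : Set (Space N)),
    MeasurableSet W → collar N ε m ⊆ W → cellUnion ε K (unitCube N \ Θ) ⊆ W →
    ∀ φ : Space N → ℝ, ContDiff ℝ 1 φ → (∀ x, R ≤ ‖x‖ → φ x = 0) →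
      ∫⁻ x in cellUnion ε K S, ‖φ x‖ₑ ^ 2 ≤ C * ∫⁻ x in W, ‖fderiv ℝ φ x‖ₑ ^ 2

namespace IsControlled

variable {Θ : Set (Space N)} {m R ε₀ : ℝ} {S S' : Set (Space N)}

theorem mono (h : IsControlled Θ m R ε₀ S') (hS : S ⊆ S') : IsControlled Θ m R ε₀ S := by
  obtain ⟨C, hC⟩ := h
  exact ⟨C, fun ε h0 h1 K W hW hcW hKW φ hφ hφR =>
    (lintegral_mono_set (cellUnion_mono hS)).trans (hC ε h0 h1 K W hW hcW hKW φ hφ hφR)⟩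

theorem union (h : IsControlled Θ m R ε₀ S) (h' : IsControlled Θ m R ε₀ S') :
    IsControlled Θ m R ε₀ (S ∪ S') := by
  obtain ⟨C, hC⟩ := h
  obtain ⟨C', hC'⟩ := h'
  refine ⟨C + C', fun ε h0 h1 K W hW hcW hKW φ hφ hφR => ?_⟩
  rw [cellUnion_union]
  refine (lintegral_union_le _ _ _).trans ?_
  rw [ENNReal.coe_add, add_mul]
  exact add_le_add (hC ε h0 h1 K W hW hcW hKW φ hφ hφR) (hC' ε h0 h1 K W hW hcW hKW φ hφ hφR)

theorem empty : IsControlled Θ m R ε₀ ∅ :=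
  ⟨0, fun ε _ _ K W _ _ _ φ _ _ => by simp [cellUnion]⟩

/-- The copies of a slab around an integer hyperplane lie in the collar, for all `ε` and `K` at
once. This is where the propagation of control starts. -/
theorem of_face (hN : 2 ≤ N) (hR : 0 < R) (i : Fin N) (l : ℤ) :
    IsControlled Θ m R ε₀ {z | |z i - l| < m} := by
  refine ⟨(N * (2 * Real.toNNReal (2 * R) ^ 2)), fun ε _ _ K W hW hcW _ φ hφ hφR => ?_⟩
  refine (lintegral_mono_set fun x hx => ?_).trans
    ((lintegral_sq_collar_le hN hR hW hcW hφ hφR).trans_eq ?_)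
  · obtain ⟨k, _, hk⟩ := mem_cellUnion.1 hx
    refine mem_iUnion.2 ⟨i, mem_iUnion.2 ⟨l + k i, ?_⟩⟩
    have e : (ε ^ 2)⁻¹ * x i - ((l + k i : ℤ) : ℝ) = (ε ^ 2)⁻¹ * x i - k i - l := by
      push_cast; ring
    simp only [mem_ofPred_eq, e]
    simpa [latticePoint] using hk
  · push_cast
    simp [ENNReal.ofReal]

/-- Control is inherited along a translation whose segments stay in the perforated cell. In the
scaled picture the translation vector is `ε² v`; the bound `ε ≤ ε₀` keeps the constant independent
of `ε`. -/
theorem shift (h' : IsControlled Θ m R ε₀ S') (hS : MeasurableSet S) (v : Space N)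
    (hv : ∀ x ∈ S, ∀ s ∈ Icc (0 : ℝ) 1, x + s • v ∈ unitCube N \ Θ)
    (hS' : ∀ x ∈ S, x + v ∈ S') : IsControlled Θ m R ε₀ S := by
  obtain ⟨C', hC'⟩ := h'
  refine ⟨2 * C' + 2 * (Real.toNNReal (ε₀ ^ 2) * ‖v‖₊) ^ 2,
    fun ε h0 h1 K W hW hcW hKW φ hφ hφR => ?_⟩
  have hε : ε ^ 2 ≠ 0 := by positivity
  have hx : ∀ (x : Space N) (k : Fin N → ℤ) (s : ℝ),
      (ε ^ 2)⁻¹ • (x + s • ε ^ 2 • v) - latticePoint k =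
        (ε ^ 2)⁻¹ • x - latticePoint k + s • v := by
    intro x k s
    rw [smul_add, smul_comm s, inv_smul_smul₀ hε]
    abel
  have h2 := lintegral_sq_le_shift hφ (measurableSet_cellUnion (ε := ε) (K := K) hS) hW
    (ε ^ 2 • v) (fun x hxS s hs => hKW (by
      obtain ⟨k, hk, hxk⟩ := mem_cellUnion.1 hxS
      refine mem_cellUnion.2 ⟨k, hk, ?_⟩
      rw [hx]
      exact hv _ hxk s hs))
  -- `S'` is not assumed measurable; its measurable hull gives the same restricted measure.
  have h3 : ∫⁻ x in cellUnion ε K S, ‖φ (x + ε ^ 2 • v)‖ₑ ^ 2 ≤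
      ∫⁻ x in toMeasurable volume (cellUnion ε K S'), ‖φ x‖ₑ ^ 2 := by
    rw [← lintegral_indicator (measurableSet_cellUnion hS),
      ← lintegral_indicator (measurableSet_toMeasurable _ _),
      ← lintegral_add_right_eq_self ((toMeasurable _ _).indicator _) (ε ^ 2 • v)]
    refine lintegral_mono fun x => ?_
    by_cases hxS : x ∈ cellUnion ε K S
    · rw [indicator_of_mem hxS, indicator_of_mem]
      refine subset_toMeasurable _ _ ?_
      obtain ⟨k, hk, hxk⟩ := mem_cellUnion.1 hxS
      refine mem_cellUnion.2 ⟨k, hk, ?_⟩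
      have := hx x k 1
      rw [one_smul, one_smul] at this
      rw [this]
      exact hS' _ hxk
    · rw [indicator_of_notMem hxS]; exact zero_le
  rw [Measure.restrict_toMeasurable_of_sFinite] at h3
  have h4 := hC' ε h0 h1 K W hW hcW hKW φ hφ hφR
  refine h2.trans ?_
  push_cast
  rw [add_mul, mul_assoc 2 (C' : ℝ≥0∞)]
  gcongr
  · exact h3.trans h4
  · rw [enorm_smul, enorm_eq_nnnorm v, Real.enorm_of_nonneg (by positivity)]
    gcongr
    exact ENNReal.ofReal_le_ofReal (by gcongr)

end IsControlled

/-- Connectedness argument: the set of points having a controlled ball is open, meets the cell near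
a face, and is relatively closed, because a small ball around a limit point can be translated inside
the cell onto a ball around a nearby controlled point. -/
theorem exists_ball_isControlled (hN : 2 ≤ N) {Θ : Set (Space N)} {m R ε₀ : ℝ} (hm : 0 < m)
    (hm1 : m < 1) (hR : 0 < R) (hΘ : IsClosed Θ) (hmΘ : ∀ x ∈ Θ, ∀ i, m ≤ x i)
    (hconn : IsPreconnected (unitCube N \ Θ)) :
    ∀ x ∈ unitCube N \ Θ, ∃ r > 0, IsControlled Θ m R ε₀ (Metric.ball x r) := by
  have hopen : IsOpen (unitCube N \ Θ) := isOpen_unitCube.sdiff hΘ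
  let G : Set (Space N) := {x | ∃ r > 0, IsControlled Θ m R ε₀ (Metric.ball x r)}
  have hG : IsOpen G := by
    rw [Metric.isOpen_iff]
    rintro x ⟨r, hr, hx⟩
    refine ⟨r, hr, fun y hy => ⟨r - dist y x, by simpa using hy, hx.mono ?_⟩⟩
    exact Metric.ball_subset_ball' (by simp)
  have hne : ((unitCube N \ Θ) ∩ G).Nonempty := by
    let i : Fin N := ⟨0, by omega⟩
    -- The point with all coordinates `m / 2` lies in the slab of a face and, as the coordinates of
    -- points of `Θ` are at least `m`, outside the hole.
    refine ⟨WithLp.toLp 2 fun _ => m / 2, ⟨fun j => ⟨?_, ?_⟩, fun h => ?_⟩, ?_⟩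
    · simpa using hm
    · simp only; linarith
    · have := hmΘ _ h i
      simp only at this
      linarith
    · have ho : IsOpen {z : Space N | |z i - (0 : ℤ)| < m} :=
        isOpen_lt (by fun_prop) continuous_const
      obtain ⟨r, hr, hb⟩ := Metric.isOpen_iff.1 ho (WithLp.toLp 2 fun _ => m / 2) (by
        simp only [mem_ofPred_eq, Int.cast_zero, sub_zero]
        rw [abs_of_pos (by positivity)]
        linarith)
      exact ⟨r, hr, (IsControlled.of_face hN hR i 0).mono hb⟩
  refine hconn.subset_of_closure_inter_subset hG hne ?_
  rintro x ⟨hxG, hx⟩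
  obtain ⟨r, hr, hb⟩ := Metric.isOpen_iff.1 hopen x hx
  obtain ⟨y, ⟨ρ, hρ, hy⟩, hxy⟩ := Metric.mem_closure_iff.1 hxG (r / 2) (by positivity)
  refine ⟨min ρ (r / 2), by positivity, hy.shift Metric.isOpen_ball.measurableSet (y - x) ?_ ?_⟩
  · intro z hz s hs
    refine hb ?_
    have h1 : dist z x < r / 2 := lt_of_lt_of_le hz (min_le_right _ _)
    have h2 : ‖s • (y - x)‖ ≤ ‖y - x‖ := by
      rw [norm_smul, Real.norm_of_nonneg hs.1]
      exact mul_le_of_le_one_left (norm_nonneg _) hs.2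
    have h3 : ‖y - x‖ < r / 2 := by rw [← dist_eq_norm, dist_comm]; exact hxy
    rw [dist_eq_norm] at h1
    rw [Metric.mem_ball, dist_eq_norm, add_sub_right_comm]
    have := norm_add_le (z - x) (s • (y - x))
    linarith
  · intro z hz
    have h1 : dist z x < ρ := lt_of_lt_of_le hz (min_le_left _ _)
    rw [Metric.mem_ball, dist_eq_norm]
    rw [dist_eq_norm] at h1
    convert h1 using 2
    abel

/-- Near `x₀` the complement of `Θ` is the region above a graph, so moving upwards along `n` never
re-enters the hole. A fixed upward translation takes the points near `x₀` to a neighbourhood of an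
interior point of the cell, where control is already known. -/
theorem isControlled_near_boundary {Θ : Set (Space N)} {m R ε₀ : ℝ} (hΘ : IsClosed Θ)
    (hΘZ : Θ ⊆ unitCube N) (hsm : HasSmoothBoundary Θᶜ)
    (hball : ∀ x ∈ unitCube N \ Θ, ∃ r > 0, IsControlled Θ m R ε₀ (Metric.ball x r))
    {x₀ : Space N} (hx₀ : x₀ ∈ frontier Θ) :
    ∃ r > 0, IsControlled Θ m R ε₀ (Metric.ball x₀ r ∩ (unitCube N \ Θ)) := by
  have hx₀Θ : x₀ ∈ Θ := hΘ.frontier_subset hx₀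
  obtain ⟨r, hr, n, hn, γ, hγ, habove⟩ := hsm x₀ (by rwa [frontier_compl])
  let F : Space N → ℝ := fun x => inner ℝ n x - γ (x - inner ℝ n x • n)
  -- `F` is the height above the graph: it grows at unit speed along `n`, and its positivity
  -- characterizes the points outside `Θ`.
  have hF : Continuous F := by
    have := hγ.continuous
    fun_prop
  have hFadd : ∀ x s, F (x + s • n) = F x + s := by
    intro x s
    have e : inner ℝ n (x + s • n) = inner ℝ n x + s := by
      rw [inner_add_right, inner_smul_right, real_inner_self_eq_norm_sq, hn]; ring
    simp only [F, e]
    rw [show x + s • n - (inner ℝ n x + s) • n = x - inner ℝ n x • n by rw [add_smul]; abel]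
    ring
  have hFΘ : ∀ x ∈ Metric.ball x₀ r, x ∉ Θ ↔ 0 < F x := fun x hx => by
    rw [← mem_compl_iff, habove x hx, sub_pos]
  -- `x₀` is a limit of points outside `Θ`, where `F` is positive.
  have hF0 : 0 ≤ F x₀ := by
    by_contra! hlt
    have hcl : x₀ ∈ closure Θᶜ := by
      rw [← frontier_compl] at hx₀
      exact frontier_subset_closure hx₀
    obtain ⟨y, hy, hyΘ⟩ := mem_closure_iff.1 hcl ({x | F x < 0} ∩ Metric.ball x₀ r)
      ((isOpen_lt hF continuous_const).inter Metric.isOpen_ball) ⟨hlt, Metric.mem_ball_self hr⟩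
    exact lt_asymm hy.1 ((hFΘ y hy.2).1 hyΘ)
  obtain ⟨r₁, hr₁, hb₁⟩ := Metric.isOpen_iff.1 isOpen_unitCube x₀ (hΘZ hx₀Θ)
  obtain ⟨q, hq, hqr, hqr₁⟩ : ∃ q > 0, q ≤ r ∧ q ≤ r₁ := ⟨min r r₁, by positivity, by simp, by simp⟩
  have hcell : ∀ x ∈ Metric.ball x₀ q, 0 < F x → x ∈ unitCube N \ Θ := fun x hx hFx =>
    ⟨hb₁ (Metric.ball_subset_ball hqr₁ hx), (hFΘ x (Metric.ball_subset_ball hqr hx)).2 hFx⟩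
  have hmem : ∀ x, dist x x₀ < q / 2 → ∀ s ∈ Icc (0 : ℝ) 1,
      x + s • (q / 2) • n ∈ Metric.ball x₀ q := by
    intro x hx s hs
    have h2 : ‖s • (q / 2) • n‖ ≤ q / 2 := by
      rw [norm_smul, norm_smul, hn, Real.norm_of_nonneg hs.1, Real.norm_of_nonneg (by positivity),
        mul_one]
      exact mul_le_of_le_one_left (by positivity) hs.2
    rw [dist_eq_norm] at hx
    rw [Metric.mem_ball, dist_eq_norm, add_sub_right_comm]
    have := norm_add_le (x - x₀) (s • (q / 2) • n)
    linarith
  have hy : x₀ + (q / 2) • n ∈ unitCube N \ Θ := by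
    have h1 := hmem x₀ (by simpa using hq) 1 (by simp)
    rw [one_smul] at h1
    refine hcell _ h1 ?_
    rw [hFadd]
    linarith
  obtain ⟨ρ, hρ, hyρ⟩ := hball _ hy
  refine ⟨min ρ (q / 2), by positivity, hyρ.shift
    (Metric.isOpen_ball.inter (isOpen_unitCube.sdiff hΘ)).measurableSet ((q / 2) • n) ?_ ?_⟩
  · rintro x ⟨hx, hxc⟩ s hs
    have h1 : dist x x₀ < q / 2 := lt_of_lt_of_le hx (min_le_right _ _)
    refine hcell _ (hmem x h1 s hs) ?_
    rw [smul_smul, hFadd]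
    have h2 := (hFΘ x (Metric.ball_subset_ball hqr (by
      rw [Metric.mem_ball]; linarith))).1 hxc.2
    have h3 : 0 ≤ s * (q / 2) := mul_nonneg hs.1 (by positivity)
    linarith
  · rintro x ⟨hx, -⟩
    have h1 : dist x x₀ < ρ := lt_of_lt_of_le hx (min_le_left _ _)
    simpa using h1

theorem isCompact_closedCube : IsCompact {x : Space N | ∀ i, x i ∈ Icc (0 : ℝ) 1} := by
  have h : {x : Space N | ∀ i, x i ∈ Icc (0 : ℝ) 1} =
      (EuclideanSpace.equiv (Fin N) ℝ).symm '' (Set.pi univ fun _ => Icc (0 : ℝ) 1) := by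
    ext x
    simp only [mem_ofPred_eq, mem_image, mem_univ_pi]
    exact ⟨fun h => ⟨x.ofLp, h, rfl⟩, by rintro ⟨y, hy, rfl⟩; exact hy⟩
  rw [h]
  exact (isCompact_univ_pi fun _ => isCompact_Icc).image
    (EuclideanSpace.equiv (Fin N) ℝ).symm.continuous

/-- A function is controlled by its gradient on the whole perforated cell. -/
theorem isControlled_cell (hN : 2 ≤ N) {Θ : Set (Space N)} {m R ε₀ : ℝ} (hm : 0 < m)
    (hm1 : m < 1) (hR : 0 < R) (hΘ : IsClosed Θ) (hΘZ : Θ ⊆ unitCube N)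
    (hmΘ : ∀ x ∈ Θ, ∀ i, m ≤ x i) (hsm : HasSmoothBoundary Θᶜ)
    (hconn : IsPreconnected (unitCube N \ Θ)) :
    IsControlled Θ m R ε₀ (unitCube N \ Θ) := by
  have hball := exists_ball_isControlled (ε₀ := ε₀) hN hm hm1 hR hΘ hmΘ hconn
  -- Control is stable under finite unions, so it is enough to find a controlled neighbourhood of
  -- each point of the compact closed cube: inside `Θ`, on its frontier, in the perforated cell, or
  -- on a face.
  have key : IsControlled Θ m R ε₀ ({x | ∀ i, x i ∈ Icc (0 : ℝ) 1} ∩ (unitCube N \ Θ)) := by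
    refine isCompact_closedCube.induction_on
      (p := fun S => IsControlled Θ m R ε₀ (S ∩ (unitCube N \ Θ))) ?_ ?_ ?_ ?_
    · simpa using IsControlled.empty
    · exact fun s t hst ht => ht.mono (inter_subset_inter_left _ hst)
    · intro s t hs ht
      rw [union_inter_distrib_right]
      exact hs.union ht
    · intro x hx
      by_cases hxZ : x ∈ unitCube N
      · by_cases hxΘ : x ∈ Θ
        · by_cases hxi : x ∈ interior Θ
          · refine ⟨Θ, mem_nhdsWithin_of_mem_nhds (mem_interior_iff_mem_nhds.1 hxi), ?_⟩
            simpa using IsControlled.empty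
          · obtain ⟨r, hr, h⟩ := isControlled_near_boundary hΘ hΘZ hsm hball
              (show x ∈ frontier Θ from ⟨subset_closure hxΘ, hxi⟩)
            exact ⟨_, mem_nhdsWithin_of_mem_nhds (Metric.ball_mem_nhds x hr), h⟩
        · obtain ⟨r, hr, h⟩ := hball x ⟨hxZ, hxΘ⟩
          exact ⟨_, mem_nhdsWithin_of_mem_nhds (Metric.ball_mem_nhds x hr), h.mono inter_subset_left⟩
      · obtain ⟨i, hi⟩ : ∃ i, x i ∉ Ioo (0 : ℝ) 1 := by
          by_contra! h
          exact hxZ h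
        obtain ⟨l, hl⟩ : ∃ l : ℤ, x i = l := by
          obtain ⟨h0, h1⟩ := hx i
          rcases h0.eq_or_lt with h | h
          · exact ⟨0, by simp [← h]⟩
          · exact ⟨1, by simpa using le_antisymm h1 (not_lt.1 fun h' => hi ⟨h, h'⟩)⟩
        have ho : IsOpen {z : Space N | |z i - l| < m} := isOpen_lt (by fun_prop) continuous_const
        refine ⟨_, mem_nhdsWithin_of_mem_nhds (ho.mem_nhds (x := x) ?_),
          (IsControlled.of_face hN hR i l).mono inter_subset_left⟩
        simpa [hl] using hm
  refine key.mono fun x hx => ⟨fun i => Ioo_subset_Icc_self (hx.1 i), hx⟩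

end

/-! ### The Poincaré inequality on the perforated domains -/

section

variable {N : ℕ}

theorem scaledHole_eq {Θ : Set (Space N)} {ε : ℝ} (hε : 0 < ε) (k : Fin N → ℤ) :
    scaledHole Θ ε k = (fun x => (ε ^ 2)⁻¹ • x - latticePoint k) ⁻¹' Θ := by
  have h : ε ^ 2 ≠ 0 := by positivity
  ext x
  simp only [scaledHole, mem_image, mem_preimage]
  constructor
  · rintro ⟨z, hz, rfl⟩
    simpa [inv_smul_smul₀ h] using hz
  · exact fun hx => ⟨_, hx, by rw [add_sub_cancel, smul_inv_smul₀ h]⟩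

theorem perforated_eq {Ω Θ : Set (Space N)} {ε : ℝ} (hε : 0 < ε) :
    perforated Ω Θ ε = Ω \ cellUnion ε {k | scaledHole Θ ε k ⊆ Ω} Θ := by
  simp only [perforated, cellUnion, scaledHole_eq hε]

theorem eq_of_mem_unitCube {y : Space N} {k l : Fin N → ℤ} (hk : y - latticePoint k ∈ unitCube N)
    (hl : y - latticePoint l ∈ unitCube N) : k = l := by
  ext i
  obtain ⟨h1, h2⟩ := hk i
  obtain ⟨h3, h4⟩ := hl i
  simp only [latticePoint, PiLp.sub_apply] at h1 h2 h3 h4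
  have h5 : (k i : ℝ) < l i + 1 := by linarith
  have h6 : (l i : ℝ) < k i + 1 := by linarith
  norm_cast at h5 h6
  omega

/-- The integer parts of the rescaled coordinates select the open cell; the points for which a
coordinate is an integer lie on a face, hence in the collar because `m > 0`. -/
theorem mem_collar_or_mem_cellUnion {ε m : ℝ} (hm : 0 < m) (K : Set (Fin N → ℤ)) (x : Space N) :
    x ∈ collar N ε m ∨ x ∈ cellUnion ε K (unitCube N) ∨ x ∈ cellUnion ε Kᶜ (unitCube N) := by
  by_cases h : ∃ i, (ε ^ 2)⁻¹ * x i = ⌊(ε ^ 2)⁻¹ * x i⌋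
  · obtain ⟨i, hi⟩ := h
    refine .inl (mem_iUnion.2 ⟨i, mem_iUnion.2 ⟨⌊(ε ^ 2)⁻¹ * x i⌋, ?_⟩⟩)
    rw [mem_ofPred_eq, ← hi, sub_self, abs_zero]
    exact hm
  · push Not at h
    have hx : (ε ^ 2)⁻¹ • x - latticePoint (fun i => ⌊(ε ^ 2)⁻¹ * x i⌋) ∈ unitCube N := by
      intro i
      have h1 := (Int.floor_le ((ε ^ 2)⁻¹ * x i)).lt_of_ne (h i).symm
      have h2 := Int.lt_floor_add_one ((ε ^ 2)⁻¹ * x i)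
      simp only [latticePoint, PiLp.sub_apply, PiLp.smul_apply, smul_eq_mul]
      constructor <;> linarith
    by_cases hk : (fun i => ⌊(ε ^ 2)⁻¹ * x i⌋) ∈ K
    · exact .inr (.inl (mem_cellUnion.2 ⟨_, hk, hx⟩))
    · exact .inr (.inr (mem_cellUnion.2 ⟨_, hk, hx⟩))

theorem collar_subset_compl_cellUnion {Θ : Set (Space N)} {m : ℝ}
    (hmΘ : ∀ x ∈ Θ, ∀ i, m ≤ x i ∧ x i ≤ 1 - m) (ε : ℝ) (K : Set (Fin N → ℤ)) :
    collar N ε m ⊆ (cellUnion ε K Θ)ᶜ := by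
  intro x hx hxΘ
  obtain ⟨i, hi⟩ := mem_iUnion.1 hx
  obtain ⟨l, hl⟩ := mem_iUnion.1 hi
  obtain ⟨k, -, hk⟩ := mem_cellUnion.1 hxΘ
  obtain ⟨h1, h2⟩ := hmΘ _ hk i
  rw [mem_ofPred_eq, abs_lt] at hl
  simp only [latticePoint, PiLp.sub_apply, PiLp.smul_apply, smul_eq_mul] at h1 h2
  have h3 : (k i : ℝ) < l := by linarith
  have h4 : (l : ℝ) < k i + 1 := by linarith
  norm_cast at h3 h4
  omega

theorem cellUnion_subset_compl {S S' : Set (Space N)} {ε : ℝ} {K K' : Set (Fin N → ℤ)}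
    (hS : S ⊆ unitCube N) (hS' : S' ⊆ unitCube N) (h : Disjoint S S' ∨ Disjoint K K') :
    cellUnion ε K S ⊆ (cellUnion ε K' S')ᶜ := by
  intro x hx hx'
  obtain ⟨k, hkK, hk⟩ := mem_cellUnion.1 hx
  obtain ⟨l, hlK, hl⟩ := mem_cellUnion.1 hx'
  obtain rfl := eq_of_mem_unitCube (hS hk) (hS' hl)
  rcases h with h | h
  · exact disjoint_left.1 h hk hl
  · exact disjoint_left.1 h hkK hlK

/-- Positive distance between the compact hole and the faces: it gives the width of the collars that
no hole meets. -/
theorem exists_margin {Θ : Set (Space N)} (hΘ : IsCompact Θ) (hΘZ : Θ ⊆ unitCube N) :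
    ∃ m, 0 < m ∧ m < 1 ∧ ∀ x ∈ Θ, ∀ i, m ≤ x i ∧ x i ≤ 1 - m := by
  obtain ⟨δ, hδ, h⟩ := hΘ.exists_thickening_subset_open isOpen_unitCube hΘZ
  refine ⟨min (δ / 2) (1 / 2), by positivity, by
    have := min_le_right (δ / 2) (1 / 2 : ℝ); linarith, fun x hx i => ?_⟩
  have key : ∀ c : ℝ, |c| < δ → x i + c ∈ Ioo (0 : ℝ) 1 := by
    intro c hc
    have hmem : x + EuclideanSpace.single i c ∈ Metric.thickening δ Θ :=
      Metric.mem_thickening_iff.2 ⟨x, hx, by simpa [dist_eq_norm] using hc⟩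
    simpa using h hmem i
  have h1 := (key (-(δ / 2)) (by rw [abs_neg, abs_of_pos (by positivity)]; linarith)).1
  have h2 := (key (δ / 2) (by rw [abs_of_pos (by positivity)]; linarith)).2
  have h3 := min_le_left (δ / 2) (1 / 2 : ℝ)
  constructor <;> linarith

theorem isConnected_unitCube : IsConnected (unitCube N) := by
  have hc : Convex ℝ (unitCube N) := by
    intro x hx y hy a b ha hb hab i
    simpa using (convex_Ioo (0 : ℝ) 1) (hx i) (hy i) ha hb hab
  refine hc.isConnected ⟨WithLp.toLp 2 fun _ => 1 / 2, fun i => ?_⟩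
  norm_num

/-- A hole contains two points at distance `ε² r / 2`, and both lie in a ball of radius `R`, so `ε²`
is bounded as soon as a hole is removed. -/
theorem exists_scale_bound (hN : 0 < N) {Ω Θ : Set (Space N)} {R : ℝ}
    (hΩ : Ω ⊆ Metric.ball 0 R) (hΘ : (interior Θ).Nonempty) :
    ∃ ε₀ : ℝ, ∀ ε > 0, (∃ k, scaledHole Θ ε k ⊆ Ω) → ε ≤ ε₀ := by
  obtain ⟨z, hz⟩ := hΘ
  obtain ⟨r, hr, hb⟩ := Metric.isOpen_iff.1 isOpen_interior z hz
  -- The maximum with `1` turns the bound on `ε²` into one on `ε`, through `ε ≤ ε²`.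
  refine ⟨max 1 (4 * R / r), fun ε hε ⟨k, hk⟩ => ?_⟩
  set e : Space N := EuclideanSpace.single ⟨0, hN⟩ (r / 2)
  have he : ‖e‖ = r / 2 := by simp [e, abs_of_pos hr]
  have h1 := hΩ (hk (mem_image_of_mem _ (interior_subset hz)))
  have h2 := hΩ (hk (mem_image_of_mem _ (interior_subset (hb (show z + e ∈ Metric.ball z r by
    rw [Metric.mem_ball, dist_eq_norm, add_sub_cancel_left, he]; linarith)))))
  rw [mem_ball_zero_iff] at h1 h2
  have h3 : ‖ε ^ 2 • e‖ ≤ ‖ε ^ 2 • (latticePoint k + (z + e))‖ + ‖ε ^ 2 • (latticePoint k + z)‖ := by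
    refine le_trans (le_of_eq ?_) (norm_sub_le _ _)
    rw [← smul_sub]
    congr 2
    abel
  rw [norm_smul, he, Real.norm_of_nonneg (by positivity)] at h3
  by_contra! hlt
  obtain ⟨h4, h5⟩ := max_lt_iff.1 hlt
  rw [div_lt_iff₀ hr] at h5
  have h6 : ε * r ≤ ε ^ 2 * r := by gcongr; nlinarith
  linarith

/-- The Poincaré inequality on the perforated domains, with a constant that does not depend on the
scale. -/
theorem exists_poincare_perforated (hN : 2 ≤ N) {Ω Θ : Set (Space N)} (hΩ : MeasurableSet Ω)
    (hΩb : Bornology.IsBounded Ω) (hΘ : IsReferenceHole Θ) :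
    ∃ C : ℝ≥0, ∀ ε > 0, ∀ φ : Space N → ℝ, ContDiff ℝ 1 φ → tsupport φ ⊆ Ω →
      ∫⁻ x in perforated Ω Θ ε, ‖φ x‖ₑ ^ 2 ≤
        C * ∫⁻ x in perforated Ω Θ ε, ‖fderiv ℝ φ x‖ₑ ^ 2 := by
  obtain ⟨R, hR, hΩR⟩ : ∃ R > 0, Ω ⊆ Metric.ball 0 R := by
    obtain ⟨R, hR, h⟩ := hΩb.subset_ball_lt 0 0
    exact ⟨R, hR, h⟩
  obtain ⟨m, hm, hm1, hmΘ⟩ := exists_margin hΘ.compact hΘ.subset_cube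
  obtain ⟨ε₀, hε₀⟩ := exists_scale_bound (by omega) hΩR hΘ.interior_nonempty
  obtain ⟨C₁, hC₁⟩ := isControlled_cell (ε₀ := ε₀) hN hm hm1 hR hΘ.compact.isClosed hΘ.subset_cube
    (fun x hx i => (hmΘ x hx i).1) hΘ.smooth hΘ.cell_connected.isPreconnected
  -- The empty hole serves the cells from which nothing is removed.
  obtain ⟨C₂, hC₂⟩ := isControlled_cell (Θ := ∅) (ε₀ := ε₀) hN hm hm1 hR isClosed_empty
    (empty_subset (unitCube N)) (by simp) (by simp [HasSmoothBoundary])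
    (by simpa using isConnected_unitCube.isPreconnected)
  obtain ⟨C₃, hC₃⟩ : ∃ C : ℝ≥0, (C : ℝ≥0∞) = N * (2 * ENNReal.ofReal (2 * R) ^ 2) :=
    ⟨N * (2 * (2 * R).toNNReal ^ 2), by push_cast; simp [ENNReal.ofReal]⟩
  refine ⟨C₃ + (C₁ + C₂), fun ε hε φ hφ hφΩ => ?_⟩
  set K := {k | scaledHole Θ ε k ⊆ Ω} with hK
  set W : Set (Space N) := (cellUnion ε K Θ)ᶜ with hW
  have hWm : MeasurableSet W := (measurableSet_cellUnion hΘ.compact.isClosed.measurableSet).compl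
  have hP : perforated Ω Θ ε = Ω ∩ W := by rw [perforated_eq hε, sdiff_eq]
  have hφR : ∀ x, R ≤ ‖x‖ → φ x = 0 := fun x hx => by
    by_contra h
    have := hΩR (hφΩ (subset_tsupport _ h))
    rw [mem_ball_zero_iff] at this
    linarith
  -- The gradient vanishes outside `Ω`, so `Ω^ε` may be replaced by the whole space minus the
  -- removed holes, which contains the full collars.
  have hint : ∫⁻ x in perforated Ω Θ ε, ‖fderiv ℝ φ x‖ₑ ^ 2 = ∫⁻ x in W, ‖fderiv ℝ φ x‖ₑ ^ 2 := by
    rw [hP, ← lintegral_indicator (hΩ.inter hWm), ← lintegral_indicator hWm]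
    refine lintegral_congr fun x => ?_
    by_cases hx : x ∈ Ω
    · by_cases hxW : x ∈ W
      · rw [indicator_of_mem hxW, indicator_of_mem (mem_inter hx hxW)]
      · rw [indicator_of_notMem hxW, indicator_of_notMem (fun h => hxW h.2)]
    · have h0 : fderiv ℝ φ x = 0 := by
        by_contra h
        exact hx (hφΩ (support_fderiv_subset ℝ h))
      rw [indicator_of_notMem (fun h => hx h.1)]
      by_cases hxW : x ∈ W
      · rw [indicator_of_mem hxW, h0, ← ofReal_norm, norm_zero, ENNReal.ofReal_zero,
          zero_pow two_ne_zero]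
      · rw [indicator_of_notMem hxW]
  rw [hint]
  by_cases hε₁ : ε ≤ ε₀
  · have hcW : collar N ε m ⊆ W := collar_subset_compl_cellUnion hmΘ ε K
    have h1 := lintegral_sq_collar_le hN hR hWm hcW hφ hφR
    have h2 := hC₁ ε hε hε₁ K W hWm hcW
      (cellUnion_subset_compl sdiff_subset hΘ.subset_cube (.inl disjoint_sdiff_left)) φ hφ hφR
    have h3 := hC₂ ε hε hε₁ Kᶜ W hWm hcW
      (cellUnion_subset_compl sdiff_subset hΘ.subset_cube (.inr disjoint_compl_left)) φ hφ hφR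
    have hcov : perforated Ω Θ ε ⊆ collar N ε m ∪ (cellUnion ε K (unitCube N \ Θ) ∪
        cellUnion ε Kᶜ (unitCube N \ ∅)) := by
      rw [hP]
      rintro x ⟨-, hxW⟩
      rcases mem_collar_or_mem_cellUnion (ε := ε) hm K x with h | h | h
      · exact .inl h
      · obtain ⟨k, hk, hxk⟩ := mem_cellUnion.1 h
        exact .inr (.inl (mem_cellUnion.2 ⟨k, hk, hxk, fun hΘ =>
          hxW (mem_cellUnion.2 ⟨k, hk, hΘ⟩)⟩))
      · exact .inr (.inr (by simpa using h))
    refine (lintegral_mono_set hcov).trans ((lintegral_union_le _ _ _).trans ?_)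
    rw [ENNReal.coe_add, add_mul, hC₃]
    refine add_le_add h1 ((lintegral_union_le _ _ _).trans ?_)
    rw [ENNReal.coe_add, add_mul]
    exact add_le_add h2 h3
  -- At large scales nothing is removed, and integration along lines in the whole space suffices.
  · have hKe : K = ∅ := by
      by_contra h
      obtain ⟨k, hk⟩ := nonempty_iff_ne_empty.2 h
      exact hε₁ (hε₀ ε hε ⟨k, hk⟩)
    have hWu : W = univ := by simp [hW, hKe, cellUnion]
    have h1 := lintegral_sq_le_of_line hφ hR hφR MeasurableSet.univ hWm
      (e := EuclideanSpace.single (⟨0, by omega⟩ : Fin N) (1 : ℝ)) (by simp)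
      (fun x _ s => by rw [hWu]; trivial)
    refine (lintegral_mono_set (subset_univ _)).trans (h1.trans ?_)
    gcongr
    rw [ENNReal.coe_add, hC₃]
    refine le_add_right (le_mul_of_one_le_left zero_le ?_)
    exact_mod_cast (by omega : 1 ≤ N)

theorem enorm_sq_eq_lintegral {X E : Type*} [MeasurableSpace X] [NormedAddCommGroup E]
    {μ : Measure X} (f : Lp E 2 μ) : ‖f‖ₑ ^ 2 = ∫⁻ x, ‖f x‖ₑ ^ 2 ∂μ := by
  rw [Lp.enorm_def, eLpNorm_eq_lintegral_rpow_enorm_toReal (by simp) (by simp),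
    ← ENNReal.rpow_natCast, ← ENNReal.rpow_mul]
  norm_num

theorem enorm_gradient (φ : Space N → ℝ) (x : Space N) : ‖gradient φ x‖ₑ = ‖fderiv ℝ φ x‖ₑ := by
  simp [gradient, enorm_eq_nnnorm]

/-- The Poincaré inequality on the spaces `V_ε`, uniformly in the scale. -/
theorem exists_norm_fn_le (hN : 2 ≤ N) {Ω Θ : Set (Space N)} (hΩ : MeasurableSet Ω)
    (hΩb : Bornology.IsBounded Ω) (hΘ : IsReferenceHole Θ) :
    ∃ C : ℝ, 0 ≤ C ∧ ∀ ε > 0, ∀ v : VSpace Ω (perforated Ω Θ ε),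
      ‖VSpace.fn v‖ ≤ C * ‖VSpace.grad v‖ := by
  obtain ⟨C, hC⟩ := exists_poincare_perforated hN hΩ hΩb hΘ
  refine ⟨√C, by positivity, fun ε hε v => ?_⟩
  have hcl : IsClosed {p : WithLp 2 (L2 (perforated Ω Θ ε) × L2Vec (perforated Ω Θ ε)) |
      ‖WithLp.fstL 2 ℝ (L2 (perforated Ω Θ ε)) (L2Vec (perforated Ω Θ ε)) p‖ ≤
        √C * ‖WithLp.sndL 2 ℝ (L2 (perforated Ω Θ ε)) (L2Vec (perforated Ω Θ ε)) p‖} :=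
    isClosed_le (by fun_prop) (by fun_prop)
  have hv : v.1 ∈ closure (testGraph Ω (perforated Ω Θ ε) : Set _) := v.2
  refine closure_minimal ?_ hcl hv
  rintro p ⟨φ, hφ, -, hφs, h1, h2⟩
  have h3 := hC ε hε φ (hφ.of_le (by exact_mod_cast le_top)) hφs
  have e1 : ∫⁻ x in perforated Ω Θ ε, ‖φ x‖ₑ ^ 2 = ‖p.fst‖ₑ ^ 2 := by
    rw [enorm_sq_eq_lintegral]
    exact lintegral_congr_ae (h1.mono fun x hx => by simp only [hx])
  have e2 : ∫⁻ x in perforated Ω Θ ε, ‖fderiv ℝ φ x‖ₑ ^ 2 = ‖p.snd‖ₑ ^ 2 := by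
    rw [enorm_sq_eq_lintegral]
    exact lintegral_congr_ae (h2.mono fun x hx => by simp only [hx, enorm_gradient])
  rw [e1, e2, enorm_eq_nnnorm, enorm_eq_nnnorm] at h3
  norm_cast at h3
  have h4 : ‖p.fst‖ ^ 2 ≤ (√C * ‖p.snd‖) ^ 2 := by
    rw [mul_pow, Real.sq_sqrt C.coe_nonneg]
    exact_mod_cast h3
  exact le_of_sq_le_sq h4 (by positivity)

end

/-! ### Averages over the future of vector-valued functions -/

section

variable {E G : Type*} [NormedAddCommGroup E] [NormedSpace ℝ E]
  [NormedAddCommGroup G] [NormedSpace ℝ G]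

/-- The convolution of the vector-valued function `F` with the kernel `K`. -/
noncomputable def mollify (K : ℝ → ℝ) (F : ℝ → E) (t : ℝ) : E := ∫ s, K (t - s) • F s

theorem integrable_mollify {K : ℝ → ℝ} {F : ℝ → E} (hK : Continuous K)
    (hKc : HasCompactSupport K) (hF : Integrable F) (t : ℝ) :
    Integrable fun s => K (t - s) • F s := by
  obtain ⟨C, hC⟩ := hKc.exists_bound_of_continuous hK
  exact hF.bdd_smul C (by fun_prop : Continuous fun s => K (t - s)).aestronglyMeasurable
    (.of_forall fun s => hC _)

theorem hasDerivAt_mollify {K : ℝ → ℝ} {F : ℝ → E} (hK : ContDiff ℝ 1 K)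
    (hKc : HasCompactSupport K) (hF : Integrable F) (t : ℝ) :
    HasDerivAt (mollify K F) (mollify (deriv K) F t) t :=
  hKc.hasDerivAt_convolution_right (ContinuousLinearMap.lsmul ℝ ℝ).flip
    hF.locallyIntegrable hK t

theorem continuous_mollify {K : ℝ → ℝ} {F : ℝ → E} (hK : ContDiff ℝ 1 K)
    (hKc : HasCompactSupport K) (hF : Integrable F) : Continuous (mollify K F) :=
  continuous_iff_continuousAt.2 fun t => (hasDerivAt_mollify hK hKc hF t).continuousAt

theorem map_mollify [CompleteSpace E] [CompleteSpace G] (L : E →L[ℝ] G) {K : ℝ → ℝ} {F : ℝ → E}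
    (hK : Continuous K) (hKc : HasCompactSupport K) (hF : Integrable F) (t : ℝ) :
    L (mollify K F t) = mollify K (fun s => L (F s)) t := by
  rw [mollify, ← L.integral_comp_comm (integrable_mollify hK hKc hF t)]
  simp only [map_smul, mollify]

theorem mollify_sub_kernel {K K' : ℝ → ℝ} {F : ℝ → E} (hK : Continuous K)
    (hKc : HasCompactSupport K) (hK' : Continuous K') (hKc' : HasCompactSupport K')
    (hF : Integrable F) (t : ℝ) :
    mollify (fun x => K x - K' x) F t = mollify K F t - mollify K' F t := by
  simp only [mollify, sub_smul]
  exact integral_sub (integrable_mollify hK hKc hF t) (integrable_mollify hK' hKc' hF t)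

/-- A kernel that averages over the future `(t, t + τ)` of the time `t`. -/
structure IsForwardKernel (K : ℝ → ℝ) (τ : ℝ) : Prop where
  contDiff : ContDiff ℝ (⊤ : ℕ∞) K
  compact : HasCompactSupport K
  tsupport_subset : tsupport K ⊆ Ioo (-τ) 0
  nonneg : ∀ x, 0 ≤ K x
  integral_eq_one : ∫ x, K x = 1

theorem exists_isForwardKernel {τ : ℝ} (hτ : 0 < τ) : ∃ K, IsForwardKernel K τ := by
  let b : ContDiffBump (-(τ / 2)) := ⟨τ / 8, τ / 4, by positivity, by linarith⟩
  refine ⟨b.normed volume, b.contDiff_normed, b.hasCompactSupport_normed, ?_, b.nonneg_normed,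
    b.integral_normed⟩
  rw [b.tsupport_normed_eq, Real.closedBall_eq_Icc]
  intro x hx
  have h : b.rOut = τ / 4 := rfl
  rw [h] at hx
  constructor <;> linarith [hx.1, hx.2]

namespace IsForwardKernel

variable {K : ℝ → ℝ} {τ : ℝ}

theorem mem_Ioo (hK : IsForwardKernel K τ) {h : ℝ} (h0 : K (-h) ≠ 0) : h ∈ Ioo 0 τ := by
  have := hK.tsupport_subset (subset_tsupport K h0)
  constructor <;> linarith [this.1, this.2]

theorem integrable (hK : IsForwardKernel K τ) : Integrable K :=
  hK.contDiff.continuous.integrable_of_hasCompactSupport hK.compact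

theorem lintegral_neg (hK : IsForwardKernel K τ) : ∫⁻ h, ENNReal.ofReal (K (-h)) = 1 := by
  rw [lintegral_neg_eq_self (fun h => ENNReal.ofReal (K h)),
    ← ofReal_integral_eq_lintegral_ofReal hK.integrable (.of_forall hK.nonneg),
    hK.integral_eq_one, ENNReal.ofReal_one]

theorem mollify_sub_eq (hK : IsForwardKernel K τ) [CompleteSpace E] {F : ℝ → E}
    (hF : Integrable F) (t : ℝ) (x : E) :
    mollify K F t - x = ∫ h, K (-h) • (F (t + h) - x) := by
  have h1 : mollify K F t = ∫ h, K (-h) • F (t + h) := by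
    rw [mollify, ← integral_add_left_eq_self _ t]
    simp
  have h2 : ∫ h, K (-h) • x = x := by
    rw [integral_smul_const, integral_neg_eq_self K, hK.integral_eq_one, one_smul]
  have hi := integrable_mollify hK.contDiff.continuous hK.compact hF t
  replace hi := hi.comp_add_left t
  simp only [sub_add_cancel_left] at hi
  simp only [smul_sub]
  rw [integral_sub hi (hK.integrable.comp_neg.smul_const x), h2, h1]

/-- `K (-h) dh` is a probability measure, so this is Jensen's inequality for the average of `F (t +
h) - F t`. -/
theorem enorm_mollify_sub_sq_le (hK : IsForwardKernel K τ) [CompleteSpace E] {F : ℝ → E}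
    (hFm : StronglyMeasurable F) (hF : Integrable F) (t : ℝ) :
    ‖mollify K F t - F t‖ₑ ^ 2 ≤ ∫⁻ h, ENNReal.ofReal (K (-h)) * ‖F (t + h) - F t‖ₑ ^ 2 := by
  have hKm : Measurable fun h => ENNReal.ofReal (K (-h)) :=
    (hK.contDiff.continuous.measurable.comp measurable_neg).ennreal_ofReal
  set ν : Measure ℝ := volume.withDensity fun h => ENNReal.ofReal (K (-h)) with hν
  have : IsProbabilityMeasure ν := ⟨by simp [hν, hK.lintegral_neg]⟩
  have hm : Measurable fun h => ‖F (t + h) - F t‖ₑ :=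
    ((hFm.comp_measurable (measurable_const_add t)).sub stronglyMeasurable_const).enorm
  calc ‖mollify K F t - F t‖ₑ ^ 2
      ≤ (∫⁻ h, ENNReal.ofReal (K (-h)) * ‖F (t + h) - F t‖ₑ) ^ 2 := by
        rw [hK.mollify_sub_eq hF]
        gcongr
        refine (enorm_integral_le_lintegral_enorm _).trans_eq (lintegral_congr fun h => ?_)
        rw [enorm_smul, Real.enorm_of_nonneg (hK.nonneg _)]
    _ = (∫⁻ h, ‖F (t + h) - F t‖ₑ ∂ν) ^ 2 := by
        rw [hν, lintegral_withDensity_eq_lintegral_mul _ hKm hm]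
        rfl
    _ ≤ ∫⁻ h, ‖F (t + h) - F t‖ₑ ^ 2 ∂ν := lintegral_sq_le_lintegral_sq hm.aemeasurable
    _ = _ := by
        rw [hν, lintegral_withDensity_eq_lintegral_mul _ hKm (hm.pow_const 2)]
        rfl

theorem lintegral_mollify_sub_le (hK : IsForwardKernel K τ) [CompleteSpace E] {F : ℝ → E}
    (hFm : StronglyMeasurable F) (hF : Integrable F) {η : ℝ≥0∞}
    (hη : ∀ h ∈ Ioo 0 τ, ∫⁻ t, ‖F (t + h) - F t‖ₑ ^ 2 ≤ η) :
    ∫⁻ t, ‖mollify K F t - F t‖ₑ ^ 2 ≤ η := by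
  have hKm : Measurable fun h => ENNReal.ofReal (K (-h)) :=
    (hK.contDiff.continuous.measurable.comp measurable_neg).ennreal_ofReal
  have hm : Measurable fun p : ℝ × ℝ => ‖F (p.1 + p.2) - F p.1‖ₑ ^ 2 :=
    ((hFm.comp_measurable (by fun_prop)).sub (hFm.comp_measurable measurable_fst)).enorm.pow_const 2
  calc _ ≤ ∫⁻ t, ∫⁻ h, ENNReal.ofReal (K (-h)) * ‖F (t + h) - F t‖ₑ ^ 2 :=
        lintegral_mono fun t => hK.enorm_mollify_sub_sq_le hFm hF t
    _ = ∫⁻ h, ∫⁻ t, ENNReal.ofReal (K (-h)) * ‖F (t + h) - F t‖ₑ ^ 2 :=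
        lintegral_lintegral_swap ((hKm.comp measurable_snd).mul hm).aemeasurable
    _ ≤ ∫⁻ h, ENNReal.ofReal (K (-h)) * η := by
        refine lintegral_mono fun h => ?_
        rw [lintegral_const_mul' _ _ ENNReal.ofReal_ne_top]
        by_cases h0 : K (-h) = 0
        · simp [h0]
        · gcongr
          exact hη h (hK.mem_Ioo h0)
    _ = η := by rw [lintegral_mul_const _ hKm, hK.lintegral_neg, one_mul]

end IsForwardKernel

theorem eLpNorm_two_eq {X E : Type*} [MeasurableSpace X] [NormedAddCommGroup E] {μ : Measure X} (f : X → E) :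
    eLpNorm f 2 μ = (∫⁻ x, ‖f x‖ₑ ^ 2 ∂μ) ^ (1 / 2 : ℝ) := by
  rw [eLpNorm_eq_lintegral_rpow_enorm_toReal (by simp) (by simp)]
  norm_num

/-- Translations act continuously on `L²(ℝ)`. -/
theorem exists_forall_eLpNorm_translate_sub_le {E : Type*} [NormedAddCommGroup E] {F : ℝ → E} (hF : MemLp F 2) {η : ℝ≥0∞}
    (hη : 0 < η) : ∃ τ > 0, ∀ h : ℝ, |h| < τ → eLpNorm (fun t => F (t + h) - F t) 2 ≤ η := by
  let tr : ℝ → C(ℝ, ℝ) := fun h => ⟨fun t => t + h, by fun_prop⟩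
  have htr : Continuous tr := ContinuousMap.continuous_of_continuous_uncurry _ (by
    simp only [tr, ContinuousMap.coe_mk]; fun_prop)
  have hmp : ∀ h, MeasurePreserving (tr h) volume volume := fun h =>
    measurePreserving_add_right volume h
  have hc : Continuous fun h => Lp.compMeasurePreserving (tr h) (hmp h) (hF.toLp F) :=
    continuous_const.compMeasurePreservingLp htr hmp (by simp)
  have hlim := (hc.tendsto 0).edist (tendsto_const_nhds (x := Lp.compMeasurePreserving (tr 0)
    (hmp 0) (hF.toLp F)))
  rw [edist_self] at hlim
  obtain ⟨τ, hτ, h⟩ := Metric.eventually_nhds_iff.1 (hlim.eventually_lt_const hη)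
  refine ⟨τ, hτ, fun x hx => le_trans (le_of_eq ?_) (h (y := x) (by simpa using hx)).le⟩
  rw [Lp.toLp_compMeasurePreserving, Lp.toLp_compMeasurePreserving, Lp.edist_toLp_toLp]
  refine eLpNorm_congr_ae (.of_forall fun t => ?_)
  simp [tr]

/-- Averages over short future time intervals converge in `L²(ℝ)`. -/
theorem exists_forall_eLpNorm_mollify_sub_le [CompleteSpace E] {F : ℝ → E} (hF : MemLp F 2)
    (hF1 : Integrable F) {η : ℝ≥0∞} (hη : 0 < η) :
    ∃ τ₀ > 0, ∀ τ ≤ τ₀, ∀ K, IsForwardKernel K τ →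
      eLpNorm (fun t => mollify K F t - F t) 2 ≤ η := by
  -- The exchange of integrals needs joint measurability of `F (t + h)`. A strongly measurable
  -- representative has it, with the same averages at every time.
  set F' := hF.1.mk F
  have hF'm : StronglyMeasurable F' := hF.1.stronglyMeasurable_mk
  have hae : F =ᵐ[volume] F' := hF.1.ae_eq_mk
  have hF1' : Integrable F' := hF1.congr hae
  obtain ⟨τ₀, hτ₀, h⟩ := exists_forall_eLpNorm_translate_sub_le (hF.ae_eq hae) hη
  refine ⟨τ₀, hτ₀, fun τ hτ K hK => ?_⟩
  have hm : ∀ t, mollify K F t = mollify K F' t := fun t =>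
    integral_congr_ae (hae.mono fun s hs => by simp only [hs])
  have h1 : eLpNorm (fun t => mollify K F t - F t) 2 =
      eLpNorm (fun t => mollify K F' t - F' t) 2 :=
    eLpNorm_congr_ae (hae.mono fun t ht => by simp only [hm, ht])
  have h2 := hK.lintegral_mollify_sub_le (η := η ^ 2) hF'm hF1' (by
    intro s hs
    have h3 := h s (by rw [abs_of_pos hs.1]; exact hs.2.trans_le hτ)
    rw [eLpNorm_two_eq] at h3
    calc _ = ((∫⁻ t, ‖F' (t + s) - F' t‖ₑ ^ 2) ^ (1 / 2 : ℝ)) ^ 2 := by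
          rw [← ENNReal.rpow_natCast, ← ENNReal.rpow_mul]; norm_num
      _ ≤ _ := by gcongr)
  rw [h1, eLpNorm_two_eq]
  calc _ ≤ (η ^ 2) ^ (1 / 2 : ℝ) := by gcongr
    _ = η := by rw [← ENNReal.rpow_natCast, ← ENNReal.rpow_mul]; norm_num

/-- An approximate identity adapted to a function of `L²(ℝ)`. -/
theorem exists_isForwardKernel_seq [CompleteSpace E] {F : ℝ → E} (hF : MemLp F 2)
    (hF1 : Integrable F) : ∃ (K : ℕ → ℝ → ℝ) (τ : ℕ → ℝ), (∀ n, IsForwardKernel (K n) (τ n)) ∧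
      (∀ n, 0 < τ n) ∧ Tendsto τ atTop (𝓝 0) ∧
      ∀ n : ℕ, eLpNorm (fun t => mollify (K n) F t - F t) 2 ≤ ENNReal.ofReal (1 / (n + 1)) := by
  have h : ∀ n : ℕ, ∃ (K : ℝ → ℝ) (τ : ℝ), IsForwardKernel K τ ∧ 0 < τ ∧ τ ≤ 1 / (n + 1) ∧
      eLpNorm (fun t => mollify K F t - F t) 2 ≤ ENNReal.ofReal (1 / (n + 1)) := fun n => by
    obtain ⟨τ₀, hτ₀, h⟩ := exists_forall_eLpNorm_mollify_sub_le hF hF1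
      (η := ENNReal.ofReal (1 / (n + 1))) (ENNReal.ofReal_pos.2 (by positivity))
    have hτ : 0 < min τ₀ (1 / (n + 1)) := by positivity
    obtain ⟨K, hK⟩ := exists_isForwardKernel hτ
    exact ⟨K, _, hK, hτ, min_le_right _ _, h _ (min_le_left _ _) K hK⟩
  choose K τ h1 h2 h3 h4 using h
  exact ⟨K, τ, h1, h2, squeeze_zero (fun n => (h2 n).le) h3 tendsto_one_div_add_atTop_nhds_zero_nat,
    h4⟩

/-- The averages over the future at the time `0` converge to the initial value. -/
theorem tendsto_mollify_zero [CompleteSpace E] {K : ℕ → ℝ → ℝ} {τ : ℕ → ℝ}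
    (hK : ∀ n, IsForwardKernel (K n) (τ n)) (hτ : Tendsto τ atTop (𝓝 0)) {T : ℝ} (hT : 0 < T)
    {F w : ℝ → E} (hF : Integrable F) (hFw : ∀ᵐ s ∂volume.restrict (Ioo 0 T), F s = w s) {x : E}
    (hw : Tendsto w (𝓝[>] 0) (𝓝 x)) : Tendsto (fun n => mollify (K n) F 0) atTop (𝓝 x) := by
  rw [Metric.tendsto_nhds]
  intro η hη
  obtain ⟨δ, hδ, hδw⟩ := Metric.mem_nhdsWithin_iff.1 (hw (Metric.ball_mem_nhds x (half_pos hη)))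
  have hmin : 0 < min δ T := lt_min hδ hT
  filter_upwards [hτ.eventually_lt_const hmin] with n hn
  rw [dist_eq_norm, (hK n).mollify_sub_eq hF]
  rw [ae_restrict_iff' measurableSet_Ioo] at hFw
  -- Only the times `h ∈ (0, τ n)` contribute, and for large `n` these lie in `(0, T)` and within
  -- `δ` of `0`.
  have hb : ∀ᵐ h, ‖K n (-h) • (F (0 + h) - x)‖ ≤ K n (-h) * (η / 2) := by
    filter_upwards [hFw] with h hh
    rw [norm_smul, Real.norm_of_nonneg ((hK n).nonneg _), zero_add]
    by_cases h0 : K n (-h) = 0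
    · simp [h0]
    · have hm := (hK n).mem_Ioo h0
      have h1 : h < min δ T := hm.2.trans hn
      rw [hh ⟨hm.1, h1.trans_le (min_le_right _ _)⟩]
      have h2 : w h ∈ Metric.ball x (η / 2) := hδw ⟨by
        rw [Metric.mem_ball, Real.dist_0_eq_abs, abs_of_pos hm.1]
        exact h1.trans_le (min_le_left _ _), hm.1⟩
      rw [mem_ball_iff_norm] at h2
      exact mul_le_mul_of_nonneg_left h2.le ((hK n).nonneg _)
  refine (norm_integral_le_of_norm_le ((hK n).integrable.comp_neg.mul_const _) hb).trans_lt ?_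
  rw [integral_mul_const, integral_neg_eq_self (K n), (hK n).integral_eq_one]
  linarith

/-- For a kernel that looks into the future, the integrand of a mollification is a test
function. -/
theorem isTimeTest_kernel {K : ℝ → ℝ} {τ T t : ℝ} (hK : ContDiff ℝ (⊤ : ℕ∞) K)
    (hKc : HasCompactSupport K) (hKs : tsupport K ⊆ Ioo (-τ) 0) (ht : t ∈ Icc 0 (T - τ)) :
    IsTimeTest T fun s => K (t - s) := by
  have hs : tsupport (fun s => K (t - s)) ⊆ (fun s => t - s) ⁻¹' tsupport K :=
    closure_minimal (fun s hs => subset_tsupport K hs)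
      ((isClosed_tsupport K).preimage (by fun_prop))
  refine ⟨hK.comp (by fun_prop), ?_, fun s h => ?_⟩
  · exact hKc.comp_homeomorph (Homeomorph.subLeft t)
  · have h1 := hKs (hs h)
    constructor <;> linarith [h1.1, h1.2, ht.1, ht.2]

theorem deriv_kernel (K : ℝ → ℝ) (t s : ℝ) :
    deriv (fun s => K (t - s)) s = -deriv K (t - s) :=
  deriv_comp_const_sub ..

end

/-! ### The abstract weak wave equation and its averaged energy identity -/

section

variable {V H : Type*} [NormedAddCommGroup V] [InnerProductSpace ℝ V]
  [NormedAddCommGroup H] [InnerProductSpace ℝ H]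

/-- The pair `(u, d)` is a weak solution on `(0, T)` of the abstract equation
`(M* M u')' + a u = g` with `d = u'`, where `j : V → H`, `M : H → H` and `a` is a bilinear form on
`V`; the functions are extended to the real line. -/
structure IsWeakWave (T : ℝ) (j : V →L[ℝ] H) (M : H →L[ℝ] H) (a : V →L[ℝ] V →L[ℝ] ℝ)
    (u : ℝ → V) (d g : ℝ → H) : Prop where
  u_memLp : MemLp u 2
  u_integrable : Integrable u
  d_memLp : MemLp d 2
  d_integrable : Integrable d
  g_memLp : MemLp g 2
  g_integrable : Integrable g
  hasTimeDeriv : ∀ φ, IsTimeTest T φ → ∫ s, deriv φ s • j (u s) = -∫ s, φ s • d s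
  equation : ∀ φ, IsTimeTest T φ → ∀ v, ∫ s, deriv φ s * ⟪M (d s), M (j v)⟫ =
    -∫ s, φ s * (⟪g s, j v⟫ - a (u s) v)

/-- The energy of a position `u` and a velocity `d`. -/
noncomputable def energy (M : H →L[ℝ] H) (a : V →L[ℝ] V →L[ℝ] ℝ) (u : V) (d : H) : ℝ :=
  1 / 2 * ‖M d‖ ^ 2 + 1 / 2 * a u u

theorem energy_le (M : H →L[ℝ] H) (a : V →L[ℝ] V →L[ℝ] ℝ) (u : V) (d : H) :
    energy M a u d ≤ 1 / 2 * ‖M‖ ^ 2 * ‖d‖ ^ 2 + 1 / 2 * ‖a‖ * ‖u‖ ^ 2 := by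
  have h1 : ‖M d‖ ^ 2 ≤ (‖M‖ * ‖d‖) ^ 2 := by gcongr; exact M.le_opNorm d
  have h2 := (le_abs_self _).trans (a.le_opNorm₂ u u)
  rw [energy]
  linarith

variable [CompleteSpace V] [CompleteSpace H]

namespace IsWeakWave

variable {T : ℝ} {j : V →L[ℝ] H} {M : H →L[ℝ] H} {a : V →L[ℝ] V →L[ℝ] ℝ}
  {u : ℝ → V} {d g : ℝ → H} {K : ℝ → ℝ} {τ : ℝ}

/-- Testing the weak derivative with `s ↦ K (t - s)`, supported in `(t, t + τ) ⊆ (0, T)`. In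
consequence the averaged velocity is the image under `j` of an element of `V`, hence an admissible
test function. -/
theorem map_mollify_deriv (h : IsWeakWave T j M a u d g) (hK : ContDiff ℝ (⊤ : ℕ∞) K)
    (hKc : HasCompactSupport K) (hKs : tsupport K ⊆ Ioo (-τ) 0) {t : ℝ} (ht : t ∈ Icc 0 (T - τ)) :
    j (mollify (deriv K) u t) = mollify K d t := by
  have h1 := h.hasTimeDeriv _ (isTimeTest_kernel hK hKc hKs ht)
  simp only [deriv_kernel, neg_smul, integral_neg, neg_inj] at h1
  rw [map_mollify j (hK.continuous_deriv (by simp)) hKc.deriv h.u_integrable]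
  exact h1

theorem inner_mollify_deriv (h : IsWeakWave T j M a u d g) (hK : ContDiff ℝ (⊤ : ℕ∞) K)
    (hKc : HasCompactSupport K) (hKs : tsupport K ⊆ Ioo (-τ) 0) {t : ℝ} (ht : t ∈ Icc 0 (T - τ))
    (v : V) : ⟪M (mollify (deriv K) d t), M (j v)⟫ =
      ⟪mollify K g t, j v⟫ - a (mollify K u t) v := by
  have h1 := h.equation _ (isTimeTest_kernel hK hKc hKs ht) v
  simp only [deriv_kernel, neg_mul, integral_neg, neg_inj] at h1
  have e1 := map_mollify ((innerSL ℝ (M (j v))).comp M) (hK.continuous_deriv (by simp)) hKc.deriv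
    h.d_integrable t
  have e2 := map_mollify (innerSL ℝ (j v)) hK.continuous hKc h.g_integrable t
  have e3 := map_mollify (a.flip v) hK.continuous hKc h.u_integrable t
  simp only [ContinuousLinearMap.comp_apply, innerSL_apply_apply,
    ContinuousLinearMap.flip_apply] at e1 e2 e3
  rw [real_inner_comm, e1, real_inner_comm, e2, e3]
  simp only [mollify, smul_eq_mul] at h1 ⊢
  have i1 := integrable_mollify hK.continuous hKc ((innerSL ℝ (j v)).integrable_comp h.g_integrable) t
  have i2 := integrable_mollify hK.continuous hKc ((a.flip v).integrable_comp h.u_integrable) t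
  simp only [innerSL_apply_apply, ContinuousLinearMap.flip_apply, smul_eq_mul] at i1 i2
  rw [← integral_sub i1 i2]
  simp only [real_inner_comm (j v), real_inner_comm (M (j v))] at h1 ⊢
  rw [h1]
  simp only [mul_sub]

/-- The energy identity for the solution averaged in time. -/
theorem energy_mollify (h : IsWeakWave T j M a u d g) (ha : ∀ v w, a v w = a w v)
    (hK : ContDiff ℝ (⊤ : ℕ∞) K) (hKc : HasCompactSupport K) (hKs : tsupport K ⊆ Ioo (-τ) 0)
    {t : ℝ} (ht : t ∈ Icc 0 (T - τ)) :
    energy M a (mollify K u t) (mollify K d t) = energy M a (mollify K u 0) (mollify K d 0) +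
      ∫ s in (0 : ℝ)..t, ⟪mollify K g s, mollify K d s⟫ := by
  have hK1 : ContDiff ℝ 1 K := hK.of_le (by exact_mod_cast le_top)
  have hd : ∀ s ∈ uIcc 0 t, HasDerivAt (fun s => energy M a (mollify K u s) (mollify K d s))
      ⟪mollify K g s, mollify K d s⟫ s := by
    intro s hs
    rw [uIcc_of_le ht.1] at hs
    have hs' : s ∈ Icc 0 (T - τ) := ⟨hs.1, hs.2.trans ht.2⟩
    have hu := hasDerivAt_mollify hK1 hKc h.u_integrable s
    have hdd := hasDerivAt_mollify hK1 hKc h.d_integrable s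
    have h1 := ((M.hasFDerivAt.comp_hasDerivAt s hdd).norm_sq).const_mul (1 / 2)
    have h2 := ((a.hasFDerivAt.comp_hasDerivAt s hu).clm_apply hu).const_mul (1 / 2)
    refine (h1.add h2).congr_deriv ?_
    simp only [Function.comp_apply]
    -- The test vector is the time derivative of the averaged position; the elastic terms then
    -- cancel by symmetry of `a`.
    have h3 := h.inner_mollify_deriv hK hKc hKs hs' (mollify (deriv K) u s)
    rw [h.map_mollify_deriv hK hKc hKs hs'] at h3
    rw [ha (mollify (deriv K) u s), real_inner_comm, h3]
    ring
  have hc : Continuous fun s => ⟪mollify K g s, mollify K d s⟫ :=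
    (continuous_mollify hK1 hKc h.g_integrable).inner (continuous_mollify hK1 hKc h.d_integrable)
  rw [intervalIntegral.integral_eq_sub_of_hasDerivAt hd (hc.intervalIntegrable _ _)]
  ring

end IsWeakWave

end

/-! ### The energy identity up to the initial time -/

theorem MeasureTheory.MemLp.prodMk_mk {X E G : Type*} [MeasurableSpace X] {μ : Measure X}
    [NormedAddCommGroup E] [NormedAddCommGroup G] {p : ℝ≥0∞} {f : X → E} {g : X → G}
    (hf : MemLp f p μ) (hg : MemLp g p μ) : MemLp (fun x => (f x, g x)) p μ := by
  refine (hf.norm.add hg.norm).mono (hf.1.prodMk hg.1) (.of_forall fun x => ?_)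
  rw [Pi.add_apply, Real.norm_of_nonneg (by positivity)]
  exact max_le (le_add_of_nonneg_right (norm_nonneg _)) (le_add_of_nonneg_left (norm_nonneg _))

theorem integral_norm_sq_eq {X E : Type*} [MeasurableSpace X] {μ : Measure X}
    [NormedAddCommGroup E] {f : X → E} (hf : MemLp f 2 μ) :
    ∫ x, ‖f x‖ ^ 2 ∂μ = (eLpNorm f 2 μ).toReal ^ 2 := by
  rw [integral_eq_lintegral_of_nonneg_ae (.of_forall fun x => by positivity)
    (f := fun x => ‖f x‖ ^ 2) (hf.1.norm.pow 2), ← ENNReal.toReal_pow, eLpNorm_two_eq, ← ENNReal.rpow_natCast,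
    ← ENNReal.rpow_mul]
  norm_num

theorem tendsto_integral_inner {X H : Type*} [MeasurableSpace X] {μ : Measure X}
    [NormedAddCommGroup H] [InnerProductSpace ℝ H] {f g : ℕ → X → H} {f' g' : X → H}
    (hf : ∀ n, MemLp (f n) 2 μ) (hg : ∀ n, MemLp (g n) 2 μ) (hf' : MemLp f' 2 μ)
    (hg' : MemLp g' 2 μ) (h1 : Tendsto (fun n => eLpNorm (f n - f') 2 μ) atTop (𝓝 0))
    (h2 : Tendsto (fun n => eLpNorm (g n - g') 2 μ) atTop (𝓝 0)) :
    Tendsto (fun n => ∫ x, ⟪f n x, g n x⟫ ∂μ) atTop (𝓝 (∫ x, ⟪f' x, g' x⟫ ∂μ)) := by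
  have e : ∀ {a b : X → H} (ha : MemLp a 2 μ) (hb : MemLp b 2 μ),
      ⟪ha.toLp a, hb.toLp b⟫ = ∫ x, ⟪a x, b x⟫ ∂μ := fun ha hb => by
    rw [L2.inner_def]
    refine integral_congr_ae ?_
    filter_upwards [ha.coeFn_toLp, hb.coeFn_toLp] with x h1 h2
    rw [h1, h2]
  have h := ((Lp.tendsto_Lp_iff_tendsto_eLpNorm'' f hf f' hf').2 h1).inner (𝕜 := ℝ)
    ((Lp.tendsto_Lp_iff_tendsto_eLpNorm'' g hg g' hg').2 h2)
  simpa only [e] using h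

section

variable {V H : Type*} [NormedAddCommGroup V] [InnerProductSpace ℝ V]
  [NormedAddCommGroup H] [InnerProductSpace ℝ H]

namespace IsWeakWave

variable {T : ℝ} {j : V →L[ℝ] H} {M : H →L[ℝ] H} {a : V →L[ℝ] V →L[ℝ] ℝ}
  {u : ℝ → V} {d g : ℝ → H}

theorem memLp_triple (h : IsWeakWave T j M a u d g) : MemLp (fun s => (u s, d s, g s)) 2 :=
  h.u_memLp.prodMk_mk (h.d_memLp.prodMk_mk h.g_memLp)

theorem integrable_triple (h : IsWeakWave T j M a u d g) : Integrable fun s => (u s, d s, g s) :=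
  h.u_integrable.prodMk (h.d_integrable.prodMk h.g_integrable)

variable [CompleteSpace V] [CompleteSpace H]

theorem mollify_triple (h : IsWeakWave T j M a u d g) {K : ℝ → ℝ} (hK : Continuous K)
    (hKc : HasCompactSupport K) (t : ℝ) : mollify K (fun s => (u s, d s, g s)) t =
      (mollify K u t, mollify K d t, mollify K g t) := by
  have hi := h.integrable_triple
  refine Prod.ext ?_ (Prod.ext ?_ ?_)
  · exact map_mollify (ContinuousLinearMap.fst ℝ V (H × H)) hK hKc hi t
  · exact map_mollify ((ContinuousLinearMap.fst ℝ H H).comp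
      (ContinuousLinearMap.snd ℝ V (H × H))) hK hKc hi t
  · exact map_mollify ((ContinuousLinearMap.snd ℝ H H).comp
      (ContinuousLinearMap.snd ℝ V (H × H))) hK hKc hi t

/-- Averaging the energy identity over `t ∈ (0, T/2)` bounds a pointwise quantity at time `0` by an
`L²` norm in time. No sign of `K` is assumed, so that the estimate applies to differences of
kernels. -/
theorem energy_mollify_zero_le (h : IsWeakWave T j M a u d g) (ha : ∀ v w, a v w = a w v)
    (hT : 0 < T) {K : ℝ → ℝ} {τ : ℝ} (hK : ContDiff ℝ (⊤ : ℕ∞) K) (hKc : HasCompactSupport K)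
    (hKs : tsupport K ⊆ Ioo (-τ) 0) (hτ : τ ≤ T / 2)
    (hP : MemLp (mollify K fun s => (u s, d s, g s)) 2) :
    energy M a (mollify K u 0) (mollify K d 0) ≤
      ((1 / 2 * ‖M‖ ^ 2 + 1 / 2 * ‖a‖) * (2 / T) + 1) *
        ∫ s, ‖mollify K (fun s => (u s, d s, g s)) s‖ ^ 2 := by
  set P := mollify K fun s => (u s, d s, g s) with hPdef
  set B := ∫ s, ‖P s‖ ^ 2
  set c := 1 / 2 * ‖M‖ ^ 2 + 1 / 2 * ‖a‖
  have hK1 : ContDiff ℝ 1 K := hK.of_le (by exact_mod_cast le_top)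
  have hPi : Integrable fun s => ‖P s‖ ^ 2 := hP.norm.integrable_sq
  have hPt := h.mollify_triple hK.continuous hKc
  have hu : ∀ s, ‖mollify K u s‖ ≤ ‖P s‖ := fun s => by rw [hPdef, hPt]; exact le_max_left _ _
  have hd : ∀ s, ‖mollify K d s‖ ≤ ‖P s‖ := fun s => by
    rw [hPdef, hPt]; exact (le_max_left _ _).trans (le_max_right _ _)
  have hg : ∀ s, ‖mollify K g s‖ ≤ ‖P s‖ := fun s => by
    rw [hPdef, hPt]; exact (le_max_right _ _).trans (le_max_right _ _)
  have hI : ∀ t, 0 ≤ t → -∫ s in (0 : ℝ)..t, ⟪mollify K g s, mollify K d s⟫ ≤ B := by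
    intro t ht
    rw [intervalIntegral.integral_of_le ht]
    refine (neg_le_abs _).trans (le_trans ?_
      (setIntegral_le_integral (s := Ioc 0 t) hPi (.of_forall fun s => by positivity)))
    refine norm_integral_le_of_norm_le (f := fun s => ⟪mollify K g s, mollify K d s⟫)
      (hPi.restrict (s := Ioc 0 t)) (.of_forall fun s => ?_)
    refine (norm_inner_le_norm _ _).trans ?_
    rw [sq]
    exact mul_le_mul (hg s) (hd s) (norm_nonneg _) (norm_nonneg _)
  -- Since `τ ≤ T / 2`, the identity is available on all of `[0, T / 2]`.
  have hpt : ∀ t ∈ Ioc 0 (T / 2), energy M a (mollify K u 0) (mollify K d 0) ≤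
      c * ‖P t‖ ^ 2 + B := by
    intro t ht
    have h1 := h.energy_mollify ha hK hKc hKs (t := t) ⟨ht.1.le, by linarith [ht.2]⟩
    have h2 := energy_le M a (mollify K u t) (mollify K d t)
    have h3 : 1 / 2 * ‖M‖ ^ 2 * ‖mollify K d t‖ ^ 2 ≤ 1 / 2 * ‖M‖ ^ 2 * ‖P t‖ ^ 2 := by
      gcongr; exact hd t
    have h4 : 1 / 2 * ‖a‖ * ‖mollify K u t‖ ^ 2 ≤ 1 / 2 * ‖a‖ * ‖P t‖ ^ 2 := by
      gcongr; exact hu t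
    have h5 := hI t ht.1.le
    have h6 : c * ‖P t‖ ^ 2 = 1 / 2 * ‖M‖ ^ 2 * ‖P t‖ ^ 2 + 1 / 2 * ‖a‖ * ‖P t‖ ^ 2 := by
      simp only [c]; ring
    linarith
  have hint : ∫ _ in Ioc 0 (T / 2), energy M a (mollify K u 0) (mollify K d 0) ≤
      ∫ t in Ioc 0 (T / 2), (c * ‖P t‖ ^ 2 + B) :=
    setIntegral_mono_on (by simp) (((hPi.const_mul c).integrableOn).add (by simp))
      measurableSet_Ioc hpt
  rw [integral_add ((hPi.const_mul c).integrableOn) (by simp), setIntegral_const, setIntegral_const,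
    integral_const_mul] at hint
  have hB : ∫ t in Ioc 0 (T / 2), ‖P t‖ ^ 2 ≤ B :=
    setIntegral_le_integral hPi (.of_forall fun s => by positivity)
  have hcB := mul_le_mul_of_nonneg_left hB (show 0 ≤ c by positivity)
  simp only [Measure.real, Real.volume_Ioc, sub_zero, smul_eq_mul,
    ENNReal.toReal_ofReal (half_pos hT).le] at hint
  have e : (c * (2 / T) + 1) * B = (c * B + T / 2 * B) / (T / 2) := by field_simp
  rw [e, le_div_iff₀ (half_pos hT)]
  linarith

/-- The energy identity for weak solutions, including the initial time. -/
theorem exists_energy_identity (h : IsWeakWave T j M a u d g) (ha : ∀ v w, a v w = a w v)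
    (ha0 : ∀ v, 0 ≤ a v v) {c₀ : ℝ} (hc₀ : ∀ v, ‖v‖ ^ 2 ≤ ‖j v‖ ^ 2 + c₀ * a v v)
    (hT : 0 < T) {w : ℝ → H} {w₀ : H} (hw : Tendsto w (𝓝[>] 0) (𝓝 w₀))
    (huw : ∀ᵐ s ∂volume.restrict (Ioo 0 T), j (u s) = w s) {q : V → ℝ → ℝ} {q₀ : V → ℝ}
    (hq : ∀ v, Tendsto (q v) (𝓝[>] 0) (𝓝 (q₀ v)))
    (hdq : ∀ v, ∀ᵐ s ∂volume.restrict (Ioo 0 T), ⟪M (d s), M (j v)⟫ = q v s) :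
    ∃ (U : V) (m : H), j U = w₀ ∧ (∀ v, ⟪m, M (j v)⟫ = q₀ v) ∧ m ∈ closure (range M) ∧
      ∀ᵐ t ∂volume.restrict (Ioo 0 T), energy M a (u t) (d t) =
        1 / 2 * ‖m‖ ^ 2 + 1 / 2 * a U U + ∫ s in (0 : ℝ)..t, ⟪g s, d s⟫ := by
  -- One sequence of kernels is adapted to the triple `(u, d, g)`, so that the three averages
  -- converge together.
  obtain ⟨K, τ, hK, hτ0, hτ, hKp⟩ := exists_isForwardKernel_seq h.memLp_triple h.integrable_triple
  set p := fun s => (u s, d s, g s) with hp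
  have hcont : ∀ n, Continuous (K n) := fun n => (hK n).contDiff.continuous
  have hK1 : ∀ n, ContDiff ℝ 1 (K n) := fun n => (hK n).contDiff.of_le (by exact_mod_cast le_top)
  have hPcont : ∀ n, Continuous (mollify (K n) p) := fun n =>
    continuous_mollify (hK1 n) (hK n).compact h.integrable_triple
  have hsub : ∀ n, MemLp (fun t => mollify (K n) p t - p t) 2 := fun n =>
    ⟨(hPcont n).aestronglyMeasurable.sub h.memLp_triple.1, (hKp n).trans_lt ENNReal.ofReal_lt_top⟩
  have hPm : ∀ n, MemLp (mollify (K n) p) 2 := fun n => by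
    have := (hsub n).add h.memLp_triple
    refine this.ae_eq (.of_forall fun t => ?_)
    simp [hp]
  have hlim : Tendsto (fun n => eLpNorm (fun t => mollify (K n) p t - p t) 2) atTop (𝓝 0) := by
    refine tendsto_of_tendsto_of_tendsto_of_le_of_le tendsto_const_nhds ?_ (fun n => zero_le) hKp
    rw [← ENNReal.ofReal_zero]
    exact ENNReal.tendsto_ofReal tendsto_one_div_add_atTop_nhds_zero_nat
  have htrip := fun n => h.mollify_triple (hcont n) (hK n).compact
  -- By linearity the difference of two averages is the average with kernel `K n - K k`; its initial
  -- energy is bounded by the squared `L²` distance of the averaged triples.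
  have hE : ∃ C : ℝ, ∀ n k, τ n ≤ T / 2 → τ k ≤ T / 2 →
      energy M a (mollify (K n) u 0 - mollify (K k) u 0) (mollify (K n) d 0 - mollify (K k) d 0) ≤
        C * (1 / ((n : ℝ) + 1) + 1 / ((k : ℝ) + 1)) ^ 2 := by
    refine ⟨(1 / 2 * ‖M‖ ^ 2 + 1 / 2 * ‖a‖) * (2 / T) + 1, fun n k hn hk => ?_⟩
    have hPe : mollify (fun x => K n x - K k x) p = mollify (K n) p - mollify (K k) p :=
      funext fun t => mollify_sub_kernel (hcont n) (hK n).compact (hcont k) (hK k).compact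
        h.integrable_triple t
    have h1 := h.energy_mollify_zero_le ha hT (K := fun x => K n x - K k x) (τ := max (τ n) (τ k))
      ((hK n).contDiff.sub (hK k).contDiff) ((hK n).compact.sub (hK k).compact) (by
        refine (tsupport_sub (K n) (K k)).trans (union_subset ?_ ?_)
        · exact (hK n).tsupport_subset.trans (Ioo_subset_Ioo_left (neg_le_neg (le_max_left _ _)))
        · exact (hK k).tsupport_subset.trans (Ioo_subset_Ioo_left (neg_le_neg (le_max_right _ _))))
      (max_le hn hk) (by rw [hPe]; exact (hPm n).sub (hPm k))
    rw [mollify_sub_kernel (hcont n) (hK n).compact (hcont k) (hK k).compact h.u_integrable,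
      mollify_sub_kernel (hcont n) (hK n).compact (hcont k) (hK k).compact h.d_integrable,
      integral_norm_sq_eq (by
      rw [hPe]; exact (hPm n).sub (hPm k))] at h1
    refine h1.trans ?_
    gcongr
    refine ENNReal.toReal_le_of_le_ofReal (by positivity) ?_
    have e : mollify (fun x => K n x - K k x) p =
        (fun t => mollify (K n) p t - p t) - fun t => mollify (K k) p t - p t := by
      rw [hPe]; ext1 t; simp
    rw [e, ENNReal.ofReal_add (by positivity) (by positivity)]
    exact (eLpNorm_sub_le (hsub n).1 (hsub k).1 (by norm_num)).trans (add_le_add (hKp n) (hKp k))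
  obtain ⟨C, hC⟩ := hE
  set e : ℕ × ℕ → ℝ := fun x => energy M a (mollify (K x.1) u 0 - mollify (K x.2) u 0)
    (mollify (K x.1) d 0 - mollify (K x.2) d 0) with he
  have he0 : ∀ v w, 0 ≤ energy M a v w := fun v w =>
    add_nonneg (by positivity) (mul_nonneg (by norm_num) (ha0 v))
  have hT2 : ∀ᶠ n in atTop, τ n ≤ T / 2 := hτ.eventually_le_const (half_pos hT)
  have helim : Tendsto e atTop (𝓝 0) := by
    rw [← prod_atTop_atTop_eq]
    have hb : Tendsto (fun x : ℕ × ℕ => C * (1 / ((x.1 : ℝ) + 1) + 1 / ((x.2 : ℝ) + 1)) ^ 2)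
        (atTop ×ˢ atTop) (𝓝 0) := by
      have h1 : Tendsto (fun n : ℕ => 1 / ((n : ℝ) + 1)) atTop (𝓝 0) :=
        tendsto_one_div_add_atTop_nhds_zero_nat
      simpa using (((h1.comp tendsto_fst).add (h1.comp tendsto_snd)).pow 2).const_mul C
    refine tendsto_of_tendsto_of_tendsto_of_le_of_le' tendsto_const_nhds hb
      (.of_forall fun x => he0 _ _) ?_
    filter_upwards [hT2.prod_mk hT2] with x hx using hC x.1 x.2 hx.1 hx.2
  have hju : Tendsto (fun n => j (mollify (K n) u 0)) atTop (𝓝 w₀) := by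
    simp_rw [fun n => map_mollify j (hcont n) (hK n).compact h.u_integrable 0]
    exact tendsto_mollify_zero hK hτ hT (j.integrable_comp h.u_integrable) huw hw
  have hMd : CauchySeq fun n => M (mollify (K n) d 0) := by
    rw [cauchySeq_iff_tendsto_dist_atTop_0]
    have h1 : Tendsto (fun x => √(2 * e x)) atTop (𝓝 0) := by
      simpa using (helim.const_mul 2).sqrt
    refine squeeze_zero (fun x => dist_nonneg) (fun x => Real.le_sqrt_of_sq_le ?_) h1
    rw [dist_eq_norm, ← map_sub]
    simp only [he, energy]
    linarith [ha0 (mollify (K x.1) u 0 - mollify (K x.2) u 0)]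
  -- The form `a` alone need not control the norm of `V`; the missing part is supplied by the
  -- convergence of `j` of the averages to `w₀`.
  have hu0 : CauchySeq fun n => mollify (K n) u 0 := by
    rw [cauchySeq_iff_tendsto_dist_atTop_0]
    have h1 := (cauchySeq_iff_tendsto_dist_atTop_0.1 hju.cauchySeq).pow 2
    have h2 : Tendsto (fun x : ℕ × ℕ => √(dist (j (mollify (K x.1) u 0)) (j (mollify (K x.2) u 0)) ^ 2
        + |c₀| * (2 * e x))) atTop (𝓝 0) := by
      simpa using (h1.add ((helim.const_mul 2).const_mul |c₀|)).sqrt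
    refine squeeze_zero (fun x => dist_nonneg) (fun x => Real.le_sqrt_of_sq_le ?_) h2
    rw [dist_eq_norm, dist_eq_norm, ← map_sub]
    refine (hc₀ _).trans (add_le_add_right ?_ _)
    refine mul_le_mul (le_abs_self _) ?_ (ha0 _) (abs_nonneg _)
    simp only [he, energy]
    linarith [sq_nonneg ‖M (mollify (K x.1) d 0 - mollify (K x.2) d 0)‖]
  obtain ⟨U, hU⟩ := cauchySeq_tendsto_of_complete hu0
  obtain ⟨m, hm⟩ := cauchySeq_tendsto_of_complete hMd
  have hE0 : Tendsto (fun n => energy M a (mollify (K n) u 0) (mollify (K n) d 0)) atTop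
      (𝓝 (1 / 2 * ‖m‖ ^ 2 + 1 / 2 * a U U)) :=
    ((hm.norm.pow 2).const_mul _).add
      (((a.continuous₂.tendsto (U, U)).comp (hU.prodMk_nhds hU)).const_mul _)
  refine ⟨U, m, tendsto_nhds_unique ((j.continuous.tendsto U).comp hU) hju, fun v => ?_,
    mem_closure_of_tendsto hm (.of_forall fun n => mem_range_self _), ?_⟩
  · refine tendsto_nhds_unique (hm.inner tendsto_const_nhds) ?_
    have e1 : ∀ n, ⟪M (mollify (K n) d 0), M (j v)⟫ =
        mollify (K n) (fun s => ⟪M (d s), M (j v)⟫) 0 := fun n => by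
      have := map_mollify ((innerSL ℝ (M (j v))).comp M) (hcont n) (hK n).compact h.d_integrable 0
      simpa only [ContinuousLinearMap.comp_apply, innerSL_apply_apply,
        real_inner_comm (M (j v))] using this
    simp_rw [e1]
    exact tendsto_mollify_zero hK hτ hT ((M.integrable_comp h.d_integrable).inner_const _)
      (hdq v) (hq v)
  -- Convergence in `L²` gives convergence at almost every time along a subsequence.
  · obtain ⟨ns, hns, hae⟩ := (tendstoInMeasure_of_tendsto_eLpNorm (p := 2) (by norm_num)
      (fun n => (hPm n).1) h.memLp_triple.1 hlim).exists_seq_tendsto_ae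
    filter_upwards [ae_restrict_of_ae hae, ae_restrict_mem measurableSet_Ioo] with t ht htT
    have hcomp : Tendsto (fun n => (mollify (K (ns n)) u t, mollify (K (ns n)) d t,
        mollify (K (ns n)) g t)) atTop (𝓝 (u t, d t, g t)) := by
      simpa only [← htrip] using ht
    have hut := hcomp.fst_nhds
    have hdt := hcomp.snd_nhds.fst_nhds
    have hEt : Tendsto (fun n => energy M a (mollify (K (ns n)) u t) (mollify (K (ns n)) d t)) atTop
        (𝓝 (energy M a (u t) (d t))) :=
      ((((M.continuous.tendsto _).comp hdt).norm.pow 2).const_mul _).add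
        (((a.continuous₂.tendsto (u t, u t)).comp (hut.prodMk_nhds hut)).const_mul _)
    have hint : Tendsto (fun n => ∫ s in (0 : ℝ)..t, ⟪mollify (K n) g s, mollify (K n) d s⟫) atTop
        (𝓝 (∫ s in (0 : ℝ)..t, ⟪g s, d s⟫)) := by
      simp only [intervalIntegral.integral_of_le htT.1.le]
      have hmg : ∀ n, MemLp (mollify (K n) g) 2 := fun n => (hPm n).of_le
        (continuous_mollify (hK1 n) (hK n).compact h.g_integrable).aestronglyMeasurable
        (.of_forall fun s => by
          rw [htrip]; exact (le_max_right _ _).trans (le_max_right _ _))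
      have hmd : ∀ n, MemLp (mollify (K n) d) 2 := fun n => (hPm n).of_le
        (continuous_mollify (hK1 n) (hK n).compact h.d_integrable).aestronglyMeasurable
        (.of_forall fun s => by
          rw [htrip]; exact (le_max_left _ _).trans (le_max_right _ _))
      refine tendsto_integral_inner (fun n => (hmg n).restrict _) (fun n => (hmd n).restrict _)
        (h.g_memLp.restrict _) (h.d_memLp.restrict _) ?_ ?_
      · refine tendsto_of_tendsto_of_tendsto_of_le_of_le tendsto_const_nhds hlim
          (fun n => zero_le) fun n => (eLpNorm_mono_measure _ Measure.restrict_le_self).trans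
            (eLpNorm_mono fun s => ?_)
        rw [htrip]; exact (le_max_right _ _).trans (le_max_right _ _)
      · refine tendsto_of_tendsto_of_tendsto_of_le_of_le tendsto_const_nhds hlim
          (fun n => zero_le) fun n => (eLpNorm_mono_measure _ Measure.restrict_le_self).trans
            (eLpNorm_mono fun s => ?_)
        rw [htrip]; exact (le_max_left _ _).trans (le_max_right _ _)
    refine tendsto_nhds_unique hEt (((hE0.add hint).comp hns.tendsto_atTop).congr' ?_)
    -- For a fixed `t < T` the averaging interval eventually stays inside `(0, T)`.
    have hτt : ∀ᶠ n in atTop, τ (ns n) < T - t :=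
      (hτ.comp hns.tendsto_atTop).eventually_lt_const (by linarith [htT.2])
    filter_upwards [hτt] with n hn
    exact (h.energy_mollify ha (hK _).contDiff (hK _).compact (hK _).tsupport_subset
      ⟨htT.1.le, by linarith⟩).symm

end IsWeakWave

end

/-! ### Weak measurability and multiplication operators on `L²` -/

/-- Pettis' theorem in a separable Hilbert space, for a weakly measurable function tested against
the values of a map with dense range. -/
theorem aestronglyMeasurable_of_inner {X ι H : Type*} [MeasurableSpace X] {μ : Measure X}
    [NormedAddCommGroup H] [InnerProductSpace ℝ H] [SecondCountableTopology H]
    {r : ι → H} (hr : DenseRange r) {G : X → H} (hG : ∀ i, AEMeasurable (fun t => ⟪G t, r i⟫) μ) :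
    AEStronglyMeasurable G μ := by
  have h1 : ∀ x : H, AEMeasurable (fun t => ⟪x, G t⟫) μ := fun x => by
    obtain ⟨y, hy, hlim⟩ := mem_closure_iff_seq_limit.1 (hr x)
    choose v hv using hy
    simp only [real_inner_comm (G _) x]
    refine aemeasurable_of_tendsto_metrizable_ae atTop (fun n => hG (v n))
      (.of_forall fun t => ?_)
    simp only [hv]
    exact tendsto_const_nhds.inner hlim
  -- The projections onto the spans of the first elements of a dense sequence have finitely many
  -- measurable coefficients and converge pointwise to the identity.
  let U : ℕ → Submodule ℝ H := fun n => Submodule.span ℝ (TopologicalSpace.denseSeq H '' Iic n)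
  have hfin : ∀ n, FiniteDimensional ℝ (U n) := fun n =>
    FiniteDimensional.span_of_finite ℝ ((finite_Iic n).image _)
  have hU : Monotone U := fun n k hnk =>
    Submodule.span_mono (image_mono (Iic_subset_Iic.2 hnk))
  have hdense : ⊤ ≤ (⨆ n, U n).topologicalClosure := by
    intro x _
    refine closure_mono ?_ (TopologicalSpace.denseRange_denseSeq H x)
    rintro _ ⟨n, rfl⟩
    exact (le_iSup U n) (Submodule.subset_span (mem_image_of_mem _ self_mem_Iic))
  refine aestronglyMeasurable_of_tendsto_ae atTop (f := fun n t => (U n).starProjection (G t))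
    (fun n => ?_) (.of_forall fun t => Submodule.starProjection_tendsto_self U hU (G t) hdense)
  have e : ∀ t, (U n).starProjection (G t) =
      ∑ i, ⟪((stdOrthonormalBasis ℝ (U n)) i : H), G t⟫ • ((stdOrthonormalBasis ℝ (U n)) i : H) := by
    intro t
    rw [(stdOrthonormalBasis ℝ (U n)).starProjection_eq_sum_rankOne]
    simp
  simp_rw [e]
  exact Finset.aestronglyMeasurable_fun_sum _ fun i _ =>
    (h1 _).aestronglyMeasurable.smul_const _

section MulOperator

variable {X : Type*} [MeasurableSpace X] {μ : Measure X}

/-- The multiplication by a bounded function on `L²`. -/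
noncomputable def mulL2 (b : X → ℝ) (hb : MemLp b ⊤ μ) : Lp ℝ 2 μ →L[ℝ] Lp ℝ 2 μ :=
  (ContinuousLinearMap.mul ℝ ℝ).holderL μ ⊤ 2 2 (hb.toLp b)

theorem coeFn_mulL2 {b : X → ℝ} (hb : MemLp b ⊤ μ) (f : Lp ℝ 2 μ) :
    mulL2 b hb f =ᵐ[μ] fun x => b x * f x := by
  filter_upwards [(ContinuousLinearMap.mul ℝ ℝ).coeFn_holder (r := 2) (hb.toLp b) f,
    hb.coeFn_toLp] with x h1 h2
  exact h1.trans (by simp [h2])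

theorem norm_mulL2_le {b : X → ℝ} (hb : MemLp b ⊤ μ) {B : ℝ} (hB : ∀ᵐ x ∂μ, |b x| ≤ B)
    (f : Lp ℝ 2 μ) : ‖mulL2 b hb f‖ ≤ B * ‖f‖ := by
  refine Lp.norm_le_mul_norm_of_ae_le_mul ?_
  filter_upwards [coeFn_mulL2 hb f, hB] with x h1 h2
  rw [h1, norm_mul]
  exact mul_le_mul_of_nonneg_right h2 (norm_nonneg _)

theorem L2_inner_eq (f g : Lp ℝ 2 μ) : ⟪f, g⟫ = ∫ x, f x * g x ∂μ := by
  rw [L2.inner_def]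
  exact integral_congr_ae (.of_forall fun x => by simp [mul_comm])

theorem inner_mulL2 {b : X → ℝ} (hb : MemLp b ⊤ μ) (f g : Lp ℝ 2 μ) :
    ⟪mulL2 b hb f, g⟫ = ∫ x, b x * f x * g x ∂μ := by
  rw [L2_inner_eq]
  exact integral_congr_ae ((coeFn_mulL2 hb f).mono fun x hx => by simp only [hx])

theorem inner_toLp {f : X → ℝ} (hf : MemLp f 2 μ) (g : Lp ℝ 2 μ) :
    ⟪hf.toLp f, g⟫ = ∫ x, f x * g x ∂μ := by
  rw [L2_inner_eq]
  exact integral_congr_ae (hf.coeFn_toLp.mono fun x hx => by simp only [hx])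

theorem integrable_mul_L2 {f : X → ℝ} (hf : MemLp f 2 μ) (g : Lp ℝ 2 μ) :
    Integrable (fun x => f x * g x) μ := hf.integrable_mul (Lp.memLp g)

theorem memLp_top_mul {b f : X → ℝ} (hb : MemLp b ⊤ μ) (hf : MemLp f 2 μ) :
    MemLp (fun x => b x * f x) 2 μ := hf.mul hb

/-- The restriction of a function of `L²(Ω)` to a subset. -/
noncomputable def restrictL2 {Ω U : Set X} (hU : U ⊆ Ω) (f : Lp ℝ 2 (μ.restrict Ω)) :
    Lp ℝ 2 (μ.restrict U) :=
  ((Lp.memLp f).mono_measure (Measure.restrict_mono hU le_rfl)).toLp f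

theorem coeFn_restrictL2 {Ω U : Set X} (hU : U ⊆ Ω) (f : Lp ℝ 2 (μ.restrict Ω)) :
    restrictL2 hU f =ᵐ[μ.restrict U] f :=
  MemLp.coeFn_toLp _

theorem norm_restrictL2_le {Ω U : Set X} (hU : U ⊆ Ω) (f : Lp ℝ 2 (μ.restrict Ω)) :
    ‖restrictL2 hU f‖ ≤ ‖f‖ := by
  rw [restrictL2, Lp.norm_toLp, Lp.norm_def]
  exact ENNReal.toReal_mono (Lp.eLpNorm_ne_top f)
    (eLpNorm_mono_measure _ (Measure.restrict_mono hU le_rfl))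

end MulOperator

/-! ### The oscillating damping coefficient -/

theorem quasiMeasurePreserving_osc {N : ℕ} {ε : ℝ} (hε : ε ≠ 0) :
    Measure.QuasiMeasurePreserving (fun p : ℝ × Space N => ((ε⁻¹ • p.2, p.1 / ε ^ 2) : Space N × ℝ))
      (volume.prod volume) volume := by
  have h1 : Measure.QuasiMeasurePreserving (fun x : Space N => ε⁻¹ • x) volume volume :=
    Measure.quasiMeasurePreserving_smul volume (inv_ne_zero hε)
  have h2 : Measure.QuasiMeasurePreserving (fun t : ℝ => t / ε ^ 2) volume volume := by
    have := Measure.quasiMeasurePreserving_smul (volume : Measure ℝ)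
      (inv_ne_zero (pow_ne_zero 2 hε))
    simpa only [div_eq_inv_mul, smul_eq_mul] using this
  exact (QuasiMeasurePreserving.prodMap h1 h2).comp Measure.measurePreserving_swap.quasiMeasurePreserving

/-- For almost every time, the oscillating coefficient `β^ε(·, t)` is measurable and satisfies the
bounds of `β`. -/
theorem ae_oscBeta {N : ℕ} {β : Space N × ℝ → ℝ} {α : ℝ} (hβ : MemLp β ⊤ volume)
    (hα : ∀ᵐ p, α ≤ β p) : ∃ B : ℝ, 0 ≤ B ∧ ∀ ε > 0, ∀ᵐ t : ℝ,
      AEStronglyMeasurable (fun x => oscBeta β ε x t) volume ∧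
        (∀ᵐ x, |oscBeta β ε x t| ≤ B) ∧ ∀ᵐ x, α ≤ oscBeta β ε x t := by
  have hB : ∀ᵐ p, ‖β p‖ ≤ (eLpNorm β ⊤ volume).toReal := by
    filter_upwards [ae_le_eLpNormEssSup (f := β) (μ := volume)] with p hp
    rw [eLpNorm_exponent_top, ← toReal_enorm]
    exact ENNReal.toReal_mono (by simpa using hβ.2.ne) hp
  refine ⟨(eLpNorm β ⊤ volume).toReal, ENNReal.toReal_nonneg, fun ε hε => ?_⟩
  -- The rescaling pulls null sets back to null sets, so the essential bounds of `β` survive for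
  -- every `ε` with the same constants; Fubini then fixes the time.
  have hq := quasiMeasurePreserving_osc (N := N) hε.ne'
  filter_upwards [(hβ.1.comp_quasiMeasurePreserving hq).prodMk_left,
    Measure.ae_ae_of_ae_prod (hq.ae hB), Measure.ae_ae_of_ae_prod (hq.ae hα)] with t h1 h2 h3
  exact ⟨h1, h2, h3⟩

/-! ### The Sobolev spaces: openness of the domain, density, gradients -/

section

variable {N : ℕ}

theorem perforated_subset (Ω Θ : Set (Space N)) (ε : ℝ) : perforated Ω Θ ε ⊆ Ω := sdiff_subset

/-- The holes contained in a bounded set have bounded lattice indices. Finiteness makes their union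
closed and the perforated domain open. -/
theorem finite_holes {Ω Θ : Set (Space N)} (hΩ : Bornology.IsBounded Ω) (hΘ : Θ.Nonempty) {ε : ℝ}
    (hε : 0 < ε) : {k : Fin N → ℤ | scaledHole Θ ε k ⊆ Ω}.Finite := by
  obtain ⟨z, hz⟩ := hΘ
  obtain ⟨R, hR⟩ := hΩ.subset_ball 0
  obtain ⟨n, hn⟩ := exists_nat_gt ((ε ^ 2)⁻¹ * R + ‖z‖)
  refine (finite_Icc (fun _ => -(n : ℤ)) (fun _ => (n : ℤ))).subset fun k hk => ?_
  have h1 := hR (hk (mem_image_of_mem _ hz))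
  rw [mem_ball_zero_iff, norm_smul, Real.norm_of_nonneg (by positivity)] at h1
  have h2 : ‖latticePoint k + z‖ < (ε ^ 2)⁻¹ * R := by
    rw [inv_mul_eq_div, lt_div_iff₀' (by positivity)]
    exact h1
  have h3 : ‖latticePoint k‖ ≤ ‖latticePoint k + z‖ + ‖z‖ := by
    simpa using norm_sub_le (latticePoint k + z) z
  have h4 : ∀ i, |k i| < (n : ℤ) := fun i => by
    have h5 : ‖(latticePoint k) i‖ ≤ ‖latticePoint k‖ := PiLp.norm_apply_le _ _
    simp only [latticePoint, Real.norm_eq_abs] at h5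
    have h6 : |(k i : ℝ)| < n := by
      simp only [latticePoint] at h2 h3
      linarith
    exact_mod_cast h6
  exact ⟨fun i => (abs_lt.1 (h4 i)).1.le, fun i => (abs_lt.1 (h4 i)).2.le⟩

theorem isOpen_perforated {Ω Θ : Set (Space N)} (hΩ : IsOpen Ω) (hΩb : Bornology.IsBounded Ω)
    (hΘ : IsReferenceHole Θ) {ε : ℝ} (hε : 0 < ε) : IsOpen (perforated Ω Θ ε) := by
  refine hΩ.sdiff ((finite_holes hΩb (hΘ.interior_nonempty.mono interior_subset) hε).isClosed_biUnion
    fun k _ => ?_)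
  exact (hΘ.compact.image (by fun_prop)).isClosed

variable {Ω U : Set (Space N)}

/-- A closed condition on the functions of the Sobolev space and their gradients may be checked on
test functions. -/
theorem VSpace.induction {P : Set (WithLp 2 (L2 U × L2Vec U))} (hP : IsClosed P)
    (h : ∀ p ∈ testGraph Ω U, p ∈ P) (v : VSpace Ω U) : v.1 ∈ P := by
  have hv : v.1 ∈ closure (testGraph Ω U : Set _) := v.2
  exact closure_minimal h hP hv

theorem memLp_of_contDiff {E : Type*} [NormedAddCommGroup E] {φ : Space N → E} (hφ : Continuous φ)
    (hφc : HasCompactSupport φ) {p : ℝ≥0∞} {μ : Measure (Space N)} [IsLocallyFiniteMeasure μ] :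
    MemLp φ p μ := hφ.memLp_of_hasCompactSupport hφc

theorem continuous_gradient {φ : Space N → ℝ} (hφ : ContDiff ℝ 1 φ) : Continuous (gradient φ) :=
  (InnerProductSpace.toDual ℝ (Space N)).symm.continuous.comp (hφ.continuous_fderiv (by simp))

theorem hasCompactSupport_gradient {φ : Space N → ℝ} (hφc : HasCompactSupport φ) :
    HasCompactSupport (gradient φ) :=
  (hφc.fderiv ℝ).comp_left (g := (InnerProductSpace.toDual ℝ (Space N)).symm) (map_zero _)

/-- The test functions of the open set as elements of the Sobolev space. -/
theorem VSpace.exists_of_test {φ : Space N → ℝ} (hφ : ContDiff ℝ (⊤ : ℕ∞) φ)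
    (hφc : HasCompactSupport φ) (hφs : tsupport φ ⊆ Ω) :
    ∃ v : VSpace Ω U, VSpace.fn v =ᵐ[volume.restrict U] φ := by
  have hφ1 : ContDiff ℝ 1 φ := hφ.of_le (by exact_mod_cast le_top)
  have h1 : MemLp φ 2 (volume.restrict U) := (memLp_of_contDiff hφ.continuous hφc).restrict U
  have h2 : MemLp (gradient φ) 2 (volume.restrict U) :=
    (memLp_of_contDiff (continuous_gradient hφ1) (hasCompactSupport_gradient hφc)).restrict U
  have hmem : WithLp.toLp 2 (h1.toLp φ, h2.toLp (gradient φ)) ∈ testGraph Ω U :=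
    ⟨φ, hφ, hφc, hφs, h1.coeFn_toLp, h2.coeFn_toLp⟩
  exact ⟨⟨_, Submodule.le_topologicalClosure _ hmem⟩, h1.coeFn_toLp⟩

theorem ae_eq_zero_of_test (hU : IsOpen U) {h : Space N → ℝ} (hh : MemLp h 2 (volume.restrict U))
    (h0 : ∀ ψ : Space N → ℝ, ContDiff ℝ (⊤ : ℕ∞) ψ → HasCompactSupport ψ → tsupport ψ ⊆ U →
      ∫ x in U, ψ x * h x = 0) : h =ᵐ[volume.restrict U] 0 := by
  have hloc : LocallyIntegrableOn h U volume :=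
    locallyIntegrableOn_of_locallyIntegrable_restrict (hh.locallyIntegrable (by norm_num))
  have h1 := hU.ae_eq_zero_of_integral_contDiff_smul_eq_zero hloc fun ψ hψ hψc hψs => by
    rw [← h0 ψ hψ hψc hψs, setIntegral_eq_integral_of_forall_compl_eq_zero]
    · rfl
    · intro x hx
      rw [image_eq_zero_of_notMem_tsupport (fun h => hx (hψs h)), zero_mul]
  exact (ae_restrict_iff' hU.measurableSet).2 h1

/-- A function of `L²(U)` that is orthogonal to the Sobolev space vanishes. -/
theorem VSpace.eq_zero_of_inner_fn (hU : IsOpen U) (hUΩ : U ⊆ Ω) {h : L2 U}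
    (h0 : ∀ v : VSpace Ω U, ⟪h, VSpace.fn v⟫ = 0) : h = 0 := by
  rw [Lp.eq_zero_iff_ae_eq_zero]
  refine ae_eq_zero_of_test hU (Lp.memLp h) fun ψ hψ hψc hψs => ?_
  obtain ⟨v, hv⟩ := VSpace.exists_of_test (U := U) hψ hψc (hψs.trans hUΩ)
  rw [← h0 v, L2_inner_eq]
  exact integral_congr_ae (hv.mono fun x hx => by simp only [hx, mul_comm])

/-- The range has trivial orthogonal complement. This makes pairings with `V_ε` sufficient to prove
measurability in time. -/
theorem VSpace.denseRange_fn (hU : IsOpen U) (hUΩ : U ⊆ Ω) :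
    DenseRange (VSpace.fn : VSpace Ω U →L[ℝ] L2 U) := by
  have h : (LinearMap.range (VSpace.fn : VSpace Ω U →L[ℝ] L2 U).toLinearMap).topologicalClosure = ⊤ := by
    rw [Submodule.topologicalClosure_eq_top_iff, Submodule.eq_bot_iff]
    intro x hx
    refine VSpace.eq_zero_of_inner_fn hU hUΩ fun v => ?_
    rw [real_inner_comm]
    exact hx _ ⟨v, rfl⟩
  rw [DenseRange, dense_iff_closure_eq]
  exact congrArg (fun s : Submodule ℝ (L2 U) => (s : Set (L2 U))) h

/-- The coordinates of a vector field. -/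
noncomputable def coordL2 (U : Set (Space N)) (i : Fin N) : L2Vec U →L[ℝ] L2 U :=
  (EuclideanSpace.proj (𝕜 := ℝ) i).compLpL 2 (volume.restrict U)

theorem coeFn_coordL2 (i : Fin N) (w : L2Vec U) :
    coordL2 U i w =ᵐ[volume.restrict U] fun x => w x i :=
  (EuclideanSpace.proj (𝕜 := ℝ) i).coeFn_compLp w

theorem norm_coordL2_le (i : Fin N) (w : L2Vec U) : ‖coordL2 U i w‖ ≤ ‖w‖ := by
  refine Lp.norm_le_norm_of_ae_le ?_
  filter_upwards [coeFn_coordL2 i w] with x hx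
  rw [hx]
  exact PiLp.norm_apply_le _ _

theorem gradient_apply_eq (φ : Space N → ℝ) (x : Space N) (i : Fin N) :
    gradient φ x i = fderiv ℝ φ x (EuclideanSpace.single i 1) := by
  rw [gradient, ← InnerProductSpace.toDual_symm_apply (𝕜 := ℝ) (y := fderiv ℝ φ x),
    EuclideanSpace.inner_single_right]
  simp

theorem integral_mul_gradient {φ ψ : Space N → ℝ} (hφ : ContDiff ℝ 1 φ) (hψ : ContDiff ℝ 1 ψ)
    (hψc : HasCompactSupport ψ) (i : Fin N) :
    ∫ x, ψ x * gradient φ x i = -∫ x, gradient ψ x i * φ x := by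
  simp only [gradient_apply_eq]
  have hcφ := hφ.continuous_fderiv one_ne_zero
  have hcψ := hψ.continuous_fderiv one_ne_zero
  have hφ' := hφ.continuous
  have hψ' := hψ.continuous
  refine integral_mul_fderiv_eq_neg_fderiv_mul_of_integrable ?_ ?_ ?_
    (fun x _ => hψ.differentiable one_ne_zero x) (fun x _ => hφ.differentiable one_ne_zero x)
  · exact (by fun_prop : Continuous _).integrable_of_hasCompactSupport
      ((hψc.fderiv_apply ℝ _).mul_right)
  · exact (by fun_prop : Continuous _).integrable_of_hasCompactSupport hψc.mul_right
  · exact (by fun_prop : Continuous _).integrable_of_hasCompactSupport hψc.mul_right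

/-- Integration by parts against a test function of `U`. -/
theorem VSpace.integral_grad_mul (v : VSpace Ω U) {ψ : Space N → ℝ}
    (hψ : ContDiff ℝ (⊤ : ℕ∞) ψ) (hψc : HasCompactSupport ψ) (hψs : tsupport ψ ⊆ U) (i : Fin N) :
    ∫ x in U, ψ x * VSpace.grad v x i = -∫ x in U, gradient ψ x i * VSpace.fn v x := by
  have hψ1 : ContDiff ℝ 1 ψ := hψ.of_le (by exact_mod_cast le_top)
  have h1 : MemLp ψ 2 (volume.restrict U) := (memLp_of_contDiff hψ.continuous hψc).restrict U
  have h2 : MemLp (fun x => gradient ψ x i) 2 (volume.restrict U) :=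
    (memLp_of_contDiff ((EuclideanSpace.proj (𝕜 := ℝ) i).continuous.comp (continuous_gradient hψ1))
      ((hasCompactSupport_gradient hψc).comp_left (g := EuclideanSpace.proj (𝕜 := ℝ) i)
        (map_zero _))).restrict U
  have e1 : ∀ w : L2Vec U, ⟪h1.toLp ψ, coordL2 U i w⟫ = ∫ x in U, ψ x * w x i := fun w => by
    rw [inner_toLp]
    exact integral_congr_ae ((coeFn_coordL2 i w).mono fun x hx => by simp only [hx])
  have hcl : IsClosed {p : WithLp 2 (L2 U × L2Vec U) |
      ⟪h1.toLp ψ, coordL2 U i (WithLp.sndL 2 ℝ (L2 U) (L2Vec U) p)⟫ =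
        -⟪h2.toLp _, WithLp.fstL 2 ℝ (L2 U) (L2Vec U) p⟫} :=
    isClosed_eq (by fun_prop) (by fun_prop)
  have key := VSpace.induction hcl (fun p hp => ?_) v
  · rw [← e1, ← inner_toLp h2]
    exact key
  · obtain ⟨φ, hφ, hφc, -, hp1, hp2⟩ := hp
    have hφ1 : ContDiff ℝ 1 φ := hφ.of_le (by exact_mod_cast le_top)
    rw [mem_ofPred_eq, e1, inner_toLp]
    have e2 : ∫ x in U, ψ x * (WithLp.sndL 2 ℝ (L2 U) (L2Vec U) p) x i =
        ∫ x in U, ψ x * gradient φ x i :=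
      integral_congr_ae (hp2.mono fun x hx => congrArg (fun w : Space N => ψ x * w i) hx)
    have e3 : ∫ x in U, gradient ψ x i * (WithLp.fstL 2 ℝ (L2 U) (L2Vec U) p) x =
        ∫ x in U, gradient ψ x i * φ x :=
      integral_congr_ae (hp1.mono fun x hx => congrArg (fun w : ℝ => gradient ψ x i * w) hx)
    rw [e2, e3, setIntegral_eq_integral_of_forall_compl_eq_zero,
      setIntegral_eq_integral_of_forall_compl_eq_zero, integral_mul_gradient hφ1 hψ1 hψc]
    · intro x hx
      rw [gradient_apply_eq, fderiv_of_notMem_tsupport (𝕜 := ℝ) (fun h => hx (hψs h))]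
      simp
    · intro x hx
      rw [image_eq_zero_of_notMem_tsupport (fun h => hx (hψs h)), zero_mul]

/-- An element of the Sobolev space on `Ω` and an element of the Sobolev space on `U ⊆ Ω` that
coincide on `U` have the same gradient there. -/
theorem VSpace.grad_ae_eq (hU : IsOpen U) (hΩ : MeasurableSet Ω) (hUΩ : U ⊆ Ω) (v : VSpace Ω U)
    (w : VSpace Ω Ω) (h : VSpace.fn v =ᵐ[volume.restrict U] VSpace.fn w) :
    VSpace.grad v =ᵐ[volume.restrict U] VSpace.grad w := by
  have hle : volume.restrict U ≤ volume.restrict Ω := Measure.restrict_mono hUΩ le_rfl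
  have hv : ∀ i, MemLp (fun x => VSpace.grad v x i) 2 (volume.restrict U) := fun i =>
    (EuclideanSpace.proj (𝕜 := ℝ) i).comp_memLp' (Lp.memLp (VSpace.grad v))
  have hw : ∀ i, MemLp (fun x => VSpace.grad w x i) 2 (volume.restrict U) := fun i =>
    (EuclideanSpace.proj (𝕜 := ℝ) i).comp_memLp' ((Lp.memLp (VSpace.grad w)).mono_measure hle)
  have key : ∀ i, (fun x => VSpace.grad v x i - VSpace.grad w x i) =ᵐ[volume.restrict U] 0 := by
    intro i
    refine ae_eq_zero_of_test hU ((hv i).sub (hw i)) fun ψ hψ hψc hψs => ?_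
    have h1 : MemLp ψ 2 (volume.restrict U) := (memLp_of_contDiff hψ.continuous hψc).restrict U
    have i1 : Integrable (fun x => ψ x * VSpace.grad v x i) (volume.restrict U) :=
      h1.integrable_mul (hv i)
    have i2 : Integrable (fun x => ψ x * VSpace.grad w x i) (volume.restrict U) :=
      h1.integrable_mul (hw i)
    simp only [mul_sub]
    rw [integral_sub i1 i2, VSpace.integral_grad_mul v hψ hψc hψs]
    -- `ψ` vanishes outside `U`, so the integrals of `w` extend to `Ω`, where its own integration by
    -- parts holds.
    have e1 : ∫ x in U, ψ x * VSpace.grad w x i = ∫ x in Ω, ψ x * VSpace.grad w x i :=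
      (setIntegral_eq_of_subset_of_forall_sdiff_eq_zero hΩ hUΩ fun x hx => by
        rw [image_eq_zero_of_notMem_tsupport (fun h => hx.2 (hψs h)), zero_mul]).symm
    have e2 : ∫ x in U, gradient ψ x i * VSpace.fn w x =
        ∫ x in Ω, gradient ψ x i * VSpace.fn w x :=
      (setIntegral_eq_of_subset_of_forall_sdiff_eq_zero hΩ hUΩ fun x hx => by
        rw [gradient_apply_eq, fderiv_of_notMem_tsupport (𝕜 := ℝ) (fun h => hx.2 (hψs h))]
        simp).symm
    have e3 : ∫ x in U, gradient ψ x i * VSpace.fn v x =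
        ∫ x in U, gradient ψ x i * VSpace.fn w x :=
      integral_congr_ae (h.mono fun x hx => by simp only [hx])
    rw [e1, VSpace.integral_grad_mul w hψ hψc (hψs.trans hUΩ), e3, e2, sub_self]
  filter_upwards [ae_all_iff.2 key] with x hx
  ext i
  exact sub_eq_zero.1 (hx i)

end

/-! ### The elliptic form -/

theorem norm_sq_L2 {X E : Type*} [MeasurableSpace X] {μ : Measure X} [NormedAddCommGroup E]
    (f : Lp E 2 μ) : ‖f‖ ^ 2 = ∫ x, ‖f x‖ ^ 2 ∂μ := by
  rw [integral_norm_sq_eq (Lp.memLp f), Lp.norm_def]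

section

variable {N : ℕ} {Ω U : Set (Space N)} {B : Space N → Matrix (Fin N) (Fin N) ℝ} {Λ : ℝ}

theorem IsUniformlyElliptic.memLp_top (hB : IsUniformlyElliptic B Λ) (U : Set (Space N))
    (i j : Fin N) : MemLp (fun x => B x i j) ⊤ (volume.restrict U) :=
  (memLp_top_of_bound (hB.measurable i j) Λ (hB.bound i j)).restrict U

/-- The bilinear form `∫ B ∇v · ∇w` on the Sobolev space. -/
noncomputable def ellipticForm (Ω : Set (Space N)) {U : Set (Space N)}
    (hB : IsUniformlyElliptic B Λ) : VSpace Ω U →L[ℝ] VSpace Ω U →L[ℝ] ℝ :=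
  ∑ i, ∑ j, (innerSL ℝ).bilinearComp
    ((mulL2 _ (hB.memLp_top U i j)).comp ((coordL2 U j).comp VSpace.grad))
    ((coordL2 U i).comp VSpace.grad)

theorem ellipticForm_eq_sum (hB : IsUniformlyElliptic B Λ) (v w : VSpace Ω U) :
    ellipticForm Ω hB v w = ∑ i, ∑ j, ⟪mulL2 _ (hB.memLp_top U i j)
      (coordL2 U j (VSpace.grad v)), coordL2 U i (VSpace.grad w)⟫ := by
  simp [ellipticForm]

theorem mul_coord_ae_eq {b : Space N → ℝ} (hb : MemLp b ⊤ (volume.restrict U)) (F G : L2Vec U)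
    (i j : Fin N) : (fun x => mulL2 b hb (coordL2 U j F) x * coordL2 U i G x)
      =ᵐ[volume.restrict U] fun x => b x * F x j * G x i := by
  filter_upwards [coeFn_mulL2 hb (coordL2 U j F), coeFn_coordL2 j F, coeFn_coordL2 i G]
    with x h1 h2 h3
  rw [h1, h2, h3]

theorem integrable_mul_coord {b : Space N → ℝ} (hb : MemLp b ⊤ (volume.restrict U))
    (F G : L2Vec U) (i j : Fin N) :
    Integrable (fun x => b x * F x j * G x i) (volume.restrict U) :=
  (integrable_mul_L2 (Lp.memLp _) _).congr (mul_coord_ae_eq hb F G i j)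

theorem inner_mul_coord {b : Space N → ℝ} (hb : MemLp b ⊤ (volume.restrict U)) (F G : L2Vec U)
    (i j : Fin N) : ⟪mulL2 b hb (coordL2 U j F), coordL2 U i G⟫ =
      ∫ x in U, b x * F x j * G x i := by
  rw [L2_inner_eq]
  exact integral_congr_ae (mul_coord_ae_eq hb F G i j)

theorem integrable_ellipticForm (hB : IsUniformlyElliptic B Λ) (v w : VSpace Ω U) (i j : Fin N) :
    Integrable (fun x => B x i j * VSpace.grad v x j * VSpace.grad w x i) (volume.restrict U) :=
  integrable_mul_coord (hB.memLp_top U i j) _ _ i j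

theorem ellipticForm_apply (hB : IsUniformlyElliptic B Λ) (v w : VSpace Ω U) :
    ellipticForm Ω hB v w =
      ∫ x in U, ∑ i, ∑ j, B x i j * VSpace.grad v x j * VSpace.grad w x i := by
  rw [ellipticForm_eq_sum, integral_finsetSum _ fun i _ =>
    integrable_finsetSum _ fun j _ => integrable_ellipticForm hB v w i j]
  refine Finset.sum_congr rfl fun i _ => ?_
  rw [integral_finsetSum _ fun j _ => integrable_ellipticForm hB v w i j]
  refine Finset.sum_congr rfl fun j _ => ?_
  exact inner_mul_coord _ _ _ i j

theorem ellipticForm_symm (hB : IsUniformlyElliptic B Λ) (v w : VSpace Ω U) :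
    ellipticForm Ω hB v w = ellipticForm Ω hB w v := by
  rw [ellipticForm_apply, ellipticForm_apply]
  refine integral_congr_ae ?_
  filter_upwards [ae_restrict_of_ae hB.symm] with x hx
  rw [Finset.sum_comm]
  refine Finset.sum_congr rfl fun i _ => Finset.sum_congr rfl fun j _ => ?_
  rw [hx.apply]
  ring

theorem le_ellipticForm (hB : IsUniformlyElliptic B Λ) (v : VSpace Ω U) :
    Λ⁻¹ * ‖VSpace.grad v‖ ^ 2 ≤ ellipticForm Ω hB v v := by
  rw [ellipticForm_apply, norm_sq_L2, ← integral_const_mul]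
  refine integral_mono_ae ((Lp.memLp _).norm.integrable_sq.const_mul _)
    (integrable_finsetSum _ fun i _ => integrable_finsetSum _ fun j _ =>
      integrable_ellipticForm hB v v i j) ?_
  filter_upwards [ae_restrict_of_ae hB.coercive] with x hx
  refine (hx _).trans_eq ?_
  refine Finset.sum_congr rfl fun i _ => Finset.sum_congr rfl fun j _ => ?_
  ring

theorem abs_ellipticForm_le (hB : IsUniformlyElliptic B Λ) (hΛ : 0 < Λ) (v w : VSpace Ω U) :
    |ellipticForm Ω hB v w| ≤ N ^ 2 * Λ * (‖VSpace.grad v‖ * ‖VSpace.grad w‖) := by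
  rw [ellipticForm_eq_sum]
  have h : ∀ i j, |⟪mulL2 _ (hB.memLp_top U i j) (coordL2 U j (VSpace.grad v)),
      coordL2 U i (VSpace.grad w)⟫| ≤ Λ * (‖VSpace.grad v‖ * ‖VSpace.grad w‖) := by
    intro i j
    refine (abs_real_inner_le_norm _ _).trans ?_
    rw [← mul_assoc]
    refine mul_le_mul ((norm_mulL2_le _ (ae_restrict_of_ae (hB.bound i j)) _).trans ?_)
      (norm_coordL2_le _ _) (norm_nonneg _) (by positivity)
    gcongr
    exact norm_coordL2_le _ _
  calc _ ≤ ∑ i : Fin N, ∑ j : Fin N, Λ * (‖VSpace.grad v‖ * ‖VSpace.grad w‖) :=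
        (Finset.abs_sum_le_sum_abs _ _).trans (Finset.sum_le_sum fun i _ =>
          (Finset.abs_sum_le_sum_abs _ _).trans (Finset.sum_le_sum fun j _ => h i j))
    _ = _ := by
        simp only [Finset.sum_const, Finset.card_univ, Fintype.card_fin, nsmul_eq_mul]
        ring

/-- The norm of the Sobolev space in terms of the elliptic form. -/
theorem norm_sq_le_ellipticForm (hB : IsUniformlyElliptic B Λ) (hΛ : 0 < Λ) (v : VSpace Ω U) :
    ‖v‖ ^ 2 ≤ ‖VSpace.fn v‖ ^ 2 + Λ * ellipticForm Ω hB v v := by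
  have h1 : ‖v‖ ^ 2 = ‖VSpace.fn v‖ ^ 2 + ‖VSpace.grad v‖ ^ 2 :=
    WithLp.prod_norm_sq_eq_of_L2 v.1
  have h2 := mul_le_mul_of_nonneg_left (le_ellipticForm hB v) hΛ.le
  rw [← mul_assoc, mul_inv_cancel₀ hΛ.ne', one_mul] at h2
  linarith

theorem ellipticForm_nonneg (hB : IsUniformlyElliptic B Λ) (hΛ : 0 < Λ) (v : VSpace Ω U) :
    0 ≤ ellipticForm Ω hB v v :=
  (by positivity : 0 ≤ Λ⁻¹ * ‖VSpace.grad v‖ ^ 2).trans (le_ellipticForm hB v)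

end

/-! ### The energy inequality for the solutions -/

section

variable {N : ℕ} {Ω U : Set (Space N)} {T ε α Λ b : ℝ}
  {A : Space N × Space N → Matrix (Fin N) (Fin N) ℝ} {ρ : Space N → ℝ} {β : Space N × ℝ → ℝ}
  {f : ℝ → L2 Ω} {u₀ : VSpace Ω Ω} {v₀ : L2 Ω}
  {u : ℝ → VSpace Ω U} {du : ℝ → L2 U} {rddu : ℝ → StrongDual ℝ (VSpace Ω U)}

theorem integral_indicator_eq {E G : Type*} [NormedAddCommGroup E] [NormedAddCommGroup G]
    [NormedSpace ℝ G] (Φ : ℝ → E → G) (hΦ : ∀ s, Φ s 0 = 0) (F : ℝ → E) (I : Set ℝ)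
    (hI : MeasurableSet I) : ∫ s, Φ s (I.indicator F s) = ∫ s in I, Φ s (F s) := by
  rw [← integral_indicator hI]
  refine integral_congr_ae (.of_forall fun s => ?_)
  by_cases hs : s ∈ I
  · simp [hs]
  · simp [hs, hΦ]

theorem inner_restrictL2 (hUΩ : U ⊆ Ω) (F : L2 Ω) (g : L2 U) :
    ⟪restrictL2 hUΩ F, g⟫ = ∫ x in U, F x * g x := by
  rw [L2_inner_eq]
  exact integral_congr_ae ((coeFn_restrictL2 hUΩ F).mono fun x hx => by simp only [hx])

theorem mul_norm_sq_le_inner_mulL2 {c : Space N → ℝ} (hc : MemLp c ⊤ (volume.restrict U))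
    (hα : ∀ᵐ x ∂volume.restrict U, α ≤ c x) (g : L2 U) : α * ‖g‖ ^ 2 ≤ ⟪mulL2 c hc g, g⟫ := by
  rw [inner_mulL2, norm_sq_L2, ← integral_const_mul]
  refine integral_mono_ae ((Lp.memLp g).norm.integrable_sq.const_mul _)
    (integrable_mul_L2 (memLp_top_mul hc (Lp.memLp g)) g) ?_
  filter_upwards [hα] with x hx
  have := mul_le_mul_of_nonneg_right hx (mul_self_nonneg (g x))
  rw [Real.norm_eq_abs, sq_abs]
  linarith

open Classical in
/-- The right-hand side `f - β u'` of the equation, as a function with values in `L²(U)`. -/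
noncomputable def source (β : Space N × ℝ → ℝ) (ε : ℝ) (hUΩ : U ⊆ Ω) (f : ℝ → L2 Ω)
    (du : ℝ → L2 U) (t : ℝ) : L2 U :=
  -- Boundedness of `β^ε(·, t)` is available for almost every `t` only; the default value is used on
  -- a null set of times.
  if hb : MemLp (fun x => oscBeta β ε x t) ⊤ (volume.restrict U) then
    restrictL2 hUΩ (f t) - mulL2 _ hb (du t) else 0

theorem ae_source (hα : 0 < α) (hUΩ : U ⊆ Ω)
    (hβ : ∀ᵐ t : ℝ, AEStronglyMeasurable (fun x => oscBeta β ε x t) volume ∧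
      (∀ᵐ x, |oscBeta β ε x t| ≤ b) ∧ ∀ᵐ x, α ≤ oscBeta β ε x t) :
    ∀ᵐ t : ℝ, (∀ g : L2 U, ⟪source β ε hUΩ f du t, g⟫ =
        (∫ x in U, f t x * g x) - ∫ x in U, oscBeta β ε x t * du t x * g x) ∧
      ‖source β ε hUΩ f du t‖ ≤ ‖f t‖ + b * ‖du t‖ ∧
      ⟪source β ε hUΩ f du t, du t⟫ ≤ 1 / (2 * α) * ‖f t‖ ^ 2 - α / 2 * ‖du t‖ ^ 2 := by
  filter_upwards [hβ] with t ⟨h1, h2, h3⟩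
  have hb : MemLp (fun x => oscBeta β ε x t) ⊤ (volume.restrict U) :=
    (memLp_top_of_bound h1 b h2).restrict U
  rw [source, dif_pos hb]
  refine ⟨fun g => ?_, ?_, ?_⟩
  · rw [inner_sub_left, inner_restrictL2, inner_mulL2]
  · exact (norm_sub_le _ _).trans (add_le_add (norm_restrictL2_le _ _)
      (norm_mulL2_le hb (ae_restrict_of_ae h2) _))
  · rw [inner_sub_left]
    have h4 := mul_norm_sq_le_inner_mulL2 hb (ae_restrict_of_ae h3) (du t)
    have h5 : ⟪restrictL2 hUΩ (f t), du t⟫ ≤ ‖f t‖ * ‖du t‖ :=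
      (real_inner_le_norm _ _).trans
        (mul_le_mul_of_nonneg_right (norm_restrictL2_le _ _) (norm_nonneg _))
    have h6 : ‖f t‖ * ‖du t‖ ≤ 1 / (2 * α) * ‖f t‖ ^ 2 + α / 2 * ‖du t‖ ^ 2 := by
      have h7 : 1 / (2 * α) * ‖f t‖ ^ 2 + α / 2 * ‖du t‖ ^ 2 - ‖f t‖ * ‖du t‖ =
          1 / (2 * α) * (‖f t‖ - α * ‖du t‖) ^ 2 := by field_simp; ring
      have h8 : 0 ≤ 1 / (2 * α) * (‖f t‖ - α * ‖du t‖) ^ 2 := by positivity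
      linarith
    linarith

namespace IsSolution

theorem ae_inner_source (h : IsSolution Ω U T ε A ρ β f u₀ v₀ u du rddu) (hα : 0 < α)
    (hUΩ : U ⊆ Ω) (hA : IsUniformlyElliptic (oscA A ε) Λ)
    (hβ : ∀ᵐ t : ℝ, AEStronglyMeasurable (fun x => oscBeta β ε x t) volume ∧
      (∀ᵐ x, |oscBeta β ε x t| ≤ b) ∧ ∀ᵐ x, α ≤ oscBeta β ε x t) :
    ∀ᵐ t ∂timeMeasure T, ∀ v : VSpace Ω U, ⟪source β ε hUΩ f du t, VSpace.fn v⟫ =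
      rddu t v + ellipticForm Ω hA (u t) v := by
  filter_upwards [ae_restrict_of_ae (ae_source (f := f) (du := du) hα hUΩ hβ), h.equation]
    with t h1 h2 v
  rw [h1.1, ellipticForm_apply, ← h2 v]
  ring

/-- Measurability of `f - βu'` in time is drawn from the equation itself: paired with an element of
`V_ε` it equals `rddu t v` plus the elliptic form, both measurable in `t`, and Pettis' theorem
concludes. -/
theorem memLp_source (h : IsSolution Ω U T ε A ρ β f u₀ v₀ u du rddu)
    (hf : MemLp f 2 (timeMeasure T)) (hα : 0 < α)
    (hU : IsOpen U) (hUΩ : U ⊆ Ω) (hA : IsUniformlyElliptic (oscA A ε) Λ)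
    (hβ : ∀ᵐ t : ℝ, AEStronglyMeasurable (fun x => oscBeta β ε x t) volume ∧
      (∀ᵐ x, |oscBeta β ε x t| ≤ b) ∧ ∀ᵐ x, α ≤ oscBeta β ε x t) :
    MemLp (source β ε hUΩ f du) 2 (timeMeasure T) := by
  have hm : AEStronglyMeasurable (source β ε hUΩ f du) (timeMeasure T) := by
    have : Fact ((2 : ℝ≥0∞) ≠ ⊤) := ⟨by simp⟩
    refine aestronglyMeasurable_of_inner (VSpace.denseRange_fn hU hUΩ) fun v => ?_
    have h1 : AEStronglyMeasurable (fun t => rddu t v) (timeMeasure T) :=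
      (ContinuousLinearMap.apply ℝ ℝ v).continuous.comp_aestronglyMeasurable h.rddu_memLp.1
    have h2 : AEStronglyMeasurable (fun t => ellipticForm Ω hA (u t) v) (timeMeasure T) :=
      ((ellipticForm Ω hA).flip v).continuous.comp_aestronglyMeasurable h.u_memLp.1
    refine (h1.add h2).aemeasurable.congr ?_
    filter_upwards [h.ae_inner_source hα hUΩ hA hβ] with t ht
    exact (ht v).symm
  refine (hf.norm.add (h.du_memLp.norm.const_mul b)).mono hm ?_
  filter_upwards [ae_restrict_of_ae (ae_source (f := f) (du := du) hα hUΩ hβ)] with t ht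
  exact ht.2.1.trans (le_abs_self _)

/-- The damping is moved to the right-hand side, where it is an `L²` source, and `M` splits the
weight `ρ^ε` symmetrically. Extension by zero is harmless because every integrand vanishes with its
argument. -/
theorem isWeakWave (h : IsSolution Ω U T ε A ρ β f u₀ v₀ u du rddu)
    (hf : MemLp f 2 (timeMeasure T)) (hα : 0 < α)
    (hU : IsOpen U) (hUΩ : U ⊆ Ω) (hA : IsUniformlyElliptic (oscA A ε) Λ)
    (hβ : ∀ᵐ t : ℝ, AEStronglyMeasurable (fun x => oscBeta β ε x t) volume ∧
      (∀ᵐ x, |oscBeta β ε x t| ≤ b) ∧ ∀ᵐ x, α ≤ oscBeta β ε x t)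
    {M : L2 U →L[ℝ] L2 U}
    (hM : ∀ d g : L2 U, ⟪M d, M g⟫ = ∫ x in U, oscRho ρ ε x * d x * g x) :
    IsWeakWave T VSpace.fn M (ellipticForm Ω hA) ((Ioo 0 T).indicator u)
      ((Ioo 0 T).indicator du) ((Ioo 0 T).indicator (source β ε hUΩ f du)) := by
  have hu2 : MemLp u 2 (timeMeasure T) := h.u_memLp.mono_exponent le_top
  have hs := h.memLp_source hf hα hU hUΩ hA hβ
  have hind : ∀ {E : Type} [NormedAddCommGroup E] {F : ℝ → E}, MemLp F 2 (timeMeasure T) →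
      MemLp ((Ioo 0 T).indicator F) 2 ∧ Integrable ((Ioo 0 T).indicator F) := fun hF =>
    ⟨(memLp_indicator_iff_restrict measurableSet_Ioo).2 hF,
      (integrable_indicator_iff measurableSet_Ioo).2 (hF.integrable (by norm_num))⟩
  refine ⟨(hind hu2).1, (hind hu2).2, (hind h.du_memLp).1, (hind h.du_memLp).2, (hind hs).1,
    (hind hs).2, fun φ hφ => ?_, fun φ hφ v => ?_⟩
  · rw [integral_indicator_eq (fun s w => deriv φ s • VSpace.fn w) (by simp) u _ measurableSet_Ioo,
      integral_indicator_eq (fun s w => φ s • w) (by simp) du _ measurableSet_Ioo]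
    exact h.hasTimeDeriv φ hφ
  · rw [integral_indicator_eq (fun s w => deriv φ s * ⟪M w, M (VSpace.fn v)⟫) (by simp) du _
      measurableSet_Ioo]
    simp only [hM]
    rw [h.hasSecondTimeDeriv φ hφ v]
    have e := integral_indicator_eq (fun s (w : VSpace Ω U × L2 U) => φ s * (⟪w.2, VSpace.fn v⟫ -
      ellipticForm Ω hA w.1 v)) (by simp) (fun s => (u s, source β ε hUΩ f du s)) (Ioo 0 T)
      measurableSet_Ioo
    rw [neg_inj]
    calc _ = ∫ s in Ioo 0 T, φ s * (⟪source β ε hUΩ f du s, VSpace.fn v⟫ -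
          ellipticForm Ω hA (u s) v) := by
          refine integral_congr_ae ?_
          filter_upwards [h.ae_inner_source hα hUΩ hA hβ] with t ht
          rw [ht, add_sub_cancel_right]
      _ = _ := by
          rw [← e]
          refine integral_congr_ae (.of_forall fun s => ?_)
          by_cases hs : s ∈ Ioo 0 T <;> simp [hs]

/-- The energy inequality, at almost every time. -/
theorem ae_energy_le (h : IsSolution Ω U T ε A ρ β f u₀ v₀ u du rddu)
    (hf : MemLp f 2 (timeMeasure T)) (hT : 0 < T) (hα : 0 < α) (hΛ : 0 < Λ)
    (hΩ : MeasurableSet Ω) (hU : IsOpen U) (hUΩ : U ⊆ Ω)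
    (hA : IsUniformlyElliptic (oscA A ε) Λ)
    (hβ : ∀ᵐ t : ℝ, AEStronglyMeasurable (fun x => oscBeta β ε x t) volume ∧
      (∀ᵐ x, |oscBeta β ε x t| ≤ b) ∧ ∀ᵐ x, α ≤ oscBeta β ε x t)
    (hρ : ∀ x, 0 ≤ oscRho ρ ε x)
    (hρU : MemLp (fun x => √(oscRho ρ ε x)) ⊤ (volume.restrict U)) :
    ∀ᵐ t ∂timeMeasure T, 1 / 2 * ‖mulL2 _ hρU (du t)‖ ^ 2 +
        1 / 2 * (Λ⁻¹ * ‖VSpace.grad (u t)‖ ^ 2) + α / 2 * ∫ s in (0 : ℝ)..t, ‖du s‖ ^ 2 ≤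
      1 / 2 * ‖v₀‖ ^ 2 + 1 / 2 * (N ^ 2 * Λ * (‖VSpace.grad u₀‖ * ‖VSpace.grad u₀‖)) +
        1 / (2 * α) * ∫ s in Ioo 0 T, ‖f s‖ ^ 2 := by
  set M := mulL2 _ hρU with hMdef
  have hMM : ∀ d g : L2 U, ⟪M d, M g⟫ = ∫ x in U, oscRho ρ ε x * d x * g x := fun d g => by
    rw [hMdef, inner_mulL2]
    refine integral_congr_ae ?_
    filter_upwards [coeFn_mulL2 hρU g] with x hx
    rw [hx]
    nth_rewrite 3 [← Real.mul_self_sqrt (hρ x)]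
    ring
  have hMs : ∀ d g : L2 U, ⟪M d, g⟫ = ⟪d, M g⟫ := fun d g => by
    rw [real_inner_comm (M g), hMdef, inner_mulL2, inner_mulL2]
    exact integral_congr_ae (.of_forall fun x => by ring)
  have hW := h.isWeakWave hf hα hU hUΩ hA hβ hMM
  obtain ⟨w, hwc, hwu, hw0⟩ := h.initial_u
  obtain ⟨q, hqc, hqd, hq0⟩ := h.initial_du
  have hIcc : 𝓝[>] (0 : ℝ) ≤ 𝓝[Icc 0 T] 0 := nhdsWithin_le_of_mem (Icc_mem_nhdsGT hT)
  have h0 : (0 : ℝ) ∈ Icc 0 T := ⟨le_rfl, hT.le⟩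
  obtain ⟨z, m, hz, hm, hmcl, hE⟩ := hW.exists_energy_identity (ellipticForm_symm hA)
    (ellipticForm_nonneg hA hΛ) (norm_sq_le_ellipticForm hA hΛ) hT
    ((hwc 0 h0).tendsto.mono_left hIcc) (by
      filter_upwards [hwu, ae_restrict_mem measurableSet_Ioo] with t ht htT
      rw [indicator_of_mem htT, ht])
    (q := fun v t => q t v) (q₀ := fun v => q 0 v)
    (fun v => (((ContinuousLinearMap.apply ℝ ℝ v).continuous.tendsto _).comp
      ((hqc 0 h0).tendsto.mono_left hIcc)))
    (fun v => by
      filter_upwards [hqd, ae_restrict_mem measurableSet_Ioo] with t ht htT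
      rw [indicator_of_mem htT, ht v, hMM])
  -- By density `M m` equals `M` of the restriction of `v₀`, so their difference is orthogonal to
  -- the range of the symmetric operator `M`. As `m` lies in the closure of that range, it is the
  -- projection of the restricted `v₀`.
  have hmv : ‖m‖ ≤ ‖v₀‖ := by
    have h1 : ∀ v : VSpace Ω U, ⟪M m - M (restrictL2 hUΩ v₀), VSpace.fn v⟫ = 0 := fun v => by
      rw [inner_sub_left, hMs, hm v, hq0 v, hMdef, inner_mulL2, sub_eq_zero]
      exact integral_congr_ae ((coeFn_restrictL2 hUΩ v₀).mono fun x hx => by simp only [hx])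
    have h2 : M m = M (restrictL2 hUΩ v₀) := sub_eq_zero.1 (VSpace.eq_zero_of_inner_fn hU hUΩ h1)
    have h3 : ⟪m, m⟫ = ⟪restrictL2 hUΩ v₀, m⟫ := by
      have hcl : IsClosed {y : L2 U | ⟪m, y⟫ = ⟪restrictL2 hUΩ v₀, y⟫} :=
        isClosed_eq (by fun_prop) (by fun_prop)
      refine closure_minimal ?_ hcl hmcl
      rintro _ ⟨y, rfl⟩
      rw [mem_ofPred_eq, ← hMs, h2, hMs]
    have h4 := (real_inner_le_norm (restrictL2 hUΩ v₀) m).trans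
      (mul_le_mul_of_nonneg_right (norm_restrictL2_le hUΩ v₀) (norm_nonneg m))
    rw [← h3, real_inner_self_eq_norm_mul_norm] at h4
    rcases (norm_nonneg m).eq_or_lt with h5 | h5
    · rw [← h5]; exact norm_nonneg _
    · exact le_of_mul_le_mul_right h4 h5
  -- The limit position coincides with `u₀` on `U`, hence so do the weak gradients.
  have hgz : ‖VSpace.grad z‖ ≤ ‖VSpace.grad u₀‖ := by
    have h1 := VSpace.grad_ae_eq hU hΩ hUΩ z u₀ (by rw [hz]; exact hw0)
    rw [Lp.norm_def, Lp.norm_def, eLpNorm_congr_ae h1]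
    exact ENNReal.toReal_mono (Lp.eLpNorm_ne_top _)
      (eLpNorm_mono_measure _ (Measure.restrict_mono hUΩ le_rfl))
  have hzz : ellipticForm Ω hA z z ≤ N ^ 2 * Λ * (‖VSpace.grad u₀‖ * ‖VSpace.grad u₀‖) :=
    ((le_abs_self _).trans (abs_ellipticForm_le hA hΛ z z)).trans (by gcongr)
  have hf2 : IntegrableOn (fun s => ‖f s‖ ^ 2) (Ioo 0 T) := hf.norm.integrable_sq
  have hd2 : IntegrableOn (fun s => ‖du s‖ ^ 2) (Ioo 0 T) := h.du_memLp.norm.integrable_sq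
  have hsd : Integrable fun s => ⟪(Ioo 0 T).indicator (source β ε hUΩ f du) s,
      (Ioo 0 T).indicator du s⟫ :=
    (hW.g_memLp.norm.integrable_mul hW.d_memLp.norm).mono' (hW.g_memLp.1.inner hW.d_memLp.1)
      (.of_forall fun s => norm_inner_le_norm _ _)
  have hsrc := ae_source (f := f) (du := du) hα hUΩ hβ
  filter_upwards [hE, ae_restrict_mem measurableSet_Ioo] with t ht htT
  have hsub : Ioc 0 t ⊆ Ioo 0 T := fun s hs => ⟨hs.1, hs.2.trans_lt htT.2⟩
  rw [indicator_of_mem htT, indicator_of_mem htT, energy] at ht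
  have h1 : ∫ s in (0 : ℝ)..t, ⟪(Ioo 0 T).indicator (source β ε hUΩ f du) s,
      (Ioo 0 T).indicator du s⟫ ≤
      ∫ s in Ioc 0 t, (1 / (2 * α) * ‖f s‖ ^ 2 - α / 2 * ‖du s‖ ^ 2) := by
    rw [intervalIntegral.integral_of_le htT.1.le]
    refine setIntegral_mono_on_ae hsd.integrableOn (((hf2.mono_set hsub).const_mul _).sub
      ((hd2.mono_set hsub).const_mul _)) measurableSet_Ioc ?_
    filter_upwards [hsrc] with s hs hst
    rw [indicator_of_mem (hsub hst), indicator_of_mem (hsub hst)]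
    exact hs.2.2
  rw [integral_sub ((hf2.mono_set hsub).const_mul _) ((hd2.mono_set hsub).const_mul _),
    integral_const_mul, integral_const_mul] at h1
  have h2 : ∫ s in Ioc 0 t, ‖f s‖ ^ 2 ≤ ∫ s in Ioo 0 T, ‖f s‖ ^ 2 :=
    setIntegral_mono_set hf2 (.of_forall fun s => by positivity) (LE.le.eventuallyLE hsub)
  have h3 := mul_le_mul_of_nonneg_left h2 (show 0 ≤ 1 / (2 * α) by positivity)
  have h4 : ‖m‖ ^ 2 ≤ ‖v₀‖ ^ 2 := by gcongr
  have h5 := le_ellipticForm hA (u t)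
  rw [intervalIntegral.integral_of_le htT.1.le]
  linarith

end IsSolution

/-- Continuity on the compact closure is enough: the bound may depend on `ε`, as it does not enter
the final constants. -/
theorem memLp_sqrt_oscRho (hU : Bornology.IsBounded U) (hρ : Continuous ρ) (ε : ℝ) :
    MemLp (fun x => √(oscRho ρ ε x)) ⊤ (volume.restrict U) := by
  have hc : Continuous fun x => √(oscRho ρ ε x) := by
    simp only [oscRho]
    fun_prop
  obtain ⟨C, hC⟩ := hU.isCompact_closure.exists_bound_of_continuousOn hc.continuousOn
  have h1 : MemLp (fun x => √(oscRho ρ ε x)) ⊤ (volume.restrict (closure U)) :=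
    memLp_top_of_bound hc.aestronglyMeasurable C
      ((ae_restrict_iff' isClosed_closure.measurableSet).2 (.of_forall hC))
  exact h1.mono_measure (Measure.restrict_mono subset_closure le_rfl)

/-- The dissipation over the whole time interval is bounded by a bound for almost every time. -/
theorem setIntegral_le_of_ae {D : ℝ → ℝ} (hT : 0 < T) (hD : IntegrableOn D (Ioo 0 T)) {C : ℝ}
    (hC : ∀ᵐ t ∂timeMeasure T, ∫ s in (0 : ℝ)..t, D s ≤ C) : ∫ s in Ioo 0 T, D s ≤ C := by
  have hD' : IntegrableOn D (Icc 0 T) :=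
    (integrableOn_Icc_iff_integrableOn_Ioo (by finiteness) (by finiteness)).2 hD
  have hcont : ContinuousOn (fun t => ∫ s in (0 : ℝ)..t, D s) (Icc 0 T) := by
    rw [← uIcc_of_le hT.le] at hD' ⊢
    exact intervalIntegral.continuousOn_primitive_interval hD'
  have hlim : Tendsto (fun t => ∫ s in (0 : ℝ)..t, D s) (𝓝[<] T) (𝓝 (∫ s in (0 : ℝ)..T, D s)) :=
    (hcont T ⟨hT.le, le_rfl⟩).tendsto.mono_left (nhdsWithin_le_of_mem (Icc_mem_nhdsLT hT))
  rw [← integral_Ioc_eq_integral_Ioo, ← intervalIntegral.integral_of_le hT.le]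
  -- If the bound failed throughout a left neighbourhood of `T`, the exceptional set would contain
  -- an interval of positive length.
  refine le_of_tendsto_of_frequently hlim fun hev => ?_
  obtain ⟨a, ha, haT⟩ := (mem_nhdsLT_iff_exists_Ioo_subset' hT).1 hev
  rw [ae_restrict_iff' measurableSet_Ioo] at hC
  have h0 : volume (Ioo (max a 0) T) = 0 := by
    refine measure_mono_null (fun t ht => ?_) hC
    have h1 := haT ⟨(le_max_left _ _).trans_lt ht.1, ht.2⟩
    exact fun h2 => h1 (h2 ⟨(le_max_right _ _).trans_lt ht.1, ht.2⟩)
  rw [Real.volume_Ioo, ENNReal.ofReal_eq_zero] at h0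
  have := max_lt ha hT
  linarith

end

/-! ### The uniform bounds and the dual norm of `ρ^ε u''` -/

section

variable {N : ℕ} {Ω U : Set (Space N)} {T ε α Λ b K c : ℝ}
  {A : Space N × Space N → Matrix (Fin N) (Fin N) ℝ} {ρ : Space N → ℝ} {β : Space N × ℝ → ℝ}
  {f : ℝ → L2 Ω} {u₀ : VSpace Ω Ω} {v₀ : L2 Ω}
  {u : ℝ → VSpace Ω U} {du : ℝ → L2 U} {rddu : ℝ → StrongDual ℝ (VSpace Ω U)}

theorem enorm_mulL2 {c : Space N → ℝ} (hc : MemLp c ⊤ (volume.restrict U)) (g : L2 U) :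
    ‖mulL2 c hc g‖ₑ = eLpNorm (fun x => c x * g x) 2 (volume.restrict U) := by
  rw [Lp.enorm_def]
  exact eLpNorm_congr_ae (coeFn_mulL2 hc g)

theorem eLpNorm_top_le_ofReal {E : Type*} [NormedAddCommGroup E] {g : ℝ → E} {C : ℝ}
    {μ : Measure ℝ} (h : ∀ᵐ t ∂μ, ‖g t‖ ≤ C) : eLpNorm g ⊤ μ ≤ ENNReal.ofReal C := by
  rw [eLpNorm_exponent_top]
  refine eLpNormEssSup_le_of_ae_enorm_bound (h.mono fun t ht => ?_)
  rw [← ofReal_norm]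
  exact ENNReal.ofReal_le_ofReal ht

theorem eLpNorm_const_mul_norm {E : Type*} [NormedAddCommGroup E] {g : ℝ → E} {C : ℝ}
    {μ : Measure ℝ} (hC : 0 ≤ C) (p : ℝ≥0∞) :
    eLpNorm (fun t => C * ‖g t‖) p μ = ENNReal.ofReal C * eLpNorm g p μ := by
  have h := eLpNorm_const_smul C (fun t => ‖g t‖) p μ
  rw [eLpNorm_norm, Real.enorm_of_nonneg hC] at h
  exact h

namespace IsSolution

theorem bounds_of_energy_le (h : IsSolution Ω U T ε A ρ β f u₀ v₀ u du rddu) (hT : 0 < T)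
    (hα : 0 < α) (hΛ : 0 < Λ) (hρU : MemLp (fun x => √(oscRho ρ ε x)) ⊤ (volume.restrict U))
    (hE : ∀ᵐ t ∂timeMeasure T, 1 / 2 * ‖mulL2 _ hρU (du t)‖ ^ 2 +
        1 / 2 * (Λ⁻¹ * ‖VSpace.grad (u t)‖ ^ 2) + α / 2 * ∫ s in (0 : ℝ)..t, ‖du s‖ ^ 2 ≤ K) :
    (∀ᵐ t ∂timeMeasure T, ‖VSpace.grad (u t)‖ ≤ √(2 * Λ * K)) ∧
      (∀ᵐ t ∂timeMeasure T, ‖mulL2 _ hρU (du t)‖ ≤ √(2 * K)) ∧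
      eLpNorm du 2 (timeMeasure T) ≤ ENNReal.ofReal √(2 * K / α) := by
  have hI : ∀ t ∈ Ioo 0 T, 0 ≤ α / 2 * ∫ s in (0 : ℝ)..t, ‖du s‖ ^ 2 := fun t ht =>
    mul_nonneg (by positivity)
      (intervalIntegral.integral_nonneg_of_forall ht.1.le fun s => by positivity)
  refine ⟨?_, ?_, ?_⟩
  · filter_upwards [hE, ae_restrict_mem measurableSet_Ioo] with t ht htT
    refine Real.le_sqrt_of_sq_le ?_
    have h1 : Λ⁻¹ * ‖VSpace.grad (u t)‖ ^ 2 ≤ 2 * K := by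
      have := hI t htT
      have := sq_nonneg ‖mulL2 _ hρU (du t)‖
      linarith
    calc ‖VSpace.grad (u t)‖ ^ 2 = Λ * (Λ⁻¹ * ‖VSpace.grad (u t)‖ ^ 2) := by field_simp
      _ ≤ Λ * (2 * K) := by gcongr
      _ = _ := by ring
  · filter_upwards [hE, ae_restrict_mem measurableSet_Ioo] with t ht htT
    refine Real.le_sqrt_of_sq_le ?_
    have := hI t htT
    have : 0 ≤ Λ⁻¹ * ‖VSpace.grad (u t)‖ ^ 2 := by positivity
    linarith
  · have h1 : ∫ s in Ioo 0 T, ‖du s‖ ^ 2 ≤ 2 * K / α := by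
      refine setIntegral_le_of_ae hT h.du_memLp.norm.integrable_sq ?_
      filter_upwards [hE] with t ht
      rw [le_div_iff₀ hα]
      have := sq_nonneg ‖mulL2 _ hρU (du t)‖
      have : 0 ≤ Λ⁻¹ * ‖VSpace.grad (u t)‖ ^ 2 := by positivity
      linarith
    rw [integral_norm_sq_eq h.du_memLp] at h1
    rw [← ENNReal.ofReal_toReal h.du_memLp.2.ne]
    exact ENNReal.ofReal_le_ofReal (Real.le_sqrt_of_sq_le h1)

/-- The equation expresses `rddu t` as the source minus the elliptic form. The latter is bounded
directly by gradients, the former through the Poincaré constant `c`. -/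
theorem ae_gradDualNorm_le (h : IsSolution Ω U T ε A ρ β f u₀ v₀ u du rddu) (hα : 0 < α)
    (hΛ : 0 < Λ) (hUΩ : U ⊆ Ω) (hA : IsUniformlyElliptic (oscA A ε) Λ)
    (hβ : ∀ᵐ t : ℝ, AEStronglyMeasurable (fun x => oscBeta β ε x t) volume ∧
      (∀ᵐ x, |oscBeta β ε x t| ≤ b) ∧ ∀ᵐ x, α ≤ oscBeta β ε x t)
    (hc : 0 ≤ c) (hP : ∀ v : VSpace Ω U, ‖VSpace.fn v‖ ≤ c * ‖VSpace.grad v‖) :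
    ∀ᵐ t ∂timeMeasure T, gradDualNorm (rddu t) ≤
      ENNReal.ofReal (c * ‖f t‖ + c * b * ‖du t‖ + N ^ 2 * Λ * ‖VSpace.grad (u t)‖) := by
  filter_upwards [ae_restrict_of_ae (ae_source (f := f) (du := du) hα hUΩ hβ),
    h.ae_inner_source hα hUΩ hA hβ] with t ht1 ht2
  refine iSup₂_le fun v hv => ?_
  rw [← ofReal_norm]
  refine ENNReal.ofReal_le_ofReal ?_
  have e : rddu t v = ⟪source β ε hUΩ f du t, VSpace.fn v⟫ - ellipticForm Ω hA (u t) v := by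
    rw [ht2 v, add_sub_cancel_right]
  have h1 : |⟪source β ε hUΩ f du t, VSpace.fn v⟫| ≤ (‖f t‖ + b * ‖du t‖) * c := by
    refine (abs_real_inner_le_norm _ _).trans ?_
    have h2 : ‖VSpace.fn v‖ ≤ c := (hP v).trans (mul_le_of_le_one_right hc hv)
    exact mul_le_mul ht1.2.1 h2 (norm_nonneg _) ((norm_nonneg _).trans ht1.2.1)
  have h3 : |ellipticForm Ω hA (u t) v| ≤ N ^ 2 * Λ * ‖VSpace.grad (u t)‖ := by
    refine (abs_ellipticForm_le hA hΛ (u t) v).trans ?_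
    gcongr
    exact mul_le_of_le_one_right (norm_nonneg _) hv
  rw [e, Real.norm_eq_abs]
  refine (abs_sub _ _).trans ?_
  linarith

theorem eLpNorm_gradDualNorm_le (h : IsSolution Ω U T ε A ρ β f u₀ v₀ u du rddu) (hα : 0 < α)
    (hf : MemLp f 2 (timeMeasure T))
    (hΛ : 0 < Λ) (hUΩ : U ⊆ Ω) (hA : IsUniformlyElliptic (oscA A ε) Λ)
    (hb : 0 ≤ b) (hβ : ∀ᵐ t : ℝ, AEStronglyMeasurable (fun x => oscBeta β ε x t) volume ∧
      (∀ᵐ x, |oscBeta β ε x t| ≤ b) ∧ ∀ᵐ x, α ≤ oscBeta β ε x t)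
    (hc : 0 ≤ c) (hP : ∀ v : VSpace Ω U, ‖VSpace.fn v‖ ≤ c * ‖VSpace.grad v‖)
    {G D : ℝ} (hG : 0 ≤ G) (hD : 0 ≤ D)
    (hu : ∀ᵐ t ∂timeMeasure T, ‖VSpace.grad (u t)‖ ≤ G)
    (hdu : eLpNorm du 2 (timeMeasure T) ≤ ENNReal.ofReal D) :
    eLpNorm (fun t => gradDualNorm (rddu t)) 2 (timeMeasure T) ≤
      ENNReal.ofReal (c * (eLpNorm f 2 (timeMeasure T)).toReal + c * b * D +
        N ^ 2 * Λ * G * ((timeMeasure T) univ ^ (2 : ℝ≥0∞).toReal⁻¹).toReal) := by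
  -- The comparison with this scalar function requires no measurability of the dual norm in time.
  -- The gradient term is bounded in time and contributes the square root of the length of `(0, T)`.
  have h1 : ∀ᵐ t ∂timeMeasure T, ‖gradDualNorm (rddu t)‖ₑ ≤
      ‖((fun t => c * ‖f t‖) + (fun t => c * b * ‖du t‖) + fun _ => N ^ 2 * Λ * G : ℝ → ℝ) t‖ₑ := by
    filter_upwards [h.ae_gradDualNorm_le hα hΛ hUΩ hA hβ hc hP, hu] with t ht hut
    rw [enorm_eq_self, Pi.add_apply, Pi.add_apply, Real.enorm_of_nonneg (by positivity)]
    exact ht.trans (ENNReal.ofReal_le_ofReal (by gcongr))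
  have m1 : AEStronglyMeasurable (fun t => c * ‖f t‖) (timeMeasure T) := hf.1.norm.const_mul c
  have m2 : AEStronglyMeasurable (fun t => c * b * ‖du t‖) (timeMeasure T) :=
    h.du_memLp.1.norm.const_mul (c * b)
  refine (eLpNorm_mono_enorm_ae h1).trans ((eLpNorm_add_le (m1.add m2)
    aestronglyMeasurable_const one_le_two).trans ?_)
  refine (add_le_add (eLpNorm_add_le m1 m2 one_le_two) (eLpNorm_le_of_ae_enorm_bound
    (.of_forall fun _ => le_rfl))).trans ?_
  have hne : (timeMeasure T) univ ^ (2 : ℝ≥0∞).toReal⁻¹ ≠ ⊤ := by simp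
  rw [eLpNorm_const_mul_norm hc, eLpNorm_const_mul_norm (by positivity),
    ENNReal.ofReal_add (by positivity) (by positivity),
    ENNReal.ofReal_add (by positivity) (by positivity), ENNReal.ofReal_mul (q := (eLpNorm f 2 _).toReal) hc,
    ENNReal.ofReal_mul (p := c * b) (by positivity), ENNReal.ofReal_mul (p := N ^ 2 * Λ * G)
    (by positivity), ENNReal.ofReal_toReal hf.2.ne, ENNReal.ofReal_toReal hne,
    Real.enorm_of_nonneg (by positivity), smul_eq_mul]
  gcongr

end IsSolution

end

end

/-! ### The a priori estimates -/

theorem mainTheorem5 {N : ℕ} (hN : 3 ≤ N)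
    {Ω : Set (Space N)} (hΩ_open : IsOpen Ω) (hΩ_conn : IsConnected Ω)
    (hΩ_bdd : Bornology.IsBounded Ω) (hΩ_lip : HasLipschitzBoundary Ω)
    {Θ : Set (Space N)} (hΘ : IsReferenceHole Θ)
    {T : ℝ} (hT : 0 < T)
    {A : Space N × Space N → Matrix (Fin N) (Fin N) ℝ} {Λ : ℝ} (hA1 : AssumptionA1 A Λ)
    {ρ : Space N → ℝ} {β : Space N × ℝ → ℝ} {α : ℝ} (hA2 : AssumptionA2 ρ β α)
    (hA3 : AssumptionA3 Θ A ρ β)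
    {f : ℝ → L2 Ω} (hf : MemLp f 2 (timeMeasure T)) (u₀ : VSpace Ω Ω) (v₀ : L2 Ω) :
    ∃ C : ℝ, 0 < C ∧ ∀ ε : ℝ, 0 < ε →
      ∀ (u : ℝ → VSpace Ω (perforated Ω Θ ε)) (du : ℝ → L2 (perforated Ω Θ ε))
        (rddu : ℝ → StrongDual ℝ (VSpace Ω (perforated Ω Θ ε))),
        IsSolution Ω (perforated Ω Θ ε) T ε A ρ β f u₀ v₀ u du rddu →
          eLpNorm (fun t => VSpace.grad (u t)) ⊤ (timeMeasure T) ≤ ENNReal.ofReal C ∧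
          eLpNorm (fun t => eLpNorm (fun x => √(oscRho ρ ε x) * du t x) 2
            (volume.restrict (perforated Ω Θ ε))) ⊤ (timeMeasure T) ≤ ENNReal.ofReal C ∧
          eLpNorm du 2 (timeMeasure T) ≤ ENNReal.ofReal C ∧
          eLpNorm (fun t => gradDualNorm (rddu t)) 2 (timeMeasure T) ≤ ENNReal.ofReal C := by
  obtain ⟨c, hc, hP⟩ := exists_norm_fn_le (by omega : 2 ≤ N) hΩ_open.measurableSet hΩ_bdd hΘ
  obtain ⟨b, hb, hβ⟩ := ae_oscBeta hA2.beta_memLp hA2.beta_lower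
  have hα := hA2.pos
  have hΛ := hA1.pos
  -- `K` is the right-hand side of the energy inequality and `R` the resulting bound on the dual
  -- norm; neither involves `ε`.
  obtain ⟨K, hK⟩ : ∃ K : ℝ, K = 1 / 2 * ‖v₀‖ ^ 2 +
    1 / 2 * (N ^ 2 * Λ * (‖VSpace.grad u₀‖ * ‖VSpace.grad u₀‖)) +
      1 / (2 * α) * ∫ s in Ioo 0 T, ‖f s‖ ^ 2 := ⟨_, rfl⟩
  obtain ⟨R, hR⟩ : ∃ R : ℝ, R = c * (eLpNorm f 2 (timeMeasure T)).toReal + c * b * √(2 * K / α) +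
    N ^ 2 * Λ * √(2 * Λ * K) * ((timeMeasure T) univ ^ (2 : ENNReal).toReal⁻¹).toReal := ⟨_, rfl⟩
  have hR0 : 0 ≤ R := by rw [hR]; positivity
  have h1 := Real.sqrt_nonneg (2 * Λ * K)
  have h2 := Real.sqrt_nonneg (2 * K)
  have h3 := Real.sqrt_nonneg (2 * K / α)
  -- The sum dominates each of the four bounds; the added `1` makes it positive even for zero data.
  refine ⟨√(2 * Λ * K) + √(2 * K) + √(2 * K / α) + R + 1, by positivity,
    fun ε hε u du rddu h => ?_⟩
  have hUΩ : perforated Ω Θ ε ⊆ Ω := perforated_subset _ _ _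
  have hU := isOpen_perforated hΩ_open hΩ_bdd hΘ hε
  have hρU := memLp_sqrt_oscRho (hΩ_bdd.subset hUΩ) hA2.rho_contDiff.continuous ε
  have hE := h.ae_energy_le hf hT hα hΛ hΩ_open.measurableSet hU hUΩ (hA1.elliptic_osc ε hε)
    (hβ ε hε) (fun x => hA2.rho_nonneg _) hρU
  rw [← hK] at hE
  obtain ⟨hgrad, hrho, hdu⟩ := h.bounds_of_energy_le hT hα hΛ hρU hE
  refine ⟨(eLpNorm_top_le_ofReal hgrad).trans (ENNReal.ofReal_le_ofReal (by linarith)), ?_,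
    hdu.trans (ENNReal.ofReal_le_ofReal (by linarith)),
    (h.eLpNorm_gradDualNorm_le hα hf hΛ hUΩ (hA1.elliptic_osc ε hε) hb (hβ ε hε) hc (hP ε hε)
      h1 h3 hgrad hdu).trans (ENNReal.ofReal_le_ofReal (by rw [← hR]; linarith))⟩
  rw [eLpNorm_exponent_top]
  refine (eLpNormEssSup_le_of_ae_enorm_bound (C := ENNReal.ofReal √(2 * K)) ?_).trans
    (ENNReal.ofReal_le_ofReal (by linarith))
  filter_upwards [hrho] with t ht
  rw [enorm_eq_self, ← enorm_mulL2 hρU, ← ofReal_norm]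
  exact ENNReal.ofReal_le_ofReal ht
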